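/- **Proposition (Reduction to the Special Case).** Let $n\ge 2$ be an integer, $T>0$, and let $p_0,\dots,p_{2n-2}:\mathbb R\to\mathbb R$ be $T$-periodic with $p_0\in C^0$, $p_j\in C^1$ for $1\le j\le n-1$ and $p_j\in C^2$ for $n\le j\le 2n-2$. Let $\mathrm{sn}$ be the solution of $\xi''+n\xi^{2n-1}=0$, $\xi(0)=0$, $\xi'(0)=1$, and let $\tau>0$ be the first positive time with $\mathrm{sn}(\tau)=1$ (so $\mathrm{sn}$ is $4\tau$-periodic). In the variables $(K,\kappa)$, $K>0$, with $\kappa$ taken modulo $4\tau$ and equations of motion $\dot K=\partial H/\partial\kappa$, $\dot\kappa=-\partial H/\partial K$, consider $$H(K,\kappa,t)=\tfrac{n+1}{2n}K^{\frac{2n}{n+1}}+\sum_{j=1}^{2n-1}K^{\frac{j}{n+1}}f_j^{0}(\kappa,t),\qquad f_j^{0}(\kappa,t)=-\tfrac{n+1}{jn}\,\mathrm{sn}^j(\kappa)\,p_{j-1}(t).$$ For $m\in\{1,n\}$ say that a Hamiltonian is in $m$-normal form on $K\ge b$ if it is $$\tfrac{n+1}{2n}K^{\frac{2n}{n+1}}+\sum_{j=m+1}^{2n-1}K^{\frac{j}{n+1}}\bar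 f_j(t)+\sum_{j=-\infty}^{m}K^{\frac{j}{n+1}}f_j(\kappa,t),$$ where the $\bar f_j$ are continuous and $T$-periodic, the $f_j$ are continuous, analytic and $4\tau$-periodic in $\kappa$, $T$-periodic in $t$, and the infinite series converges uniformly for $K\ge b$ and all $\kappa,t$. The case $m=1$ is the special case. Write $\{A,B\}=A_KB_\kappa-A_\kappa B_K$. For sequences $A=(A_j)_{j\ge0}$ and $(W_r)_{r\ge1}$ of functions of $(K,\kappa,t)$, let $A_j^0=A_j$ and $A_j^i=A_{j+1}^{i-1}+\sum_{k=0}^{j}\binom jk\{A_{j-k}^{i-1},W_{k+1}\}$. Let $H_{*}=\sum_{i\ge 0}\frac{\varepsilon^i}{i!}H_i$ be obtained from a Hamiltonian of the above kind by multiplying the term with $K^{(2n-i)/(n+1)}$ by $\varepsilon^i$. Then there are constants $K_1,K_2>0$, finite generating functions $$W^{(1)}=\sum_{r=1}^{n-1}\tfrac{\varepsilon^{r-1}}{(r-1)!}W^{(1)}_r,\qquad W^{(2)}=\sum_{r=n}^{2n-2}\tfrac{\varepsilon^{r-1}}{(r-1)!}W^{(2)}_r,$$ with $W^{(\ell)}_r=K^{\frac{n-r+1}{n+1}}\tilde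 F^{(\ell)}_r(\kappa,t)$, where $\tilde F^{(\ell)}_r$ is $C^1$, analytic in $\kappa$, $4\tau$-periodic with mean value zero in $\kappa$, and $T$-periodic in $t$, a Hamiltonian $\mathcal H_1$ in $n$-normal form on $K\ge K_1$, and a Hamiltonian $\mathcal H$ in $1$-normal form (the special case) on $K\ge K_2$, such that the following holds for the steps $(H,W^{(1)},\mathcal H_1)$, with $m=n$, $a=0$, $b=K_1$, and $(\mathcal H_1,W^{(2)},\mathcal H)$, with $m=1$, $a=K_1$, $b=K_2$. 1. *Convergence up to $\varepsilon=1$.* The solution $X_\varepsilon(K,\kappa,t)$ of $dK/d\varepsilon=\partial W/\partial\kappa$, $d\kappa/d\varepsilon=-\partial W/\partial K$ with $X_0=(K,\kappa)$ exists for $0\le\varepsilon\le1$, all $K\ge b$ and all $\kappa,t$, and stays in the domain $K>a$. For each of $A_*=K$, $A_*=\kappa$, $A_*=H_*$ (for the step's old Hamiltonian) and $A_*=-\partial W/\partial t$, written as $A_*=\sum\frac{\varepsilon^i}{i!}A_i$, the series $\sum_{i\ge0}\frac{\varepsilon^i}{i!}A_0^i(K,\kappa,t)$ converges uniformly for $0\le\varepsilon\le1$,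 $K\ge b$ and all $\kappa,t$, to the value of $A_*(\cdot,t,\varepsilon)$ at $X_\varepsilon(K,\kappa,t)$. 2. *Removal of $\kappa$.* Let $H_0^i$ and $R_0^i$ be the entries so obtained from $H_*$ and $-\partial W/\partial t$. On $K>a$, $H_0^i=K^{\frac{2n-i}{n+1}}F_i(\kappa,t)$ and $R_0^i=K^{\frac{n-i}{n+1}}G_i(\kappa,t)$ for all $i\ge0$, with $F_i,G_i$ continuous, analytic and $4\tau$-periodic in $\kappa$, $T$-periodic in $t$; and $F_i$ does not depend on $\kappa$ if $i\ge1$ and $2n-i>m$. 3. *New Hamiltonian.* The new Hamiltonian equals $H_0^0+\sum_{i\ge1}\frac1{i!}\left(H_0^i+R_0^{i-1}\right)$, with uniform convergence for $K\ge b$ and all $\kappa,t$. 4. *Change of variables.* $\Phi=X_1$ maps $K>b$ into $K>a$, is $C^1$ in $(K,\kappa,t)$, $T$-periodic in $t$, satisfies $\Phi(K,\kappa+4\tau,t)=\Phi(K,\kappa,t)+(0,4\tau)$, and for each $t$ preserves $dK\wedge d\kappa$, is injective, and has an image that contains $\{K>c\}$ for some $c$ independent of $t$. The new Hamiltonian is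 differentiable in $(K,\kappa)$ on $K>b$, and a curve $y(t)$ in $K>b$, on an open interval, solves the equations of the new Hamiltonian if and only if $\Phi(y(t),t)$ solves those of the old one. Moreover, the composition $\Phi_1\circ\Phi_2$ of the two changes of variables has the properties in 4 with $a=0$, $b=K_2$: it is an invertible symplectic change of variables that transforms $H$ to the special Hamiltonian $\mathcal H$. -/

import Mathlib

namespace LieOscillator

/-! ### The reference solution -/

section

open Set
theorem exists_global_solution {f : ℝ × ℝ → ℝ × ℝ} {k C : NNReal}
    (hf : LipschitzWith k f) (hC : ∀ z, ‖f z‖ ≤ C) (z₀ : ℝ × ℝ) :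
    ∃ γ : ℝ → ℝ × ℝ, γ 0 = z₀ ∧ ∀ t, HasDerivAt γ (f (γ t)) t := by
  have key : ∀ a : ℝ, 0 < a → ∃ γ : ℝ → ℝ × ℝ, γ 0 = z₀ ∧
      ∀ t ∈ Ioo (-a) a, HasDerivAt γ (f (γ t)) t := by
    intro a ha
    have h0 : (0 : ℝ) ∈ Icc (-a) a := ⟨by linarith, ha.le⟩
    have hpl : IsPicardLindelof (fun _ => f) (⟨0, h0⟩ : Icc (-a) a) z₀ (C * ⟨a, ha.le⟩) 0 C k :=
      { lipschitzOnWith := fun _ _ => hf.lipschitzOnWith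
        continuousOn := fun _ _ => continuousOn_const
        norm_le := fun _ _ x _ => hC x
        mul_max_le := by simp; exact le_rfl }
    obtain ⟨γ, h1, h2⟩ := hpl.exists_eq_forall_mem_Icc_hasDerivWithinAt₀
    exact ⟨γ, h1, fun t ht => (h2 t (Ioo_subset_Icc_self ht)).hasDerivAt (Icc_mem_nhds ht.1 ht.2)⟩
  choose! γ h1 h2 using key
  have heq : ∀ a b : ℝ, 0 < a → a ≤ b → EqOn (γ a) (γ b) (Ioo (-a) a) := by
    intro a b ha hab
    refine ODE_solution_unique_of_mem_Ioo (v := fun _ => f) (s := fun _ => univ) (K := k) (t₀ := 0)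
      (fun _ _ => hf.lipschitzOnWith) ⟨by linarith, ha⟩ (fun t ht => ⟨h2 a ha t ht, mem_univ _⟩)
      (fun t ht => ⟨h2 b (ha.trans_le hab) t ⟨by linarith [ht.1], ht.2.trans_le hab⟩, mem_univ _⟩) ?_
    rw [h1 a ha, h1 b (ha.trans_le hab)]
  refine ⟨fun t => γ (|t| + 1) t, h1 _ (by positivity), fun t => ?_⟩
  have hb : 0 < |t| + 2 := by positivity
  have hmem : t ∈ Ioo (-(|t| + 1)) (|t| + 1) :=
    ⟨by linarith [neg_abs_le t], by linarith [le_abs_self t]⟩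
  have hev : (fun s => γ (|s| + 1) s) =ᶠ[nhds t] γ (|t| + 2) := by
    filter_upwards [Ioo_mem_nhds hmem.1 hmem.2] with s hs
    have hs' : |s| < |t| + 1 := abs_lt.2 hs
    exact heq (|s| + 1) (|t| + 2) (by positivity) (by linarith)
      ⟨by linarith [neg_abs_le s], by linarith [le_abs_self s]⟩
  have h := h2 (|t| + 2) hb t ⟨by linarith [neg_abs_le t], by linarith [le_abs_self t]⟩
  have h' := h.congr_of_eventuallyEq hev
  rwa [← hev.self_of_nhds] at h'

noncomputable def clampOne (x : ℝ) : ℝ := max (-1) (min x 1)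

theorem clampOne_lip : LipschitzWith 1 clampOne :=
  ((LipschitzWith.id.min_const 1).const_max (-1))

theorem abs_clampOne_le (x : ℝ) : |clampOne x| ≤ 1 :=
  abs_le.2 ⟨le_max_left _ _, max_le (by norm_num) (min_le_right _ _)⟩

theorem clampOne_of_abs_le {x : ℝ} (h : |x| ≤ 1) : clampOne x = x := by
  have := abs_le.1 h
  rw [clampOne, min_eq_left this.2, max_eq_right this.1]

theorem clampOne_neg (x : ℝ) : clampOne (-x) = -clampOne x := by
  unfold clampOne; grind

noncomputable def clampPrim (m : ℕ) (x : ℝ) : ℝ := ∫ s in (0 : ℝ)..x, clampOne s ^ m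

theorem hasDerivAt_clampPrim (m : ℕ) (x : ℝ) :
    HasDerivAt (clampPrim m) (clampOne x ^ m) x :=
  ((clampOne_lip.continuous.pow m).integral_hasStrictDerivAt 0 x).hasDerivAt

theorem clampPrim_neg {m : ℕ} (hm : Odd m) (x : ℝ) : clampPrim m (-x) = clampPrim m x := by
  have h := intervalIntegral.integral_comp_neg (a := 0) (b := x) (fun s => clampOne s ^ m)
  simp only [clampOne_neg, hm.neg_pow, neg_zero, intervalIntegral.integral_neg] at h
  unfold clampPrim
  rw [intervalIntegral.integral_symm, ← h, neg_neg]

theorem clampPrim_one (m : ℕ) : clampPrim m 1 = 1 / (m + 1) := by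
  unfold clampPrim
  rw [intervalIntegral.integral_congr (g := fun s => s ^ m)]
  · simp
  · intro s hs
    rw [uIcc_of_le zero_le_one] at hs
    simp only
    rw [clampOne_of_abs_le (abs_le.2 ⟨by linarith [hs.1], hs.2⟩)]

theorem clampOne_nonneg {x : ℝ} (h : 0 ≤ x) : 0 ≤ clampOne x :=
  le_max_of_le_right (le_min h zero_le_one)

theorem clampPrim_nonneg {m : ℕ} (hm : Odd m) (x : ℝ) : 0 ≤ clampPrim m x := by
  have h : ∀ y : ℝ, 0 ≤ y → 0 ≤ clampPrim m y := fun y hy =>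
    intervalIntegral.integral_nonneg hy fun s hs => pow_nonneg (clampOne_nonneg hs.1) m
  rcases le_total 0 x with hx | hx
  · exact h x hx
  · rw [← clampPrim_neg hm]; exact h _ (by linarith)

theorem abs_le_one_of_clampPrim_le {m : ℕ} (hm : Odd m) {x : ℝ}
    (h : clampPrim m x ≤ 1 / (m + 1)) : |x| ≤ 1 := by
  have key : ∀ y : ℝ, clampPrim m y ≤ 1 / (m + 1) → y ≤ 1 := by
    intro y hy
    by_contra! hlt
    have hc := (clampOne_lip.continuous.pow m).intervalIntegrable (μ := MeasureTheory.volume)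
    have h1 : clampPrim m y = clampPrim m 1 + ∫ s in (1 : ℝ)..y, clampOne s ^ m :=
      (intervalIntegral.integral_add_adjacent_intervals (hc 0 1) (hc 1 y)).symm
    have h2 : ∫ s in (1 : ℝ)..y, clampOne s ^ m = y - 1 := by
      rw [intervalIntegral.integral_congr (g := fun _ => (1 : ℝ))]
      · simp
      · intro s hs
        rw [uIcc_of_le hlt.le] at hs
        simp [clampOne, min_eq_right hs.1]
    rw [h1, h2, clampPrim_one] at hy
    linarith
  exact abs_le.2 ⟨by linarith [key (-x) (by rwa [clampPrim_neg hm])], key x h⟩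

structure IsRefSolution (n : ℕ) (ξ : ℝ → ℝ) : Prop where
  init : ξ 0 = 0
  init_deriv : deriv ξ 0 = 1
  differentiable : Differentiable ℝ ξ
  ode : ∀ κ, HasDerivAt (deriv ξ) (-((n : ℝ) * ξ κ ^ (2 * n - 1))) κ

theorem exists_isRefSolution {n : ℕ} (hn : 1 ≤ n) : ∃ ξ, IsRefSolution n ξ := by
  set m := 2 * n - 1 with hm
  have hodd : Odd m := ⟨n - 1, by omega⟩
  have hmn : ((m : ℝ) + 1) = 2 * n := by
    have : m + 1 = 2 * n := by omega
    exact_mod_cast this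
  have hn0 : (0 : ℝ) < n := by exact_mod_cast hn
  let f : ℝ × ℝ → ℝ × ℝ := fun z => (clampOne z.2, -((n : ℝ) * clampOne z.1 ^ m))
  have hpow : LipschitzWith (n * m) (fun x => -((n : ℝ) * clampOne x ^ m)) := by
    refine LipschitzWith.of_dist_le_mul fun x y => ?_
    have h1 := clampOne_lip.dist_le_mul x y
    rw [Real.dist_eq] at h1
    have h2 : max |clampOne x| |clampOne y| ^ (m - 1) ≤ 1 :=
      pow_le_one₀ (le_max_of_le_left (abs_nonneg _))
        (max_le (abs_clampOne_le x) (abs_clampOne_le y))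
    simp only [NNReal.coe_one, one_mul] at h1
    rw [dist_neg_neg, Real.dist_eq, ← mul_sub, abs_mul, abs_of_pos hn0]
    calc (n : ℝ) * |clampOne x ^ m - clampOne y ^ m|
        ≤ n * (|clampOne x - clampOne y| * m * max |clampOne x| |clampOne y| ^ (m - 1)) := by
          gcongr; exact abs_pow_sub_pow_le _ _ _
      _ ≤ n * (dist x y * m * 1) := by gcongr
      _ = _ := by push_cast; ring
  have hk := (clampOne_lip.comp LipschitzWith.prod_snd).prodMk (hpow.comp LipschitzWith.prod_fst)
  have hB : ∀ z, ‖f z‖ ≤ ((1 + n : NNReal) : ℝ) := by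
    intro z
    refine max_le ?_ ?_
    · rw [Real.norm_eq_abs]; exact (abs_clampOne_le _).trans (by simp)
    · rw [norm_neg, Real.norm_eq_abs, abs_mul, abs_pow, abs_of_pos hn0]
      have := pow_le_one₀ (n := m) (abs_nonneg _) (abs_clampOne_le z.1)
      push_cast
      nlinarith
  obtain ⟨γ, h0, hγ⟩ := exists_global_solution (f := f) hk hB (0, 1)
  have hx : ∀ t, HasDerivAt (fun s => (γ s).1) (clampOne (γ t).2) t := fun t => (hγ t).fst
  have hy : ∀ t, HasDerivAt (fun s => (γ s).2) (-((n : ℝ) * clampOne (γ t).1 ^ m)) t :=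
    fun t => (hγ t).snd
  let E : ℝ → ℝ := fun t => clampPrim 1 (γ t).2 + n * clampPrim m (γ t).1
  have hE : ∀ t, HasDerivAt E 0 t := by
    intro t
    have h1 := (hasDerivAt_clampPrim 1 (γ t).2).comp t (hy t)
    have h2 := ((hasDerivAt_clampPrim m (γ t).1).comp t (hx t)).const_mul (n : ℝ)
    convert! h1.add h2 using 1
    ring
  have hE' : ∀ t, E t = 1 / 2 := by
    intro t
    rw [is_const_of_deriv_eq_zero (fun t => (hE t).differentiableAt) (fun t => (hE t).deriv) t 0]
    simp only [E, h0, clampPrim_one]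
    simp [clampPrim]
    norm_num
  have hbx : ∀ t, |(γ t).1| ≤ 1 := fun t => by
    refine abs_le_one_of_clampPrim_le hodd ?_
    have h1 := hE' t
    have h2 := clampPrim_nonneg odd_one (γ t).2
    rw [hmn, le_div_iff₀ (by positivity)]
    simp only [E] at h1
    linarith
  have hby : ∀ t, |(γ t).2| ≤ 1 := fun t => by
    refine abs_le_one_of_clampPrim_le odd_one ?_
    have h1 := hE' t
    have h2 := mul_nonneg hn0.le (clampPrim_nonneg hodd (γ t).1)
    simp only [E] at h1
    norm_num
    linarith
  have hd : deriv (fun s => (γ s).1) = fun s => (γ s).2 := by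
    funext t
    rw [(hx t).deriv, clampOne_of_abs_le (hby t)]
  refine ⟨fun s => (γ s).1, by simp [h0], by simp [hd, h0], fun t => (hx t).differentiableAt, ?_⟩
  intro t
  rw [hd]
  have := hy t
  rwa [clampOne_of_abs_le (hbx t)] at this

end

/-- `sn n` is the solution `ξ` of `ξ'' + n ξ^(2n-1) = 0`, `ξ(0) = 0`, `ξ'(0) = 1`. -/
noncomputable def sn (n : ℕ) : ℝ → ℝ := Classical.epsilon (IsRefSolution n)

theorem sn_isRefSolution {n : ℕ} (hn : 1 ≤ n) : IsRefSolution n (sn n) :=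
  Classical.epsilon_spec (exists_isRefSolution hn)

/-- `tau n` is the first positive time at which `sn n` reaches its maximum value `1`;
`sn n` is periodic with period `4 * tau n`. -/
noncomputable def tau (n : ℕ) : ℝ := sInf {κ : ℝ | 0 < κ ∧ sn n κ = 1}

/-! ### Hamiltonians in the variables `(K, κ)`, depending on time `t` -/

/-- A real function of `K`, `κ`, `t` (in this order). Only its values for `K > 0` matter. -/
abbrev PhaseFun : Type := ℝ → ℝ → ℝ → ℝ

/-- The power `K ^ (j / (n + 1))`. -/
noncomputable def kpow (n : ℕ) (j : ℤ) (K : ℝ) : ℝ := K ^ ((j : ℝ) / ((n : ℝ) + 1))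

/-- The leading term `(n + 1) / (2 n) * K ^ (2 n / (n + 1))`. -/
noncomputable def leadTerm (n : ℕ) (K : ℝ) : ℝ :=
  ((n : ℝ) + 1) / (2 * (n : ℝ)) * kpow n (2 * (n : ℤ)) K

/-- The coefficient `f_j(κ, t) = - (n + 1) / (j n) * sn(κ) ^ j * p_{j-1}(t)`, for `j ≥ 1`. -/
noncomputable def origCoeff (n : ℕ) (p : ℕ → ℝ → ℝ) (j : ℕ) (κ t : ℝ) : ℝ :=
  -(((n : ℝ) + 1) / ((j : ℝ) * (n : ℝ))) * sn n κ ^ j * p (j - 1) t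

/-- The original Hamiltonian in action-angle variables,
`(n + 1) / (2 n) * K ^ (2 n / (n + 1)) + ∑_{j=1}^{2n-1} K ^ (j / (n + 1)) * f_j(κ, t)`. -/
noncomputable def origHam (n : ℕ) (p : ℕ → ℝ → ℝ) : PhaseFun := fun K κ t =>
  leadTerm n K + ∑ j ∈ Finset.Icc 1 (2 * n - 1), kpow n (j : ℤ) K * origCoeff n p j κ t

/-- The Hamiltonian
`(n+1)/(2n) * K^(2n/(n+1)) + ∑_{j=m+1}^{2n-1} K^(j/(n+1)) * fbar_j(t)
  + ∑_{j=-∞}^{m} K^(j/(n+1)) * f_j(κ,t)`.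
The special case is `m = 1`, the intermediate Hamiltonian is `m = n`. -/
noncomputable def normalHam (n : ℕ) (m : ℤ) (fbar : ℤ → ℝ → ℝ) (f : ℤ → ℝ → ℝ → ℝ) :
    PhaseFun := fun K κ t =>
  leadTerm n K + ∑ j ∈ Finset.Icc (m + 1) (2 * (n : ℤ) - 1), kpow n j K * fbar j t
    + ∑' j : Set.Iic m, kpow n (j : ℤ) K * f (j : ℤ) κ t

/-- `F(κ, t)` is continuous, real-analytic and `4τ`-periodic in `κ`, and `T`-periodic in `t`. -/
structure IsCoefficient (n : ℕ) (T : ℝ) (F : ℝ → ℝ → ℝ) : Prop where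
  continuous : Continuous fun q : ℝ × ℝ => F q.1 q.2
  analytic : ∀ t κ, AnalyticAt ℝ (fun k => F k t) κ
  periodic_angle : ∀ κ t, F (κ + 4 * tau n) t = F κ t
  periodic_time : ∀ κ t, F κ (t + T) = F κ t

/-- The conditions on the coefficients of `normalHam`: regularity, periodicity, and uniform
convergence of the infinite series for `K ≥ b` and all `κ`, `t`. -/
structure IsNormalForm (n : ℕ) (T : ℝ) (m : ℤ) (b : ℝ) (fbar : ℤ → ℝ → ℝ)
    (f : ℤ → ℝ → ℝ → ℝ) : Prop where
  continuous_bar : ∀ j, m < j → j ≤ 2 * (n : ℤ) - 1 → Continuous (fbar j)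
  periodic_bar : ∀ j, m < j → j ≤ 2 * (n : ℤ) - 1 → Function.Periodic (fbar j) T
  coefficient : ∀ j, j ≤ m → IsCoefficient n T (f j)
  uniform : SummableUniformlyOn
    (fun (j : Set.Iic m) (q : ℝ × ℝ × ℝ) => kpow n (j : ℤ) q.1 * f (j : ℤ) q.2.1 q.2.2)
    {q | b ≤ q.1}

/-! ### Hamiltonian systems and symplectic changes of variables -/

/-- The Hamiltonian vector field `K' = ∂H/∂κ`, `κ' = -∂H/∂K`. -/
noncomputable def hamField (H : PhaseFun) (t : ℝ) (z : ℝ × ℝ) : ℝ × ℝ :=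
  (deriv (fun x => H z.1 x t) z.2, -deriv (fun k => H k z.2 t) z.1)

/-- The curve `y = (K, κ)` solves the Hamiltonian system of `H` on `I`. -/
def IsHamSolution (H : PhaseFun) (y : ℝ → ℝ × ℝ) (I : Set ℝ) : Prop :=
  ∀ t ∈ I, HasDerivAt y (hamField H t (y t)) t

/-- `Φ(K, κ, t)` is an invertible symplectic change of variables near `K = ∞`, periodic in `t`,
from the domain `K > b` into the domain `K > a` of the `(K, κ)`-cylinder (on which `κ` has period
`4τ`); its image contains a neighbourhood of `K = ∞`. -/
structure IsSymplecticChange (n : ℕ) (T a b : ℝ) (Φ : ℝ → ℝ → ℝ → ℝ × ℝ) : Prop where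
  maps : ∀ K κ t, b < K → a < (Φ K κ t).1
  contDiff : ContDiffOn ℝ 1 (fun q : ℝ × ℝ × ℝ => Φ q.1 q.2.1 q.2.2) {q | b < q.1}
  angle : ∀ K κ t, b < K → Φ K (κ + 4 * tau n) t = Φ K κ t + (0, 4 * tau n)
  periodic_time : ∀ K κ t, b < K → Φ K κ (t + T) = Φ K κ t
  /-- the two-form `dK ∧ dκ` is preserved at each fixed time -/
  symplectic : ∀ K κ t, b < K → ∀ u v : ℝ × ℝ,
    let D := fderiv ℝ (fun z : ℝ × ℝ => Φ z.1 z.2 t) (K, κ)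
    (D u).1 * (D v).2 - (D u).2 * (D v).1 = u.1 * v.2 - u.2 * v.1
  injective : ∀ t, Set.InjOn (fun z : ℝ × ℝ => Φ z.1 z.2 t) {z | b < z.1}
  surjective : ∃ c : ℝ, ∀ t,
    {z : ℝ × ℝ | c < z.1} ⊆ (fun z : ℝ × ℝ => Φ z.1 z.2 t) '' {z | b < z.1}

/-- The time-dependent change of variables `(K, κ) = Φ(K', κ', t)`, `K' > b`, transforms the
Hamiltonian system of `H` into the one of `G`: a curve solves the system of `G` exactly if its
image solves the system of `H`. -/
def TransformsHam (b : ℝ) (H G : PhaseFun) (Φ : ℝ → ℝ → ℝ → ℝ × ℝ) : Prop :=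
  (∀ t, DifferentiableOn ℝ (fun z : ℝ × ℝ => G z.1 z.2 t) {z | b < z.1}) ∧
  ∀ (α β : ℝ) (y : ℝ → ℝ × ℝ), (∀ t ∈ Set.Ioo α β, b < (y t).1) →
    (IsHamSolution G y (Set.Ioo α β) ↔
      IsHamSolution H (fun t => Φ (y t).1 (y t).2 t) (Set.Ioo α β))

/-! ### Lie transforms -/

/-- The Poisson bracket `{A, B} = A_K B_κ - A_κ B_K`. -/
noncomputable def bracket (A B : PhaseFun) : PhaseFun := fun K κ t =>
  deriv (fun k => A k κ t) K * deriv (fun x => B K x t) κ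
    - deriv (fun x => A K x t) κ * deriv (fun k => B k κ t) K

/-- The Lie triangle: `lieTriangle W A i j` is the entry `A_j^i` defined by `A_j^0 = A j` and
`A_j^i = A_{j+1}^{i-1} + ∑_{k=0}^{j} (j choose k) {A_{j-k}^{i-1}, W_{k+1}}`. -/
noncomputable def lieTriangle (W A : ℕ → PhaseFun) : ℕ → ℕ → PhaseFun
  | 0, j => A j
  | i + 1, j => fun K κ t => lieTriangle W A i (j + 1) K κ t
      + ∑ k ∈ Finset.range (j + 1),
          (j.choose k : ℝ) * bracket (lieTriangle W A i (j - k)) (W (k + 1)) K κ t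

/-- The term `ε ^ i / i! * A_i` of the series with coefficients `A`. -/
noncomputable def epsTerm (A : ℕ → PhaseFun) (ε : ℝ) (i : ℕ) : PhaseFun := fun K κ t =>
  ε ^ i / (i.factorial : ℝ) * A i K κ t

/-- The finite generating function `W(K, κ, t, ε) = ∑_{r ∈ s} ε ^ (r-1) / (r-1)! * W_r(K, κ, t)`,
where `s` is the set of rows `r ≥ 1` that occur. -/
noncomputable def genFun (s : Finset ℕ) (W : ℕ → PhaseFun) (ε : ℝ) : PhaseFun := fun K κ t =>
  ∑ r ∈ s, epsTerm (fun i => W (i + 1)) ε (r - 1) K κ t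

/-- The terms `W_r`, `r ∈ s`, are of the form `K ^ ((n - r + 1) / (n + 1)) * F(κ, t)` with `F` of
class `C^1`, analytic in `κ`, periodic, and with mean value zero in `κ`; all other `W_r` vanish. -/
structure IsGenerator (n : ℕ) (T : ℝ) (s : Finset ℕ) (W : ℕ → PhaseFun) : Prop where
  term : ∀ r ∈ s, ∃ F : ℝ → ℝ → ℝ, IsCoefficient n T F ∧
    ContDiff ℝ 1 (fun q : ℝ × ℝ => F q.1 q.2) ∧
    (∀ t, ∫ κ in (0 : ℝ)..(4 * tau n), F κ t = 0) ∧
    ∀ K κ t, 0 < K → W r K κ t = kpow n ((n : ℤ) - r + 1) K * F κ t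
  zero : ∀ r, r ∉ s → W r = 0

/-- `X ε K κ t` is the transformation generated by `W`: for `K ≥ b` it solves
`dK/dε = ∂W/∂κ`, `dκ/dε = -∂W/∂K` on `0 ≤ ε ≤ 1`, starting at `(K, κ)`, within the domain
`K > a`. -/
structure IsLieFlow (s : Finset ℕ) (W : ℕ → PhaseFun) (a b : ℝ)
    (X : ℝ → ℝ → ℝ → ℝ → ℝ × ℝ) : Prop where
  init : ∀ K κ t, b ≤ K → X 0 K κ t = (K, κ)
  domain : ∀ ε ∈ Set.Icc (0 : ℝ) 1, ∀ K κ t, b ≤ K → a < (X ε K κ t).1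
  ode : ∀ ε ∈ Set.Icc (0 : ℝ) 1, ∀ K κ t, b ≤ K →
    HasDerivWithinAt (fun e => X e K κ t) (hamField (genFun s W ε) t (X ε K κ t))
      (Set.Icc 0 1) ε

/-- The set of all `(ε, K, κ, t)` with `0 ≤ ε ≤ 1` and `K ≥ b`. -/
def lieDomain (b : ℝ) : Set (ℝ × ℝ × ℝ × ℝ) := {q | q.1 ∈ Set.Icc (0 : ℝ) 1 ∧ b ≤ q.2.1}

/-- The Lie transform of `A_* = ∑ ε^i/i! A_i` is convergent up to `ε = 1`: the series
`∑ ε^i/i! A_0^i` formed with the diagonal of the Lie triangle converges uniformly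
for `0 ≤ ε ≤ 1`, `K ≥ b` and all `κ`, `t`, and its sum is `A_*` at the transformed point. -/
structure LieConverges (W : ℕ → PhaseFun) (X : ℝ → ℝ → ℝ → ℝ → ℝ × ℝ) (b : ℝ)
    (A : ℕ → PhaseFun) : Prop where
  summable : ∀ ε ∈ Set.Icc (0 : ℝ) 1, ∀ K κ t, b ≤ K →
    Summable fun i => epsTerm A ε i (X ε K κ t).1 (X ε K κ t).2 t
  uniform : HasSumUniformlyOn
    (fun (i : ℕ) (q : ℝ × ℝ × ℝ × ℝ) =>
      epsTerm (fun i => lieTriangle W A i 0) q.1 i q.2.1 q.2.2.1 q.2.2.2)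
    (fun q => ∑' i, epsTerm A q.1 i (X q.1 q.2.1 q.2.2.1 q.2.2.2).1
      (X q.1 q.2.1 q.2.2.1 q.2.2.2).2 q.2.2.2)
    (lieDomain b)

/-- A function independent of `ε`, as a series in `ε`. -/
def constSeries (A : PhaseFun) : ℕ → PhaseFun := fun i => if i = 0 then A else 0

/-- The coefficients `-∂W_{j+1}/∂t` of `-∂W/∂t`, whose Lie transform gives the remainder. -/
noncomputable def remRows (W : ℕ → PhaseFun) : ℕ → PhaseFun := fun j K κ t =>
  -deriv (fun u => W (j + 1) K κ u) t

/-- The rows `H_i^0` for the original Hamiltonian. -/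
noncomputable def origRows (n : ℕ) (p : ℕ → ℝ → ℝ) : ℕ → PhaseFun := fun i K κ t =>
  if i = 0 then leadTerm n K
  else if i ≤ 2 * n - 1 then
    (i.factorial : ℝ) * (kpow n (2 * (n : ℤ) - i) K * origCoeff n p (2 * n - i) κ t)
  else 0

/-- The rows `H_i^0` for the Hamiltonian `normalHam n m fbar f`. -/
noncomputable def normalRows (n : ℕ) (m : ℤ) (fbar : ℤ → ℝ → ℝ) (f : ℤ → ℝ → ℝ → ℝ) :
    ℕ → PhaseFun := fun i K κ t =>
  if i = 0 then leadTerm n K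
  else (i.factorial : ℝ) * (kpow n (2 * (n : ℤ) - i) K *
    (if m < 2 * (n : ℤ) - i then fbar (2 * (n : ℤ) - i) t else f (2 * (n : ℤ) - i) κ t))

/-- The reduction, by the Lie transform with the finite generating function `∑_{r ∈ s}`, of the
Hamiltonian `H` with rows `Hrows` on `K > a` to the Hamiltonian `normalHam n m fbar f` on
`K > b`. -/
structure IsLieReduction (n : ℕ) (T a b : ℝ) (s : Finset ℕ) (m : ℤ) (H : PhaseFun)
    (Hrows : ℕ → PhaseFun) (W : ℕ → PhaseFun) (X : ℝ → ℝ → ℝ → ℝ → ℝ × ℝ)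
    (fbar : ℤ → ℝ → ℝ) (f : ℤ → ℝ → ℝ → ℝ) : Prop where
  generator : IsGenerator n T s W
  flow : IsLieFlow s W a b X
  /-- the transformation itself is convergent up to `ε = 1` -/
  converges_K : LieConverges W X b (constSeries fun K _ _ => K)
  converges_angle : LieConverges W X b (constSeries fun _ κ _ => κ)
  /-- so are the transforms of the Hamiltonian and of the remainder -/
  converges_ham : LieConverges W X b Hrows
  converges_rem : LieConverges W X b (remRows W)
  /-- the transformed terms of degree `j > m` do not depend on `κ` -/
  reduced : ∀ i : ℕ, 1 ≤ i → m < 2 * (n : ℤ) - i → ∃ F : ℝ → ℝ, Continuous F ∧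
    Function.Periodic F T ∧
    ∀ K κ t, a < K → lieTriangle W Hrows i 0 K κ t = kpow n (2 * (n : ℤ) - i) K * F t
  rows : ∀ i : ℕ, ∃ F : ℝ → ℝ → ℝ, IsCoefficient n T F ∧
    ∀ K κ t, a < K → lieTriangle W Hrows i 0 K κ t = kpow n (2 * (n : ℤ) - i) K * F κ t
  rem_rows : ∀ i : ℕ, ∃ F : ℝ → ℝ → ℝ, IsCoefficient n T F ∧
    ∀ K κ t, a < K → lieTriangle W (remRows W) i 0 K κ t = kpow n ((n : ℤ) - i) K * F κ t
  /-- the new Hamiltonian, `H_0^0 + ∑_{i ≥ 1} (H_0^i + R_0^{i-1}) / i!`, has the normal form -/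
  normal_form : IsNormalForm n T m b fbar f
  new_ham : HasSumUniformlyOn
    (fun (i : ℕ) (q : ℝ × ℝ × ℝ) => 1 / ((i + 1).factorial : ℝ) *
      (lieTriangle W Hrows (i + 1) 0 q.1 q.2.1 q.2.2
        + lieTriangle W (remRows W) i 0 q.1 q.2.1 q.2.2))
    (fun q => normalHam n m fbar f q.1 q.2.1 q.2.2 - leadTerm n q.1)
    {q | b ≤ q.1}
  change : IsSymplecticChange n T a b (X 1)
  transforms : TransformsHam b H (normalHam n m fbar f) (X 1)

end LieOscillator

namespace LieOscillator

open Set Filter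
open scoped Topology ContDiff NNReal

/-! ### Taylor series along a chain of derivatives -/

/-! Say that `K^(a/(n+1))` has degree `a`. The bracket with `W_r`, which has degree `n-r+1`, lowers
the degree by exactly `r`. Hence in a Lie triangle that starts from `A_j` of degree `σ-j`, the entry
`A_j^i` is the power of degree `σ-i-j` times a function of `(κ,t)` (`lieTriangle_eq`), and `ε`
enters only through `μ = ε K^(-1/(n+1))`. Convergence at `ε = 1` is then a matter of taking `K`
large, provided the diagonal coefficients grow at most like `i! L^i`.

Removal of `κ`: `H_0^i` depends on `W_i` only through `{H_0, W_i}` (`coefTriangle_sub`), whose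
coefficient is exactly `∂w_i/∂κ`. Taking for `w_i` minus the mean-zero primitive of the oscillating
part leaves only the mean value (`exists_normalizing_generator`). If `W` starts at `r₀`, the
remainder `-∂W/∂t` has degree at most `n-r₀+1`. This is `n` for the first step (`r₀ = 1`) and `1`
for the second (`r₀ = n`), so it never reaches the degrees being normalized in that step. Each step
costs one time derivative, which explains the classes `C^2` and `C^1` of the `p_j`; `p_0` sits in
degree `1`, which is not normalized.

Growth: all coefficients are finite sums `φ(κ) q(t)` (`Sep`), where the derivatives of `φ` are at
most `C k! R^k`; for `sn` this comes from its differential equation (`uniformlyAnalytic_sn`). The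
class is stable under products, derivatives and mean-zero primitives, and the factorial bounds pass
from row to row with a constant factor (`GrowthBound.coefTriangle`).

Value of the series: the rows of the triangle, summed over `j` and evaluated along the flow, are
successive `ε`-derivatives of the first one (`hasDerivWithinAt_expansion`), so Taylor's theorem with
the growth bound gives convergence to the right limit (`hasSum_taylor`).

Change of variables: in the coordinate `u = K^(1/(n+1))` the field of `W` is bounded and Lipschitz
for `u ≥ 1`. After a cut-off it has a global flow that moves `u` by a bounded amount, and uniqueness
gives injectivity, the image and the periodicity. The variational equation gives the `C^1`
derivative `J`. The area form of two `J`-images of spatial vectors is constant in `ε`, while the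
pairing of the time direction with a spatial `v` changes at the rate of the derivative along `v` of
`∂W/∂t` at `X_ε`. Integrated over `ε`, this says that the explicit time dependence of `Φ` is
Hamiltonian with the correction `∑ R_0^i/(i+1)!` (`IsAreaMap.transformsHam`). -/

theorem abs_sub_taylor_le {B : ℝ} (N : ℕ) : ∀ {g : ℕ → ℝ → ℝ},
    (∀ i, ∀ s ∈ Icc (0 : ℝ) 1, HasDerivWithinAt (g i) (g (i + 1) s) (Icc 0 1) s) →
    (∀ s ∈ Icc (0 : ℝ) 1, |g N s| ≤ B) → ∀ ε ∈ Icc (0 : ℝ) 1,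
    |g 0 ε - ∑ i ∈ Finset.range N, ε ^ i / (i.factorial : ℝ) * g i 0|
      ≤ B * (ε ^ N / (N.factorial : ℝ)) := by
  induction N with
  | zero => intro g _ hb ε hε; simpa using hb ε hε
  | succ N ih =>
    intro g hg hb ε hε
    -- The derivative of the Taylor remainder of order `N + 1` is the remainder of order `N` of the
    -- shifted chain, so the bound is integrated once.
    have h1 := ih (g := fun i => g (i + 1)) (fun i => hg (i + 1)) hb
    let f : ℝ → ℝ := fun s => g 0 s - ∑ i ∈ Finset.range (N + 1), s ^ i / (i.factorial : ℝ) * g i 0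
    have hpow : ∀ (i : ℕ) (s : ℝ), HasDerivAt (fun s : ℝ => s ^ (i + 1) / ((i + 1).factorial : ℝ))
        (s ^ i / (i.factorial : ℝ)) s := by
      intro i s
      have := (hasDerivAt_pow (i + 1) s).div_const (((i + 1).factorial : ℝ))
      convert! this using 1
      rw [Nat.factorial_succ]
      push_cast
      have : (i.factorial : ℝ) ≠ 0 := by positivity
      have : (i : ℝ) + 1 ≠ 0 := by positivity
      field_simp
    have hf : ∀ s ∈ Icc (0 : ℝ) 1, HasDerivWithinAt f
        (g 1 s - ∑ i ∈ Finset.range N, s ^ i / (i.factorial : ℝ) * g (i + 1) 0) (Icc 0 1) s := by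
      intro s hs
      have e : f = fun s => g 0 s - (∑ i ∈ Finset.range N,
          s ^ (i + 1) / ((i + 1).factorial : ℝ) * g (i + 1) 0 + g 0 0) := by
        funext s
        simp only [f]
        rw [Finset.sum_range_succ']
        simp
      rw [e]
      refine (hg 0 s hs).sub (HasDerivWithinAt.add_const (c := g 0 0) ?_)
      exact (HasDerivAt.fun_sum fun i _ => (hpow i s).mul_const _).hasDerivWithinAt
    refine image_norm_le_of_norm_deriv_right_le_deriv_boundary (f := f)
      (B := fun s => B * (s ^ (N + 1) / ((N + 1).factorial : ℝ))) (a := 0) (b := 1)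
      (fun s hs => (hf s hs).continuousWithinAt)
      (fun s hs => ((hf s ⟨hs.1, hs.2.le⟩).mono_of_mem_nhdsWithin
        (Icc_mem_nhdsGE_of_mem hs))) ?_ (fun s => (hpow N s).const_mul B) ?_ hε
    · simp [f, Finset.sum_range_succ']
    · intro s hs
      exact h1 s ⟨hs.1, hs.2.le⟩

/-- The `i!` allowed in the bound cancels against the `1/N!` of the remainder, which leaves `B q^N`.
The index `0` is exempt from the bound, so that `g 0` may be the angle itself. -/
theorem hasSum_taylor {g : ℕ → ℝ → ℝ} {B q : ℝ} (hq0 : 0 ≤ q) (hq : q < 1)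
    (hg : ∀ i, ∀ s ∈ Icc (0 : ℝ) 1, HasDerivWithinAt (g i) (g (i + 1) s) (Icc 0 1) s)
    (hb : ∀ i, 1 ≤ i → ∀ s ∈ Icc (0 : ℝ) 1, |g i s| ≤ B * i.factorial * q ^ i)
    {ε : ℝ} (hε : ε ∈ Icc (0 : ℝ) 1) :
    HasSum (fun i => ε ^ i / (i.factorial : ℝ) * g i 0) (g 0 ε) := by
  have hε1 : ∀ i, ε ^ i ≤ 1 := fun i => pow_le_one₀ hε.1 hε.2
  have hsum : Summable (fun i => ε ^ i / (i.factorial : ℝ) * g i 0) := by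
    rw [← summable_nat_add_iff 1]
    refine Summable.of_norm_bounded (g := fun i => B * q ^ (i + 1)) ?_ fun i => ?_
    · exact ((summable_nat_add_iff 1).2 (summable_geometric_of_lt_one hq0 hq)).mul_left B
    · have h := hb (i + 1) (by omega) 0 (by simp)
      have hf : (0 : ℝ) < (i + 1).factorial := by positivity
      have h0 : 0 ≤ ε ^ (i + 1) := pow_nonneg hε.1 _
      rw [Real.norm_eq_abs, abs_mul, abs_of_nonneg (by positivity)]
      calc ε ^ (i + 1) / ((i + 1).factorial : ℝ) * |g (i + 1) 0|
          ≤ 1 / ((i + 1).factorial : ℝ) * (B * (i + 1).factorial * q ^ (i + 1)) := by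
            gcongr; exact hε1 _
        _ = _ := by field_simp
  refine (hsum.hasSum_iff_tendsto_nat).2 ?_
  rw [tendsto_iff_dist_tendsto_zero]
  have hlim : Tendsto (fun N => B * q ^ N) atTop (𝓝 0) := by
    simpa using (tendsto_pow_atTop_nhds_zero_of_lt_one hq0 hq).const_mul B
  refine squeeze_zero' (Eventually.of_forall fun _ => dist_nonneg) ?_ hlim
  filter_upwards [eventually_ge_atTop 1] with N hN
  rw [dist_comm, Real.dist_eq]
  refine (abs_sub_taylor_le N hg (hb N hN) ε hε).trans ?_
  have h1 := hb N hN 0 (by simp)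
  have hf : (0 : ℝ) < N.factorial := by positivity
  have h2 : 0 ≤ B * N.factorial * q ^ N := (abs_nonneg _).trans h1
  calc B * N.factorial * q ^ N * (ε ^ N / (N.factorial : ℝ))
      ≤ B * N.factorial * q ^ N * (1 / (N.factorial : ℝ)) := by gcongr; exact hε1 N
    _ = _ := by field_simp

/-! ### Uniformly analytic functions -/

/-- Smooth functions on the line whose `k`-th derivatives are bounded by `C * k! * R ^ k`. -/
structure UniformlyAnalytic (φ : ℝ → ℝ) : Prop where
  smooth : ContDiff ℝ ∞ φ
  bound : ∃ C R : ℝ, 0 ≤ C ∧ 1 ≤ R ∧ ∀ k x, |iteratedDeriv k φ x| ≤ C * k.factorial * R ^ k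

theorem contDiff_top_nat {φ : ℝ → ℝ} (h : ContDiff ℝ ∞ φ) (k : ℕ) : ContDiff ℝ k φ :=
  h.of_le (by exact_mod_cast le_top)

theorem hasDerivAt_iteratedDeriv {φ : ℝ → ℝ} (h : ContDiff ℝ ∞ φ) (k : ℕ) (x : ℝ) :
    HasDerivAt (iteratedDeriv k φ) (iteratedDeriv (k + 1) φ x) x := by
  rw [iteratedDeriv_succ]
  refine DifferentiableAt.hasDerivAt ?_
  exact (h.differentiable_iteratedDeriv k (by exact_mod_cast WithTop.coe_lt_top k)) x

theorem analyticAt_of_iteratedDeriv_bound {φ : ℝ → ℝ} (h : ContDiff ℝ ∞ φ) {C R : ℝ}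
    (hC : 0 ≤ C) (hR : 1 ≤ R) (hb : ∀ k x, |iteratedDeriv k φ x| ≤ C * k.factorial * R ^ k)
    (x : ℝ) : AnalyticAt ℝ φ x := by
  refine ⟨FormalMultilinearSeries.ofScalars ℝ
    (fun k => iteratedDeriv k φ x / (k.factorial : ℝ)), ?_⟩
  rw [hasFPowerSeriesAt_iff]
  have hR0 : 0 < R := by linarith
  filter_upwards [Metric.ball_mem_nhds (0 : ℝ) (show 0 < 1 / (2 * R) by positivity)] with y hy
  rw [mem_ball_zero_iff, Real.norm_eq_abs, lt_div_iff₀ (by positivity)] at hy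
  -- Taylor expansion along the segment from `x` to `x + y`: the functions `y^i φ^(i)(x + s y)` form
  -- a chain of derivatives in `s`, and `|y| R ≤ 1/2` supplies the ratio.
  have key := hasSum_taylor (g := fun i s => y ^ i * iteratedDeriv i φ (x + s * y)) (B := C)
    (q := 1 / 2) (by norm_num) (by norm_num) ?_ ?_ (ε := 1) (by simp)
  · simp only [iteratedDeriv_zero, pow_zero, one_mul, zero_mul, add_zero] at key
    convert! key using 2 with i
    rw [FormalMultilinearSeries.coeff_ofScalars, smul_eq_mul, one_pow]
    ring
  · intro i s _
    have h1 : HasDerivAt (fun s : ℝ => x + s * y) y s := by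
      simpa using ((hasDerivAt_id s).mul_const y).const_add x
    have := ((hasDerivAt_iteratedDeriv h i (x + s * y)).comp s h1).const_mul (y ^ i)
    refine HasDerivAt.hasDerivWithinAt ?_
    convert! this using 1
    ring
  · intro i _ s _
    rw [abs_mul, abs_pow]
    calc |y| ^ i * |iteratedDeriv i φ (x + s * y)| ≤ |y| ^ i * (C * i.factorial * R ^ i) := by
          gcongr; exact hb _ _
      _ = C * i.factorial * (|y| * R) ^ i := by rw [mul_pow]; ring
      _ ≤ _ := by gcongr; linarith

namespace UniformlyAnalytic

theorem const (c : ℝ) : UniformlyAnalytic (fun _ => c) := by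
  refine ⟨contDiff_const, |c|, 1, abs_nonneg _, le_rfl, fun k x => ?_⟩
  rw [iteratedDeriv_const]
  split_ifs with h
  · simp [h]
  · simp; positivity

theorem deriv {φ : ℝ → ℝ} (h : UniformlyAnalytic φ) : UniformlyAnalytic (deriv φ) := by
  obtain ⟨C, R, hC, hR, hb⟩ := h.bound
  refine ⟨(contDiff_infty_iff_deriv.1 h.smooth).2, C * R, 2 * R, by positivity, by linarith,
    fun k x => ?_⟩
  rw [← iteratedDeriv_succ']
  refine (hb _ _).trans ?_
  -- The factor `k + 1` of `(k+1)!` is absorbed by doubling `R`.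
  have h2 : (k : ℝ) + 1 ≤ 2 ^ k := by exact_mod_cast Nat.lt_two_pow_self
  rw [Nat.factorial_succ, pow_succ, mul_pow]
  push_cast
  have hR0 : 0 ≤ R := by linarith
  calc C * (((k : ℝ) + 1) * k.factorial) * (R ^ k * R)
      = ((k : ℝ) + 1) * (C * k.factorial * R ^ k * R) := by ring
    _ ≤ 2 ^ k * (C * k.factorial * R ^ k * R) := by gcongr
    _ = _ := by ring

theorem of_deriv {φ : ℝ → ℝ} (hd : Differentiable ℝ φ) (h : UniformlyAnalytic (_root_.deriv φ))
    {M : ℝ} (hM : ∀ x, |φ x| ≤ M) : UniformlyAnalytic φ := by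
  obtain ⟨C, R, hC, hR, hb⟩ := h.bound
  have hM0 : 0 ≤ M := (abs_nonneg _).trans (hM 0)
  refine ⟨contDiff_infty_iff_deriv.2 ⟨hd, h.smooth⟩, C + M, R, by positivity, hR, ?_⟩
  rintro (_ | k) x
  · simpa using (hM x).trans (by linarith)
  · rw [iteratedDeriv_succ']
    refine (hb _ _).trans ?_
    have : k.factorial ≤ (k + 1).factorial := Nat.factorial_le (by omega)
    gcongr
    · linarith
    · omega

theorem add {φ ψ : ℝ → ℝ} (h : UniformlyAnalytic φ) (h' : UniformlyAnalytic ψ) :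
    UniformlyAnalytic (fun x => φ x + ψ x) := by
  obtain ⟨C, R, hC, hR, hb⟩ := h.bound
  obtain ⟨C', R', hC', hR', hb'⟩ := h'.bound
  refine ⟨h.smooth.add h'.smooth, C + C', max R R', by positivity, hR.trans (le_max_left _ _),
    fun k x => ?_⟩
  rw [iteratedDeriv_fun_add (contDiff_top_nat h.smooth k).contDiffAt
    (contDiff_top_nat h'.smooth k).contDiffAt]
  refine (abs_add_le _ _).trans ((add_le_add (hb k x) (hb' k x)).trans ?_)
  have h1 : R ^ k ≤ max R R' ^ k := by gcongr; exact le_max_left _ _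
  have h2 : R' ^ k ≤ max R R' ^ k := by gcongr; exact le_max_right _ _
  calc C * k.factorial * R ^ k + C' * k.factorial * R' ^ k
      ≤ C * k.factorial * max R R' ^ k + C' * k.factorial * max R R' ^ k := by gcongr
    _ = _ := by ring

/-- In the Leibniz rule the binomial coefficient turns `i! (k-i)!` into `k!`, so all `k + 1`
summands obey the same bound; their number is absorbed by doubling the rate. -/
theorem mul {φ ψ : ℝ → ℝ} (h : UniformlyAnalytic φ) (h' : UniformlyAnalytic ψ) :
    UniformlyAnalytic (fun x => φ x * ψ x) := by
  obtain ⟨C, R, hC, hR, hb⟩ := h.bound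
  obtain ⟨C', R', hC', hR', hb'⟩ := h'.bound
  refine ⟨h.smooth.mul h'.smooth, C * C', 2 * max R R', by positivity,
    by linarith [hR.trans (le_max_left R R')], fun k x => ?_⟩
  rw [iteratedDeriv_fun_mul (contDiff_top_nat h.smooth k).contDiffAt
    (contDiff_top_nat h'.smooth k).contDiffAt]
  refine (Finset.abs_sum_le_sum_abs _ _).trans ?_
  have hS : (0 : ℝ) ≤ max R R' := by linarith [hR.trans (le_max_left R R')]
  have hterm : ∀ i ∈ Finset.range (k + 1), |(k.choose i : ℝ) * iteratedDeriv i φ x *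
      iteratedDeriv (k - i) ψ x| ≤ C * C' * k.factorial * max R R' ^ k := by
    intro i hi
    have hi' : i ≤ k := by simpa [Nat.lt_succ_iff] using hi
    rw [abs_mul, abs_mul, Nat.abs_cast]
    calc (k.choose i : ℝ) * |iteratedDeriv i φ x| * |iteratedDeriv (k - i) ψ x|
        ≤ (k.choose i : ℝ) * (C * i.factorial * max R R' ^ i) *
          (C' * (k - i).factorial * max R R' ^ (k - i)) := by
          gcongr
          · exact (hb i x).trans (by gcongr; exact le_max_left _ _)
          · exact (hb' _ x).trans (by gcongr; exact le_max_right _ _)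
      _ = C * C' * ((k.choose i : ℝ) * i.factorial * (k - i).factorial) *
          (max R R' ^ i * max R R' ^ (k - i)) := by ring
      _ = _ := by
          rw [← pow_add, Nat.add_sub_cancel' hi']
          congr 2
          exact_mod_cast Nat.choose_mul_factorial_mul_factorial hi'
  refine (Finset.sum_le_card_nsmul _ _ _ hterm).trans ?_
  have h2 : (k : ℝ) + 1 ≤ 2 ^ k := by exact_mod_cast Nat.lt_two_pow_self
  rw [Finset.card_range, nsmul_eq_mul, mul_pow]
  push_cast
  calc ((k : ℝ) + 1) * (C * C' * k.factorial * max R R' ^ k)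
      ≤ 2 ^ k * (C * C' * k.factorial * max R R' ^ k) := by gcongr
    _ = _ := by ring

theorem pow {φ : ℝ → ℝ} (h : UniformlyAnalytic φ) (m : ℕ) :
    UniformlyAnalytic (fun x => φ x ^ m) := by
  induction m with
  | zero => simpa using const 1
  | succ m ih => simpa only [pow_succ] using ih.mul h

/-- A periodic uniformly analytic function minus its mean value has a periodic uniformly analytic
primitive with mean value zero. -/
theorem exists_primitive {φ : ℝ → ℝ} (h : UniformlyAnalytic φ) {ϖ : ℝ} (hϖ : 0 < ϖ)
    (hp : Function.Periodic φ ϖ) : ∃ (ψ : ℝ → ℝ) (c : ℝ), UniformlyAnalytic ψ ∧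
      Function.Periodic ψ ϖ ∧ ∫ x in (0 : ℝ)..ϖ, ψ x = 0 ∧ ∀ x, HasDerivAt ψ (φ x - c) x := by
  set c := (∫ x in (0 : ℝ)..ϖ, φ x) / ϖ with hc
  have hφ : Continuous φ := h.smooth.continuous
  let g : ℝ → ℝ := fun x => φ x - c
  have hg : Continuous g := hφ.sub continuous_const
  let G : ℝ → ℝ := fun x => ∫ s in (0 : ℝ)..x, g s
  have hG : ∀ x, HasDerivAt G (g x) x := fun x =>
    (hg.integral_hasStrictDerivAt 0 x).hasDerivAt
  have hint : ∫ s in (0 : ℝ)..ϖ, g s = 0 := by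
    simp only [g]
    rw [intervalIntegral.integral_sub (hφ.intervalIntegrable _ _) (by simp)]
    simp [hc]
    field_simp
    ring
  have hgp : Function.Periodic g ϖ := fun x => by simp only [g, hp x]
  have hGp : Function.Periodic G ϖ := by
    intro x
    have h1 : G (x + ϖ) = G x + ∫ s in x..(x + ϖ), g s :=
      (intervalIntegral.integral_add_adjacent_intervals (hg.intervalIntegrable _ _)
        (hg.intervalIntegrable _ _)).symm
    rw [h1, hgp.intervalIntegral_add_eq x 0, zero_add, hint, add_zero]
  set d := (∫ x in (0 : ℝ)..ϖ, G x) / ϖ with hd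
  have hGc : Continuous G := continuous_iff_continuousAt.2 fun x => (hG x).continuousAt
  have hψ : ∀ x, HasDerivAt (fun x => G x - d) (g x) x := fun x => (hG x).sub_const d
  have hψp : Function.Periodic (fun x => G x - d) ϖ := fun x => by simp only [hGp x]
  obtain ⟨M, hM⟩ := (isCompact_Icc (a := (0 : ℝ)) (b := ϖ)).exists_bound_of_continuousOn
    (hGc.sub (continuous_const (y := d))).continuousOn
  refine ⟨fun x => G x - d, c, ?_, hψp, ?_, hψ⟩
  · refine of_deriv (fun x => (hψ x).differentiableAt) (M := M) ?_ fun x => ?_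
    · rw [funext fun x => (hψ x).deriv]
      simpa [g, sub_eq_add_neg] using h.add (const (-c))
    · obtain ⟨y, hy, hxy⟩ := hψp.exists_mem_Ico₀ hϖ x
      rw [hxy]
      exact hM y ⟨hy.1, hy.2.le⟩
  · rw [intervalIntegral.integral_sub (hGc.intervalIntegrable _ _) (by simp)]
    simp [hd]
    field_simp
    ring

end UniformlyAnalytic

/-! ### Separable coefficients -/

/-- The derivative with respect to the angle. -/
noncomputable def angleDeriv (F : ℝ → ℝ → ℝ) : ℝ → ℝ → ℝ := fun κ t => deriv (fun x => F x t) κ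

/-- The derivative with respect to time. -/
noncomputable def timeDeriv (F : ℝ → ℝ → ℝ) : ℝ → ℝ → ℝ := fun κ t => deriv (fun u => F κ u) t

/-- Finite sums of products `φ(κ) q(t)` with `φ` uniformly analytic and `ϖ`-periodic and `q` of
class `C^e` and `T`-periodic. -/
def Sep (ϖ T : ℝ) (e : ℕ) : Submodule ℝ (ℝ → ℝ → ℝ) :=
  Submodule.span ℝ {F | ∃ φ q : ℝ → ℝ, UniformlyAnalytic φ ∧ Function.Periodic φ ϖ ∧
    ContDiff ℝ e q ∧ Function.Periodic q T ∧ F = fun κ t => φ κ * q t}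

namespace Sep

variable {ϖ T : ℝ} {e : ℕ} {F G : ℝ → ℝ → ℝ}

theorem tensor_mem {φ q : ℝ → ℝ} (h1 : UniformlyAnalytic φ) (h2 : Function.Periodic φ ϖ)
    (h3 : ContDiff ℝ e q) (h4 : Function.Periodic q T) :
    (fun κ t => φ κ * q t) ∈ Sep ϖ T e :=
  Submodule.subset_span ⟨φ, q, h1, h2, h3, h4, rfl⟩

theorem time_mem {q : ℝ → ℝ} (h3 : ContDiff ℝ e q) (h4 : Function.Periodic q T) :
    (fun _ t => q t) ∈ Sep ϖ T e := by
  simpa using tensor_mem (UniformlyAnalytic.const 1) (fun _ => rfl) h3 h4 (ϖ := ϖ)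

theorem const_mem (c : ℝ) : (fun _ _ => c) ∈ Sep ϖ T e :=
  time_mem contDiff_const fun _ => rfl

theorem mono {e' : ℕ} (h : e' ≤ e) : Sep ϖ T e ≤ Sep ϖ T e' := by
  refine Submodule.span_mono ?_
  rintro _ ⟨φ, q, h1, h2, h3, h4, rfl⟩
  exact ⟨φ, q, h1, h2, h3.of_le (by exact_mod_cast h), h4, rfl⟩

theorem contDiff_angle (hF : F ∈ Sep ϖ T e) (t : ℝ) : ContDiff ℝ ∞ fun κ => F κ t := by
  induction hF using Submodule.span_induction with
  | mem x h => obtain ⟨φ, q, h1, -, -, -, rfl⟩ := h; exact h1.smooth.mul contDiff_const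
  | zero => exact contDiff_const
  | add x y _ _ hx hy => exact hx.add hy
  | smul a x _ hx => exact contDiff_const.mul hx

theorem contDiff (hF : F ∈ Sep ϖ T e) : ContDiff ℝ e fun z : ℝ × ℝ => F z.1 z.2 := by
  induction hF using Submodule.span_induction with
  | mem x h =>
    obtain ⟨φ, q, h1, -, h3, -, rfl⟩ := h
    exact ((contDiff_top_nat h1.smooth e).comp contDiff_fst).mul (h3.comp contDiff_snd)
  | zero => exact contDiff_const
  | add x y _ _ hx hy => exact hx.add hy
  | smul a x _ hx => exact contDiff_const.mul hx

theorem periodic_angle (hF : F ∈ Sep ϖ T e) (κ t : ℝ) : F (κ + ϖ) t = F κ t := by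
  induction hF using Submodule.span_induction with
  | mem x h => obtain ⟨φ, q, -, h2, -, -, rfl⟩ := h; simp only [h2 κ]
  | zero => rfl
  | add x y _ _ hx hy => simp only [Pi.add_apply, hx, hy]
  | smul a x _ hx => simp only [Pi.smul_apply, hx]

theorem periodic_time (hF : F ∈ Sep ϖ T e) (κ t : ℝ) : F κ (t + T) = F κ t := by
  induction hF using Submodule.span_induction with
  | mem x h => obtain ⟨φ, q, -, -, -, h4, rfl⟩ := h; simp only [h4 t]
  | zero => rfl
  | add x y _ _ hx hy => simp only [Pi.add_apply, hx, hy]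
  | smul a x _ hx => simp only [Pi.smul_apply, hx]

theorem exists_bound_of_periodic {q : ℝ → ℝ} (hT : 0 < T) (hq : Continuous q)
    (hp : Function.Periodic q T) : ∃ M, 0 ≤ M ∧ ∀ t, |q t| ≤ M := by
  obtain ⟨M, hM⟩ := (isCompact_Icc (a := (0 : ℝ)) (b := T)).exists_bound_of_continuousOn
    hq.continuousOn
  have : ∀ t, |q t| ≤ M := fun t => by
    obtain ⟨y, hy, hxy⟩ := hp.exists_mem_Ico₀ hT t
    rw [hxy]
    exact hM y ⟨hy.1, hy.2.le⟩
  exact ⟨M, (abs_nonneg _).trans (this 0), this⟩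

theorem bound (hT : 0 < T) (hF : F ∈ Sep ϖ T e) : ∃ C R : ℝ, 0 ≤ C ∧ 1 ≤ R ∧
    ∀ k κ t, |iteratedDeriv k (fun x => F x t) κ| ≤ C * k.factorial * R ^ k := by
  induction hF using Submodule.span_induction with
  | mem x h =>
    obtain ⟨φ, q, h1, -, h3, h4, rfl⟩ := h
    obtain ⟨C, R, hC, hR, hb⟩ := h1.bound
    obtain ⟨M, hM0, hM⟩ := exists_bound_of_periodic hT h3.continuous h4
    refine ⟨C * M, R, by positivity, hR, fun k κ t => ?_⟩
    rw [iteratedDeriv_mul_const_field, abs_mul]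
    calc |iteratedDeriv k φ κ| * |q t| ≤ C * k.factorial * R ^ k * M := by
          gcongr
          exacts [hb k κ, hM t]
      _ = _ := by ring
  | zero =>
    refine ⟨0, 1, le_rfl, le_rfl, fun k κ t => ?_⟩
    have : (fun x => (0 : ℝ → ℝ → ℝ) x t) = fun _ => (0 : ℝ) := rfl
    rw [this, iteratedDeriv_const]
    simp
  | add x y hx' hy' hx hy =>
    obtain ⟨C, R, hC, hR, hb⟩ := hx
    obtain ⟨C', R', hC', hR', hb'⟩ := hy
    refine ⟨C + C', max R R', by positivity, hR.trans (le_max_left _ _), fun k κ t => ?_⟩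
    simp only [Pi.add_apply]
    rw [iteratedDeriv_fun_add (contDiff_top_nat (contDiff_angle hx' t) k).contDiffAt
      (contDiff_top_nat (contDiff_angle hy' t) k).contDiffAt]
    refine (abs_add_le _ _).trans ((add_le_add (hb k κ t) (hb' k κ t)).trans ?_)
    have h1 : R ^ k ≤ max R R' ^ k := by gcongr; exact le_max_left _ _
    have h2 : R' ^ k ≤ max R R' ^ k := by gcongr; exact le_max_right _ _
    calc C * k.factorial * R ^ k + C' * k.factorial * R' ^ k
        ≤ C * k.factorial * max R R' ^ k + C' * k.factorial * max R R' ^ k := by gcongr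
      _ = _ := by ring
  | smul a x hx' hx =>
    obtain ⟨C, R, hC, hR, hb⟩ := hx
    refine ⟨|a| * C, R, by positivity, hR, fun k κ t => ?_⟩
    simp only [Pi.smul_apply, smul_eq_mul]
    rw [iteratedDeriv_const_mul_field, abs_mul]
    calc |a| * |iteratedDeriv k (fun y => x y t) κ| ≤ |a| * (C * k.factorial * R ^ k) := by
          gcongr; exact hb k κ t
      _ = _ := by ring

theorem isCoefficient {n : ℕ} (hT : 0 < T) (hF : F ∈ Sep (4 * tau n) T e) :
    IsCoefficient n T F where
  continuous := (contDiff hF).continuous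
  analytic t κ := by
    obtain ⟨C, R, hC, hR, hb⟩ := bound hT hF
    exact analyticAt_of_iteratedDeriv_bound ((contDiff_angle hF) t) hC hR (fun k x => hb k x t) κ
  periodic_angle := (periodic_angle hF)
  periodic_time := (periodic_time hF)

theorem mul_mem (hF : F ∈ Sep ϖ T e) (hG : G ∈ Sep ϖ T e) :
    (fun κ t => F κ t * G κ t) ∈ Sep ϖ T e := by
  induction hF, hG using Submodule.span_induction₂ with
  | mem_mem x y hx hy =>
    obtain ⟨φ, q, h1, h2, h3, h4, rfl⟩ := hx
    obtain ⟨φ', q', h1', h2', h3', h4', rfl⟩ := hy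
    have := tensor_mem (h1.mul h1') (h2.mul h2') (h3.mul h3') (h4.mul h4')
    convert! this using 3
    simp
    ring
  | zero_left y hy =>
    have : (fun κ t => (0 : ℝ → ℝ → ℝ) κ t * y κ t) = 0 := by funext κ t; simp
    rw [this]; exact Submodule.zero_mem _
  | zero_right y hy =>
    have : (fun κ t => y κ t * (0 : ℝ → ℝ → ℝ) κ t) = 0 := by funext κ t; simp
    rw [this]; exact Submodule.zero_mem _
  | add_left x y z _ _ _ h h' =>
    simp only [Pi.add_apply, add_mul]; exact Submodule.add_mem _ h h'
  | add_right x y z _ _ _ h h' =>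
    simp only [Pi.add_apply, mul_add]; exact Submodule.add_mem _ h h'
  | smul_left r x y _ _ h =>
    simp only [Pi.smul_apply, smul_eq_mul, mul_assoc]; exact Submodule.smul_mem _ r h
  | smul_right r x y _ _ h =>
    simp only [Pi.smul_apply, smul_eq_mul, mul_left_comm]; exact Submodule.smul_mem _ r h

theorem hasDerivAt_angle (hF : F ∈ Sep ϖ T e) (κ t : ℝ) :
    HasDerivAt (fun x => F x t) (angleDeriv F κ t) κ :=
  (((contDiff_angle hF) t).differentiable (by simp) κ).hasDerivAt

theorem differentiable (hF : F ∈ Sep ϖ T (e + 1)) :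
    Differentiable ℝ fun z : ℝ × ℝ => F z.1 z.2 :=
  (contDiff hF).differentiable (by exact_mod_cast Nat.succ_ne_zero e)

theorem hasDerivAt_time (hF : F ∈ Sep ϖ T (e + 1)) (κ t : ℝ) :
    HasDerivAt (fun u => F κ u) (timeDeriv F κ t) t := by
  have : Differentiable ℝ fun u => F κ u :=
    (differentiable hF).comp ((differentiable_const κ).prodMk differentiable_id)
  exact (this t).hasDerivAt

theorem angleDeriv_tensor (φ q : ℝ → ℝ) :
    angleDeriv (fun κ t => φ κ * q t) = fun κ t => deriv φ κ * q t := by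
  funext κ t
  simp [angleDeriv]

theorem timeDeriv_tensor (φ q : ℝ → ℝ) :
    timeDeriv (fun κ t => φ κ * q t) = fun κ t => φ κ * deriv q t := by
  funext κ t
  simp [timeDeriv]

theorem angleDeriv_add (hF : F ∈ Sep ϖ T e) (hG : G ∈ Sep ϖ T e) :
    angleDeriv (F + G) = angleDeriv F + angleDeriv G := by
  funext κ t
  exact (((hasDerivAt_angle hF) κ t).add ((hasDerivAt_angle hG) κ t)).deriv

theorem angleDeriv_smul (a : ℝ) (F : ℝ → ℝ → ℝ) : angleDeriv (a • F) = a • angleDeriv F := by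
  funext κ t
  simp [angleDeriv]

theorem timeDeriv_add (hF : F ∈ Sep ϖ T (e + 1)) (hG : G ∈ Sep ϖ T (e + 1)) :
    timeDeriv (F + G) = timeDeriv F + timeDeriv G := by
  funext κ t
  exact (((hasDerivAt_time hF) κ t).add ((hasDerivAt_time hG) κ t)).deriv

theorem timeDeriv_smul (a : ℝ) (F : ℝ → ℝ → ℝ) : timeDeriv (a • F) = a • timeDeriv F := by
  funext κ t
  simp [timeDeriv]

theorem angleDeriv_zero : angleDeriv 0 = 0 := by
  funext κ t
  simp [angleDeriv]

theorem timeDeriv_zero : timeDeriv 0 = 0 := by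
  funext κ t
  simp [timeDeriv]

theorem angleDeriv_mem (hF : F ∈ Sep ϖ T e) : angleDeriv F ∈ Sep ϖ T e := by
  induction hF using Submodule.span_induction with
  | mem x h =>
    obtain ⟨φ, q, h1, h2, h3, h4, rfl⟩ := h
    rw [angleDeriv_tensor]
    refine tensor_mem h1.deriv (fun x => ?_) h3 h4
    have := deriv_comp_add_const (f := φ) ϖ x
    rw [← this]
    congr 1
    funext y
    exact h2 y
  | zero => rw [angleDeriv_zero]; exact Submodule.zero_mem _
  | add x y hx' hy' hx hy => rw [angleDeriv_add hx' hy']; exact Submodule.add_mem _ hx hy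
  | smul a x _ hx => rw [angleDeriv_smul]; exact Submodule.smul_mem _ _ hx

/-- The mixed derivatives commute although the coefficient may be only `C^1` in time: on a product
both are `φ' q'`. The two claims are proved together because additivity of `angleDeriv` on time
derivatives uses their membership. -/
theorem timeDeriv_mem_and (hF : F ∈ Sep ϖ T (e + 1)) : timeDeriv F ∈ Sep ϖ T e ∧
    timeDeriv (angleDeriv F) = angleDeriv (timeDeriv F) := by
  induction hF using Submodule.span_induction with
  | mem x h =>
    obtain ⟨φ, q, h1, h2, h3, h4, rfl⟩ := h
    rw [angleDeriv_tensor, timeDeriv_tensor, timeDeriv_tensor, angleDeriv_tensor]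
    refine ⟨tensor_mem h1 h2 ?_ (fun x => ?_), rfl⟩
    · exact (contDiff_succ_iff_deriv.1 (by exact_mod_cast h3)).2.2
    have := deriv_comp_add_const (f := q) T x
    rw [← this]
    congr 1
    funext y
    exact h4 y
  | zero => rw [timeDeriv_zero, angleDeriv_zero, timeDeriv_zero]; exact ⟨Submodule.zero_mem _, rfl⟩
  | add x y hx' hy' hx hy =>
    have hx'' : x ∈ Sep ϖ T (e + 1) := hx'
    have hy'' : y ∈ Sep ϖ T (e + 1) := hy'
    rw [angleDeriv_add hx'' hy'', timeDeriv_add hx'' hy'', timeDeriv_add (angleDeriv_mem hx'')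
      (angleDeriv_mem hy''), hx.2, hy.2, angleDeriv_add hx.1 hy.1]
    exact ⟨Submodule.add_mem _ hx.1 hy.1, rfl⟩
  | smul a x _ hx =>
    rw [angleDeriv_smul, timeDeriv_smul, timeDeriv_smul, angleDeriv_smul, hx.2]
    exact ⟨Submodule.smul_mem _ _ hx.1, rfl⟩

theorem timeDeriv_mem (hF : F ∈ Sep ϖ T (e + 1)) : timeDeriv F ∈ Sep ϖ T e :=
  (timeDeriv_mem_and hF).1

theorem timeDeriv_angleDeriv (hF : F ∈ Sep ϖ T (e + 1)) :
    timeDeriv (angleDeriv F) = angleDeriv (timeDeriv F) :=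
  (timeDeriv_mem_and hF).2

/-- Integration in the angle acts on the factors `φ` alone, so neither the primitive nor the mean
value `c` loses regularity in time. -/
theorem exists_primitive (hϖ : 0 < ϖ) (hF : F ∈ Sep ϖ T e) : ∃ G ∈ Sep ϖ T e, ∃ c : ℝ → ℝ,
    ContDiff ℝ e c ∧ Function.Periodic c T ∧ (∀ t, ∫ κ in (0 : ℝ)..ϖ, G κ t = 0) ∧
      ∀ κ t, angleDeriv G κ t = F κ t - c t := by
  induction hF using Submodule.span_induction with
  | mem x h =>
    obtain ⟨φ, q, h1, h2, h3, h4, rfl⟩ := h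
    obtain ⟨ψ, c, h5, h6, h7, h8⟩ := h1.exists_primitive hϖ h2
    refine ⟨_, tensor_mem h5 h6 h3 h4, fun t => c * q t, contDiff_const.mul h3,
      fun t => by simp only [h4 t], fun t => ?_, fun κ t => ?_⟩
    · rw [intervalIntegral.integral_mul_const, h7, zero_mul]
    · rw [angleDeriv_tensor]
      simp only [(h8 κ).deriv]
      ring
  | zero =>
    exact ⟨0, Submodule.zero_mem _, fun _ => 0, contDiff_const, fun _ => rfl, fun t => by simp,
      fun κ t => by simp [angleDeriv_zero]⟩
  | add x y _ _ hx hy =>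
    obtain ⟨G, hG, c, h1, h2, h3, h4⟩ := hx
    obtain ⟨G', hG', c', h1', h2', h3', h4'⟩ := hy
    refine ⟨G + G', Submodule.add_mem _ hG hG', fun t => c t + c' t, h1.add h1',
      fun t => by simp only [h2 t, h2' t], fun t => ?_, fun κ t => ?_⟩
    · simp only [Pi.add_apply]
      rw [intervalIntegral.integral_add ((contDiff_angle hG t).continuous.intervalIntegrable _ _)
        ((contDiff_angle hG' t).continuous.intervalIntegrable _ _), h3, h3', add_zero]
    · rw [angleDeriv_add hG hG']
      simp only [Pi.add_apply, h4, h4']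
      ring
  | smul a x _ hx =>
    obtain ⟨G, hG, c, h1, h2, h3, h4⟩ := hx
    refine ⟨a • G, Submodule.smul_mem _ _ hG, fun t => a * c t, contDiff_const.mul h1,
      fun t => by simp only [h2 t], fun t => ?_, fun κ t => ?_⟩
    · simp only [Pi.smul_apply, smul_eq_mul]
      rw [intervalIntegral.integral_const_mul, h3, mul_zero]
    · rw [angleDeriv_smul]
      simp only [Pi.smul_apply, h4, smul_eq_mul]
      ring

end Sep

/-! ### The reference solution -/

/-- The derivative of the reference solution. -/
noncomputable def cs (n : ℕ) : ℝ → ℝ := deriv (sn n)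

section

variable {n : ℕ}

theorem hasDerivAt_sn (hn : 1 ≤ n) (κ : ℝ) : HasDerivAt (sn n) (cs n κ) κ :=
  ((sn_isRefSolution hn).differentiable κ).hasDerivAt

theorem hasDerivAt_cs (hn : 1 ≤ n) (κ : ℝ) :
    HasDerivAt (cs n) (-((n : ℝ) * sn n κ ^ (2 * n - 1))) κ :=
  (sn_isRefSolution hn).ode κ

theorem sn_zero (hn : 1 ≤ n) : sn n 0 = 0 := (sn_isRefSolution hn).init

theorem cs_zero (hn : 1 ≤ n) : cs n 0 = 1 := (sn_isRefSolution hn).init_deriv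

theorem cs_sq_add_sn_pow (hn : 1 ≤ n) (κ : ℝ) : cs n κ ^ 2 + sn n κ ^ (2 * n) = 1 := by
  have hE : ∀ x, HasDerivAt (fun x => cs n x ^ 2 + sn n x ^ (2 * n)) 0 x := by
    intro x
    have := ((hasDerivAt_cs hn x).pow 2).add ((hasDerivAt_sn hn x).pow (2 * n))
    convert! this using 1
    push_cast
    ring
  have h := is_const_of_deriv_eq_zero (fun x => (hE x).differentiableAt) (fun x => (hE x).deriv) κ 0
  simp only [cs_zero hn, sn_zero hn] at h
  rw [h, zero_pow (by omega)]
  norm_num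

theorem abs_sn_le (hn : 1 ≤ n) (κ : ℝ) : |sn n κ| ≤ 1 := by
  have h := cs_sq_add_sn_pow hn κ
  have h1 : |sn n κ| ^ (2 * n) ≤ 1 := by
    rw [← abs_pow, pow_mul, abs_of_nonneg (by positivity), ← pow_mul]
    nlinarith [sq_nonneg (cs n κ)]
  exact (pow_le_one_iff_of_nonneg (abs_nonneg _) (by omega)).1 h1

theorem abs_cs_le (hn : 1 ≤ n) (κ : ℝ) : |cs n κ| ≤ 1 := by
  have h := cs_sq_add_sn_pow hn κ
  have h1 : 0 ≤ sn n κ ^ (2 * n) := by rw [pow_mul]; positivity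
  exact (sq_le_one_iff_abs_le_one _).1 (by linarith)

/-- Bounded solutions of the first order system of the reference equation. -/
structure IsRefCurve (n : ℕ) (ξ η : ℝ → ℝ) : Prop where
  hasDerivAt_fst : ∀ κ, HasDerivAt ξ (η κ) κ
  hasDerivAt_snd : ∀ κ, HasDerivAt η (-((n : ℝ) * ξ κ ^ (2 * n - 1))) κ
  abs_fst_le : ∀ κ, |ξ κ| ≤ 1
  abs_snd_le : ∀ κ, |η κ| ≤ 1

theorem isRefCurve_sn (hn : 1 ≤ n) : IsRefCurve n (sn n) (cs n) :=
  ⟨hasDerivAt_sn hn, hasDerivAt_cs hn, abs_sn_le hn, abs_cs_le hn⟩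

/-- The polynomial field is not globally Lipschitz, but it is on the box `[-1,1]²`, which contains
all these curves. -/
theorem IsRefCurve.eq {ξ η ξ' η' : ℝ → ℝ} (h : IsRefCurve n ξ η) (h' : IsRefCurve n ξ' η')
    {κ₀ : ℝ} (h1 : ξ κ₀ = ξ' κ₀) (h2 : η κ₀ = η' κ₀) : ξ = ξ' ∧ η = η' := by
  let f : ℝ × ℝ → ℝ × ℝ := fun z => (z.2, -((n : ℝ) * z.1 ^ (2 * n - 1)))
  have hf : ContDiff ℝ 1 f := by
    refine contDiff_snd.prodMk ?_
    exact (contDiff_const.mul (contDiff_fst.pow _)).neg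
  obtain ⟨k, hk⟩ := hf.contDiffOn.exists_lipschitzOnWith one_ne_zero
    ((convex_Icc (-1 : ℝ) 1).prod (convex_Icc (-1 : ℝ) 1))
    ((isCompact_Icc (a := (-1 : ℝ)) (b := 1)).prod (isCompact_Icc (a := (-1 : ℝ)) (b := 1)))
  have key : (fun κ => (ξ κ, η κ)) = fun κ => (ξ' κ, η' κ) := by
    refine ODE_solution_unique_univ (v := fun _ => f)
      (s := fun _ => Icc (-1 : ℝ) 1 ×ˢ Icc (-1 : ℝ) 1) (K := k) (t₀ := κ₀) (fun _ => hk)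
      (fun t => ⟨(h.hasDerivAt_fst t).prodMk (h.hasDerivAt_snd t), ?_⟩)
      (fun t => ⟨(h'.hasDerivAt_fst t).prodMk (h'.hasDerivAt_snd t), ?_⟩) (by simp [h1, h2])
    · exact ⟨abs_le.1 (h.abs_fst_le t), abs_le.1 (h.abs_snd_le t)⟩
    · exact ⟨abs_le.1 (h'.abs_fst_le t), abs_le.1 (h'.abs_snd_le t)⟩
  exact ⟨funext fun κ => congrArg Prod.fst (congrFun key κ),
    funext fun κ => congrArg Prod.snd (congrFun key κ)⟩

theorem odd_two_mul_sub_one (hn : 1 ≤ n) : Odd (2 * n - 1) := ⟨n - 1, by omega⟩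

theorem sn_neg (hn : 1 ≤ n) (κ : ℝ) : sn n (-κ) = -sn n κ := by
  have h : IsRefCurve n (fun x => -sn n (-x)) (fun x => cs n (-x)) := by
    refine ⟨fun x => ?_, fun x => ?_, fun x => ?_, fun x => abs_cs_le hn _⟩
    · have := ((hasDerivAt_sn hn (-x)).comp x (hasDerivAt_neg x)).neg
      convert! this using 1
      ring
    · have := (hasDerivAt_cs hn (-x)).comp x (hasDerivAt_neg x)
      convert! this using 1
      rw [(odd_two_mul_sub_one hn).neg_pow]
      ring
    · rw [abs_neg]; exact abs_sn_le hn _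
  have := congrFun (h.eq (isRefCurve_sn hn) (κ₀ := 0) (by simp [sn_zero hn]) (by simp)).1 κ
  linarith

/-- Otherwise `cs` has no zero on `[0,∞)`, since by conservation of energy its first zero would be a
point with `sn = 1`. Then `sn` increases, so after time `1` the derivative of `cs` is at most `-d`
with `d = n sn(1)^(2n-1) > 0`, and `cs` must become nonpositive. -/
theorem exists_sn_eq_one (hn : 1 ≤ n) : ∃ κ, 0 < κ ∧ sn n κ = 1 := by
  by_contra! hne
  have hsc : Continuous (sn n) :=
    continuous_iff_continuousAt.2 fun x => (hasDerivAt_sn hn x).continuousAt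
  have hcc : Continuous (cs n) :=
    continuous_iff_continuousAt.2 fun x => (hasDerivAt_cs hn x).continuousAt
  have hpos : ∀ κ, 0 ≤ κ → 0 < cs n κ := by
    by_contra! hex
    let S : Set ℝ := {κ | 0 ≤ κ ∧ cs n κ ≤ 0}
    have hS : IsClosed S := isClosed_Ici.inter (isClosed_le hcc continuous_const)
    have hbd : BddBelow S := ⟨0, fun x hx => hx.1⟩
    obtain ⟨h0, h1⟩ : sInf S ∈ S := hS.csInf_mem hex hbd
    set κ₀ := sInf S
    have hκ : 0 < κ₀ := by
      refine lt_of_le_of_ne h0 fun h => ?_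
      rw [← h, cs_zero hn] at h1
      linarith
    have hlt : ∀ x, 0 ≤ x → x < κ₀ → 0 < cs n x := fun x hx hx' => by
      by_contra! hc
      exact absurd (csInf_le hbd ⟨hx, hc⟩) (not_le.2 hx')
    have hmono : StrictMonoOn (sn n) (Icc 0 κ₀) := by
      refine strictMonoOn_of_deriv_pos (convex_Icc _ _) hsc.continuousOn fun x hx => ?_
      rw [interior_Icc] at hx
      rw [(hasDerivAt_sn hn x).deriv]
      exact hlt x hx.1.le hx.2
    have hs : 0 < sn n κ₀ := by
      have := hmono (left_mem_Icc.2 h0) (right_mem_Icc.2 h0) hκ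
      rwa [sn_zero hn] at this
    have hc0 : 0 ≤ cs n κ₀ := by
      refine ge_of_tendsto (hcc.continuousAt.continuousWithinAt (s := Iio κ₀)).tendsto ?_
      filter_upwards [Ioo_mem_nhdsLT hκ] with x hx
      exact (hlt x hx.1.le hx.2).le
    have hE := cs_sq_add_sn_pow hn κ₀
    rw [le_antisymm h1 hc0, zero_pow two_ne_zero, zero_add] at hE
    exact hne κ₀ hκ ((pow_eq_one_iff_of_nonneg hs.le (by omega)).1 hE)
  have hmono : StrictMonoOn (sn n) (Ici 0) := by
    refine strictMonoOn_of_deriv_pos (convex_Ici _) hsc.continuousOn fun x hx => ?_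
    rw [interior_Ici] at hx
    rw [(hasDerivAt_sn hn x).deriv]
    exact hpos x (le_of_lt hx)
  have hc : 0 < sn n 1 := by
    have := hmono (self_mem_Ici) (show (1 : ℝ) ∈ Ici 0 by simp) one_pos
    rwa [sn_zero hn] at this
  set d := (n : ℝ) * sn n 1 ^ (2 * n - 1) with hd
  have hn0 : (0 : ℝ) < n := by exact_mod_cast hn
  have hd0 : 0 < d := by positivity
  have hanti : AntitoneOn (fun x => cs n x + d * x) (Ici 1) := by
    have hder : ∀ x, HasDerivAt (fun x => cs n x + d * x)
        (-((n : ℝ) * sn n x ^ (2 * n - 1)) + d) x := fun x => by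
      have := (hasDerivAt_cs hn x).add ((hasDerivAt_id x).const_mul d)
      rwa [mul_one] at this
    refine antitoneOn_of_deriv_nonpos (convex_Ici _)
      (fun x _ => (hder x).continuousAt.continuousWithinAt)
      (fun x _ => (hder x).differentiableAt.differentiableWithinAt) fun x hx => ?_
    rw [interior_Ici] at hx
    rw [(hder x).deriv]
    have hx1 : (1 : ℝ) < x := hx
    have : sn n 1 ≤ sn n x :=
      (hmono (by simp) (show x ∈ Ici (0 : ℝ) from by simp; linarith) hx1).le
    have h2 : sn n 1 ^ (2 * n - 1) ≤ sn n x ^ (2 * n - 1) := by gcongr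
    have := mul_le_mul_of_nonneg_left h2 hn0.le
    linarith
  -- Starting from `cs 1 ≤ 1` and decreasing at rate at least `d`, `cs` has lost at least `1` after
  -- the further time `1/d`.
  have h1 := hanti (show (1 : ℝ) ∈ Ici 1 by simp) (show 1 + 1 / d ∈ Ici (1 : ℝ) by
    simp; positivity) (show (1 : ℝ) ≤ 1 + 1 / d by simp; positivity)
  have h2 := hpos (1 + 1 / d) (by positivity)
  have h3 := (abs_le.1 (abs_cs_le hn 1)).2
  simp only at h1
  have : d * (1 + 1 / d) = d + 1 := by field_simp
  linarith

theorem tau_pos_and_sn_tau (hn : 1 ≤ n) : 0 < tau n ∧ sn n (tau n) = 1 := by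
  have hsc : Continuous (sn n) :=
    continuous_iff_continuousAt.2 fun x => (hasDerivAt_sn hn x).continuousAt
  -- Since `sn 0 ≠ 1`, the strict inequality may be relaxed; this makes the set closed, so the
  -- infimum is attained.
  have e : {κ : ℝ | 0 < κ ∧ sn n κ = 1} = {κ : ℝ | 0 ≤ κ ∧ sn n κ = 1} := by
    ext x
    refine ⟨fun h => ⟨h.1.le, h.2⟩, fun h => ⟨lt_of_le_of_ne h.1 fun h0 => ?_, h.2⟩⟩
    have := h.2
    rw [← h0, sn_zero hn] at this
    norm_num at this
  have hcl : IsClosed {κ : ℝ | 0 < κ ∧ sn n κ = 1} := by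
    rw [e]
    exact isClosed_Ici.inter (isClosed_eq hsc continuous_const)
  exact hcl.csInf_mem (exists_sn_eq_one hn) ⟨0, fun x hx => hx.1.le⟩

theorem tau_pos (hn : 1 ≤ n) : 0 < tau n := (tau_pos_and_sn_tau hn).1

/-- At `τ` the curve has `sn = 1`, `cs = 0`, so it coincides with its reflection about `τ`. Together
with oddness this gives `sn(x + 2τ) = -sn x`. -/
theorem sn_periodic (hn : 1 ≤ n) : Function.Periodic (sn n) (4 * tau n) := by
  have hs := (tau_pos_and_sn_tau hn).2
  have hc : cs n (tau n) = 0 := by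
    have := cs_sq_add_sn_pow hn (tau n)
    rw [hs, one_pow] at this
    exact pow_eq_zero_iff two_ne_zero |>.1 (by linarith)
  have h : IsRefCurve n (fun x => sn n (2 * tau n - x)) (fun x => -cs n (2 * tau n - x)) := by
    have hd : ∀ x, HasDerivAt (fun x => 2 * tau n - x) (-1) x := fun x =>
      (hasDerivAt_id x).const_sub _
    refine ⟨fun x => ?_, fun x => ?_, fun x => abs_sn_le hn _, fun x => ?_⟩
    · have := (hasDerivAt_sn hn (2 * tau n - x)).comp x (hd x)
      convert! this using 1
      ring
    · have := ((hasDerivAt_cs hn (2 * tau n - x)).comp x (hd x)).neg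
      convert! this using 1
      ring
    · rw [abs_neg]; exact abs_cs_le hn _
  have e : 2 * tau n - tau n = tau n := by ring
  have hr : ∀ x, sn n (2 * tau n - x) = sn n x := fun x =>
    congrFun (h.eq (isRefCurve_sn hn) (κ₀ := tau n) (by simp [e]) (by simp [e, hc])).1 x
  have h2 : ∀ x, sn n (x + 2 * tau n) = -sn n x := fun x => by
    rw [← sn_neg hn, ← hr (-x)]
    congr 1
    ring
  intro x
  rw [show x + 4 * tau n = (x + 2 * tau n) + 2 * tau n by ring, h2, h2, neg_neg]

theorem contDiff_sn_cs (hn : 1 ≤ n) (k : ℕ) : ContDiff ℝ k (sn n) ∧ ContDiff ℝ k (cs n) := by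
  have d1 : Differentiable ℝ (sn n) := fun x => (hasDerivAt_sn hn x).differentiableAt
  have d2 : Differentiable ℝ (cs n) := fun x => (hasDerivAt_cs hn x).differentiableAt
  induction k with
  | zero => exact ⟨contDiff_zero.2 d1.continuous, contDiff_zero.2 d2.continuous⟩
  | succ k ih =>
    push_cast
    refine ⟨contDiff_succ_iff_deriv.2 ⟨d1, by simp, ih.2⟩,
      contDiff_succ_iff_deriv.2 ⟨d2, by simp, ?_⟩⟩
    rw [funext fun x => (hasDerivAt_cs hn x).deriv]
    exact (contDiff_const.mul (ih.1.pow _)).neg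

/-- Differentiating a monomial in `sn`, `cs` of degree at most `d` gives two monomials of degree at
most `d + 2n - 2`, whose coefficients add up to at most `n d`. Iteration produces the product, since
every monomial is bounded by `1`. -/
theorem abs_iteratedDeriv_sn_cs_le (hn : 1 ≤ n) (N : ℕ) : ∀ (d a b : ℕ), a + b ≤ d → ∀ x,
    |iteratedDeriv N (fun x => sn n x ^ a * cs n x ^ b) x|
      ≤ (n : ℝ) ^ N * ∏ k ∈ Finset.range N, ((d : ℝ) + (2 * n - 2) * k) := by
  have hn1 : (1 : ℝ) ≤ n := by exact_mod_cast hn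
  have hsm : ∀ (k a b : ℕ), ContDiff ℝ k (fun x => sn n x ^ a * cs n x ^ b) := fun k a b =>
    ((contDiff_sn_cs hn k).1.pow a).mul ((contDiff_sn_cs hn k).2.pow b)
  induction N with
  | zero =>
    intro d a b _ x
    simp only [iteratedDeriv_zero, pow_zero, Finset.range_zero, Finset.prod_empty, mul_one]
    rw [abs_mul, abs_pow, abs_pow]
    exact mul_le_one₀ (pow_le_one₀ (abs_nonneg _) (abs_sn_le hn x)) (by positivity)
      (pow_le_one₀ (abs_nonneg _) (abs_cs_le hn x))
  | succ N ih =>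
    intro d a b hab x
    have hd : deriv (fun x => sn n x ^ a * cs n x ^ b) = fun x =>
        (a : ℝ) * (sn n x ^ (a - 1) * cs n x ^ (b + 1)) -
          ((n : ℝ) * b) * (sn n x ^ (a + (2 * n - 1)) * cs n x ^ (b - 1)) := by
      funext x
      have := ((hasDerivAt_sn hn x).pow a).mul ((hasDerivAt_cs hn x).pow b)
      refine HasDerivAt.deriv ?_
      convert! this using 1
      simp only [Pi.pow_apply]
      ring
    rw [iteratedDeriv_succ', hd, iteratedDeriv_fun_sub
      (contDiff_const.mul (hsm N _ _)).contDiffAt (contDiff_const.mul (hsm N _ _)).contDiffAt,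
      iteratedDeriv_const_mul_field, iteratedDeriv_const_mul_field]
    set P := (n : ℝ) ^ N * ∏ k ∈ Finset.range N, (((d + (2 * n - 2) : ℕ) : ℝ) + (2 * n - 2) * k)
      with hP
    have hP0 : 0 ≤ P := by
      refine mul_nonneg (by positivity) (Finset.prod_nonneg fun k _ => ?_)
      have : (0 : ℝ) ≤ 2 * n - 2 := by linarith
      positivity
    have h1 : |(a : ℝ) * iteratedDeriv N (fun x => sn n x ^ (a - 1) * cs n x ^ (b + 1)) x|
        ≤ a * P := by
      rw [abs_mul, Nat.abs_cast]
      rcases Nat.eq_zero_or_pos a with rfl | ha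
      · simp
      · gcongr
        exact ih _ _ _ (by omega) x
    have h2 : |((n : ℝ) * b) * iteratedDeriv N
        (fun x => sn n x ^ (a + (2 * n - 1)) * cs n x ^ (b - 1)) x| ≤ (n * b) * P := by
      rw [abs_mul, abs_of_nonneg (by positivity)]
      rcases Nat.eq_zero_or_pos b with rfl | hb
      · simp
      · gcongr
        exact ih _ _ _ (by omega) x
    refine (abs_sub _ _).trans ((add_le_add h1 h2).trans ?_)
    have h3 : (n : ℝ) ^ (N + 1) * ∏ k ∈ Finset.range (N + 1), ((d : ℝ) + (2 * n - 2) * k)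
        = (n * d) * P := by
      rw [Finset.prod_range_succ', hP, pow_succ]
      have e : ∏ k ∈ Finset.range N, ((d : ℝ) + (2 * n - 2) * ((k + 1 : ℕ) : ℝ)) =
          ∏ k ∈ Finset.range N, (((d + (2 * n - 2) : ℕ) : ℝ) + (2 * n - 2) * k) := by
        refine Finset.prod_congr rfl fun k _ => ?_
        rw [Nat.cast_add d, Nat.cast_sub (by omega)]
        push_cast
        ring
      rw [e]
      push_cast
      ring
    rw [h3, ← add_mul]
    refine mul_le_mul_of_nonneg_right ?_ hP0
    have h4 : (a : ℝ) + b ≤ d := by exact_mod_cast hab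
    have h5 : (a : ℝ) ≤ n * a := le_mul_of_one_le_left (by positivity) hn1
    nlinarith

theorem uniformlyAnalytic_sn (hn : 1 ≤ n) : UniformlyAnalytic (sn n) := by
  have hn1 : (1 : ℝ) ≤ n := by exact_mod_cast hn
  refine ⟨contDiff_infty.2 fun k => (contDiff_sn_cs hn k).1, 1, n * (2 * n - 1), zero_le_one,
    by nlinarith, fun k x => ?_⟩
  have h := abs_iteratedDeriv_sn_cs_le hn k 1 1 0 le_rfl x
  simp only [pow_one, pow_zero, mul_one] at h
  refine h.trans ?_
  -- Factorwise `1 + (2n-2) j ≤ (2n-1)(j+1)`, and the factors `j + 1` make up `k!`.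
  have h2 : ∏ j ∈ Finset.range k, (((1 : ℕ) : ℝ) + (2 * n - 2) * j)
      ≤ (2 * n - 1) ^ k * k.factorial := by
    rw [← Finset.prod_range_add_one_eq_factorial, Nat.cast_prod]
    have : ((2 * n - 1 : ℝ)) ^ k = ∏ j ∈ Finset.range k, (2 * n - 1 : ℝ) := by simp
    rw [this, ← Finset.prod_mul_distrib]
    refine Finset.prod_le_prod (fun j _ => ?_) fun j _ => ?_
    · have : (0 : ℝ) ≤ (2 * n - 2) * j := mul_nonneg (by linarith) (by positivity)
      push_cast
      linarith
    · push_cast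
      have : (0 : ℝ) ≤ j := by positivity
      nlinarith
  calc (n : ℝ) ^ k * ∏ j ∈ Finset.range k, (((1 : ℕ) : ℝ) + (2 * n - 2) * j)
      ≤ (n : ℝ) ^ k * ((2 * n - 1) ^ k * k.factorial) := by gcongr
    _ = _ := by rw [mul_pow]; ring

end

/-! ### The coefficient triangle -/

/-- One row of the Lie triangle at the level of the coefficients: if `A_j = K ^ ((s - j) / (n + 1))
F_j` and `W_r = K ^ ((n - r + 1) / (n + 1)) w_r`, the next row has the coefficients
`coefStep n s w F j` of `K ^ ((s - 1 - j) / (n + 1))`. -/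
noncomputable def coefStep (n : ℕ) (s : ℝ) (w F : ℕ → ℝ → ℝ → ℝ) : ℕ → ℝ → ℝ → ℝ := fun j κ t =>
  F (j + 1) κ t + ∑ l ∈ Finset.range (j + 1), (j.choose l : ℝ) *
    (((s - (j - l : ℕ)) / ((n : ℝ) + 1) * F (j - l) κ t) * angleDeriv (w (l + 1)) κ t -
      angleDeriv (F (j - l)) κ t * (((n : ℝ) - l) / ((n : ℝ) + 1) * w (l + 1) κ t))

/-- The coefficients of the Lie triangle. -/
noncomputable def coefTriangle (n : ℕ) (s : ℝ) (w h : ℕ → ℝ → ℝ → ℝ) : ℕ → ℕ → ℝ → ℝ → ℝ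
  | 0 => h
  | i + 1 => coefStep n (s - i) w (coefTriangle n s w h i)

section

variable {n : ℕ} {s : ℝ} {w h : ℕ → ℝ → ℝ → ℝ} {ϖ T : ℝ}

/-- Only the `h l` with `l ≤ i + j` enter. Low-degree terms of the Hamiltonian, which are less
regular in time, therefore do not spoil the entries that have to be normalized. -/
theorem coefTriangle_mem {e : ℕ} (hw : ∀ r, w r ∈ Sep ϖ T e) (i : ℕ) : ∀ j,
    (∀ l ≤ i + j, h l ∈ Sep ϖ T e) → coefTriangle n s w h i j ∈ Sep ϖ T e := by
  induction i with
  | zero => intro j hh; exact hh j (by omega)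
  | succ i ih =>
    intro j hh
    have h1 : ∀ l, l ≤ j + 1 → coefTriangle n s w h i l ∈ Sep ϖ T e := fun l hl =>
      ih l fun l' hl' => hh l' (by omega)
    have e1 : coefTriangle n s w h (i + 1) j = coefTriangle n s w h i (j + 1) +
        ∑ l ∈ Finset.range (j + 1), (j.choose l : ℝ) •
        (((s - i - (j - l : ℕ)) / ((n : ℝ) + 1)) •
          (fun κ t => coefTriangle n s w h i (j - l) κ t * angleDeriv (w (l + 1)) κ t) -
        (((n : ℝ) - l) / ((n : ℝ) + 1)) • (fun κ t =>
          angleDeriv (coefTriangle n s w h i (j - l)) κ t * w (l + 1) κ t)) := by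
      funext κ t
      simp only [coefTriangle, coefStep, Pi.add_apply, Finset.sum_apply, Pi.smul_apply,
        Pi.sub_apply, smul_eq_mul]
      congr 1
      refine Finset.sum_congr rfl fun l _ => ?_
      ring
    rw [e1]
    refine Submodule.add_mem _ (h1 _ le_rfl) (Submodule.sum_mem _ fun l _ => ?_)
    refine Submodule.smul_mem _ _ (Submodule.sub_mem _ ?_ ?_)
    · exact Submodule.smul_mem _ _ (Sep.mul_mem (h1 _ (by omega)) (Sep.angleDeriv_mem (hw _)))
    · exact Submodule.smul_mem _ _ (Sep.mul_mem (Sep.angleDeriv_mem (h1 _ (by omega))) (hw _))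

theorem coefTriangle_congr {w' : ℕ → ℝ → ℝ → ℝ} (i : ℕ) : ∀ j,
    (∀ r, 1 ≤ r → r ≤ i + j → w' r = w r) →
    coefTriangle n s w' h i j = coefTriangle n s w h i j := by
  induction i with
  | zero => intro j _; rfl
  | succ i ih =>
    intro j hj
    funext κ t
    simp only [coefTriangle, coefStep]
    rw [ih (j + 1) fun r h1 h2 => hj r h1 (by omega)]
    congr 1
    refine Finset.sum_congr rfl fun l hl => ?_
    have hl' : l ≤ j := by simpa [Nat.lt_succ_iff] using hl
    rw [ih (j - l) fun r h1 h2 => hj r h1 (by omega), hj (l + 1) (by omega) (by omega)]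

theorem angleDeriv_zero_apply (κ t : ℝ) : angleDeriv 0 κ t = 0 := by
  simp [angleDeriv]

theorem coefTriangle_of_zero (i : ℕ) : ∀ j, (∀ r, 1 ≤ r → r ≤ i + j → w r = 0) →
    coefTriangle n s w h i j = h (i + j) := by
  induction i with
  | zero => intro j _; simp [coefTriangle]
  | succ i ih =>
    intro j hj
    funext κ t
    simp only [coefTriangle, coefStep]
    rw [ih (j + 1) fun r h1 h2 => hj r h1 (by omega), Finset.sum_eq_zero fun l hl => ?_, add_zero]
    · rw [show i + 1 + j = i + (j + 1) by omega]
    · have hl' : l ≤ j := by simpa [Nat.lt_succ_iff] using hl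
      rw [hj (l + 1) (by omega) (by omega), angleDeriv_zero_apply]
      simp

/-- Applied to the remainder: if `W` starts late, so does the triangle of `-∂W/∂t`. -/
theorem coefTriangle_eq_zero {N : ℕ} (hh : ∀ l ≤ N, h l = 0) (i : ℕ) : ∀ j, i + j ≤ N →
    coefTriangle n s w h i j = 0 := by
  induction i with
  | zero => intro j hj; exact hh j (by omega)
  | succ i ih =>
    intro j hj
    funext κ t
    simp only [coefTriangle, coefStep]
    rw [ih (j + 1) (by omega), Finset.sum_eq_zero fun l hl => ?_]
    · simp
    · rw [ih (j - l) (by omega), angleDeriv_zero_apply]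
      simp

/-- The entry `A_j^i` depends on `W_{i+j}` only through the bracket `{A_0, W_{i+j}}`. -/
theorem coefTriangle_sub {w' : ℕ → ℝ → ℝ → ℝ} {c : ℝ} (h0 : h 0 = fun _ _ => c) (i : ℕ) : ∀ j,
    (∀ r, 1 ≤ r → r < i + 1 + j → w' r = w r) → ∀ κ t,
    coefTriangle n s w' h (i + 1) j κ t = coefTriangle n s w h (i + 1) j κ t +
      s / ((n : ℝ) + 1) * c *
        (angleDeriv (w' (i + 1 + j)) κ t - angleDeriv (w (i + 1 + j)) κ t) := by
  induction i with
  | zero =>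
    intro j hj κ t
    -- In the first row only the summand `l = j`, the bracket with the constant coefficient `h 0`,
    -- contains the new `w'`.
    have hs : ∀ l ∈ Finset.range j, w' (l + 1) = w (l + 1) := fun l hl =>
      hj (l + 1) (by omega) (by have := Finset.mem_range.1 hl; omega)
    change coefStep n (s - (0 : ℕ)) w' h j κ t = coefStep n (s - (0 : ℕ)) w h j κ t + _
    rw [coefStep, coefStep, Finset.sum_range_succ, Finset.sum_range_succ,
      Finset.sum_congr rfl fun l hl => by rw [hs l hl]]
    simp [h0, angleDeriv, add_comm 1 j]
    ring
  | succ i ih =>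
    intro j hj κ t
    change coefStep n (s - (i + 1 : ℕ)) w' (coefTriangle n s w' h (i + 1)) j κ t =
      coefStep n (s - (i + 1 : ℕ)) w (coefTriangle n s w h (i + 1)) j κ t + _
    rw [coefStep, coefStep]
    -- In a later row the bracket sum sees only generators of smaller index, so the whole change is
    -- inherited from the entry to the right in the preceding row.
    rw [ih (j + 1) (fun r h1 h2 => hj r h1 (by omega)), Finset.sum_congr rfl fun l hl => ?_]
    · rw [show i + 1 + (j + 1) = i + 1 + 1 + j by ring]
      ring
    · have hl' : l ≤ j := by simpa [Nat.lt_succ_iff] using hl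
      rw [coefTriangle_congr (i + 1) (j - l) fun r h1 h2 => hj r h1 (by omega),
        hj (l + 1) (by omega) (by omega)]

/-- Solution of the homological equations. -/
theorem exists_normalizing_generator {e r₀ r₁ : ℕ} (hn : 1 ≤ n) (hϖ : 0 < ϖ)
    (h0 : h 0 = fun _ _ => ((n : ℝ) + 1) / (2 * n)) (hh : ∀ i ≤ r₁, h i ∈ Sep ϖ T e)
    (hlow : ∀ i, 1 ≤ i → i < r₀ → ∀ κ t, h i κ t = h i 0 t) :
    ∃ w : ℕ → ℝ → ℝ → ℝ, (∀ r, w r ∈ Sep ϖ T e) ∧ (∀ r, r ∉ Finset.Icc r₀ r₁ → w r = 0) ∧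
      (∀ r t, ∫ κ in (0 : ℝ)..ϖ, w r κ t = 0) ∧
      ∀ i, 1 ≤ i → i ≤ r₁ → ∀ κ t, coefTriangle n (2 * n) w h i 0 κ t =
        coefTriangle n (2 * n) w h i 0 0 t := by
  have key : ∀ R ≤ r₁, ∃ w : ℕ → ℝ → ℝ → ℝ, (∀ r, w r ∈ Sep ϖ T e) ∧
      (∀ r, r ∉ Finset.Icc r₀ r₁ → w r = 0) ∧ (∀ r, R < r → w r = 0) ∧
      (∀ r t, ∫ κ in (0 : ℝ)..ϖ, w r κ t = 0) ∧
      ∀ i, 1 ≤ i → i ≤ R → ∀ κ t, coefTriangle n (2 * n) w h i 0 κ t =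
        coefTriangle n (2 * n) w h i 0 0 t := by
    intro R
    induction R with
    | zero =>
      intro _
      refine ⟨0, fun r => Submodule.zero_mem _, fun _ _ => rfl, fun _ _ => rfl, fun r t => by simp,
        fun i h1 h2 => by omega⟩
    | succ R ih =>
      intro hR
      obtain ⟨w, w1, w2, w3, w4, w5⟩ := ih (by omega)
      by_cases hlt : R + 1 < r₀
      -- Below `r₀` nothing is to be done: no generator acts yet and the coefficients are
      -- independent of `κ` by assumption.
      · refine ⟨w, w1, w2, fun r hr => w3 r (by omega), w4, fun i h1 h2 κ t => ?_⟩
        rw [coefTriangle_of_zero i 0 fun r _ hr => w2 r (by simp; omega)]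
        exact hlow i h1 (by omega) κ t
      · have hS : coefTriangle n (2 * n) w h (R + 1) 0 ∈ Sep ϖ T e :=
          coefTriangle_mem w1 (R + 1) 0 fun l hl => hh l (by omega)
        obtain ⟨G, hG, c, -, -, h3, h4⟩ := Sep.exists_primitive hϖ hS
        -- The factor of `∂w_{R+1}/∂κ` in the entry is `2n/(n+1) · (n+1)/(2n) = 1`, so minus the
        -- primitive of the oscillating part cancels exactly that part and leaves the mean value `c
        -- t`.
        refine ⟨Function.update w (R + 1) (-G), fun r => ?_, fun r hr => ?_, fun r hr => ?_,
          fun r t => ?_, fun i h1 h2 κ t => ?_⟩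
        · rcases eq_or_ne r (R + 1) with rfl | hne
          · rw [Function.update_self]; exact Submodule.neg_mem _ hG
          · rw [Function.update_of_ne hne]; exact w1 r
        · rw [Function.update_of_ne]
          · exact w2 r hr
          · rintro rfl
            simp at hr
            omega
        · rw [Function.update_of_ne (by omega)]
          exact w3 r (by omega)
        · rcases eq_or_ne r (R + 1) with rfl | hne
          · rw [Function.update_self]
            simp only [Pi.neg_apply, intervalIntegral.integral_neg, h3, neg_zero]
          · rw [Function.update_of_ne hne]; exact w4 r t
        · rcases eq_or_ne i (R + 1) with rfl | hne
          · have hn0 : (n : ℝ) ≠ 0 := by positivity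
            have hc : ∀ κ t, coefTriangle n (2 * n) (Function.update w (R + 1) (-G)) h (R + 1) 0 κ t
                = c t := by
              intro κ t
              rw [coefTriangle_sub (w := w) h0 R 0 fun r _ hr => Function.update_of_ne (by omega) _ _]
              rw [add_zero, Function.update_self, w3 (R + 1) (by omega), angleDeriv_zero_apply]
              have : angleDeriv (-G) κ t = - angleDeriv G κ t := by simp [angleDeriv]
              rw [this, h4]
              field_simp
              ring
            rw [hc, hc]
          · rw [coefTriangle_congr (w := w) i 0
              fun r _ hr => Function.update_of_ne (by omega) _ _]
            exact w5 i h1 (by omega) κ t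
  obtain ⟨w, w1, w2, -, w4, w5⟩ := key r₁ le_rfl
  exact ⟨w, w1, w2, w4, w5⟩

/-! ### Growth of the coefficients -/

/-- Factorial growth of the derivatives of a sequence of coefficients. -/
structure GrowthBound (c : ℕ) (P R : ℝ) (F : ℕ → ℝ → ℝ → ℝ) : Prop where
  smooth : ∀ j t, ContDiff ℝ ∞ fun κ => F j κ t
  bound : ∀ j k κ t, |iteratedDeriv k (fun x => F j x t) κ| ≤ P * (c + j + k).factorial * R ^ (j + k)

/-- Both binomial factors are dominated by descending factorials, and these complete the remaining
factorial to `(c+j+k)!`. -/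
theorem choose_mul_choose_mul_factorial_le {c j k l m : ℕ} (hl : l ≤ j) (hm : m ≤ k) :
    j.choose l * (k.choose m * m.factorial) * (c + (j - l) + (k - m)).factorial
      ≤ (c + j + k).factorial := by
  have h1 : k.choose m * m.factorial ≤ (c + (j - l) + k).descFactorial m := by
    rw [mul_comm, ← Nat.descFactorial_eq_factorial_mul_choose]
    exact Nat.descFactorial_le _ (by omega)
  have h2 : (c + (j - l) + k).descFactorial m * (c + (j - l) + (k - m)).factorial =
      (c + (j - l) + k).factorial := by
    rw [mul_comm, ← Nat.factorial_mul_descFactorial (show m ≤ c + (j - l) + k by omega)]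
    congr 2
    omega
  have h3 : j.choose l ≤ (c + j + k).descFactorial l := by
    refine le_trans ?_ (Nat.descFactorial_le l (show j ≤ c + j + k by omega))
    rw [Nat.descFactorial_eq_factorial_mul_choose]
    exact Nat.le_mul_of_pos_left _ l.factorial_pos
  have h4 : (c + j + k).descFactorial l * (c + (j - l) + k).factorial = (c + j + k).factorial := by
    rw [mul_comm, ← Nat.factorial_mul_descFactorial (show l ≤ c + j + k by omega)]
    congr 2
    omega
  calc j.choose l * (k.choose m * m.factorial) * (c + (j - l) + (k - m)).factorial
      ≤ (c + j + k).descFactorial l * (c + (j - l) + k).descFactorial m *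
        (c + (j - l) + (k - m)).factorial := by gcongr
    _ = _ := by rw [mul_assoc, h2, h4]

theorem sum_half_pow_le (N : ℕ) : ∑ i ∈ Finset.range N, (1 / 2 : ℝ) ^ i ≤ 2 := by
  have := sum_geometric_two_le N
  simpa using this

theorem contDiff_infty_sum {ι : Type*} {f : ι → ℝ → ℝ} {S : Finset ι}
    (hf : ∀ i ∈ S, ContDiff ℝ ∞ (f i)) : ContDiff ℝ ∞ fun x => ∑ i ∈ S, f i x :=
  ContDiff.sum hf

/-- Because `R ≥ 2 R₀` and `R ≥ 2`, the double sum over `l` (binomial sum) and `m` (Leibniz rule) is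
dominated by two geometric series of ratio `1/2`; hence the factor `4 = 2 · 2`. It does not depend
on `c`, so the estimate can be iterated. -/
theorem GrowthBound.convolution {c : ℕ} {P R C R₀ : ℝ} {F u : ℕ → ℝ → ℝ → ℝ}
    (hF : GrowthBound c P R F) (hP : 0 ≤ P) (hC : 0 ≤ C) (hR₀ : 1 ≤ R₀) (hR : 2 * R₀ ≤ R)
    (hus : ∀ l t, ContDiff ℝ ∞ fun κ => u l κ t)
    (hu : ∀ l k κ t, |iteratedDeriv k (fun x => u l x t) κ| ≤ C * k.factorial * R₀ ^ k) :
    GrowthBound c (4 * P * C) R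
      (fun j κ t => ∑ l ∈ Finset.range (j + 1), (j.choose l : ℝ) * (F (j - l) κ t * u l κ t)) := by
  have hsm : ∀ j l t, ContDiff ℝ ∞ fun κ => (j.choose l : ℝ) * (F (j - l) κ t * u l κ t) :=
    fun j l t => contDiff_const.mul ((hF.smooth _ t).mul (hus l t))
  have hR0 : 0 < R := by linarith
  refine ⟨fun j t => contDiff_infty_sum fun l _ => hsm j l t, fun j k κ t => ?_⟩
  rw [iteratedDeriv_fun_sum fun l _ => (contDiff_top_nat (hsm j l t) k).contDiffAt]
  have hterm : ∀ l ∈ Finset.range (j + 1), |iteratedDeriv k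
      (fun x => (j.choose l : ℝ) * (F (j - l) x t * u l x t)) κ| ≤
      2 * P * C * (c + j + k).factorial * R ^ (j + k) * (1 / 2) ^ l := by
    intro l hl
    have hl' : l ≤ j := by simpa [Nat.lt_succ_iff] using hl
    rw [iteratedDeriv_const_mul_field, show (fun x => F (j - l) x t * u l x t) =
      fun x => u l x t * F (j - l) x t from funext fun x => mul_comm _ _,
      iteratedDeriv_fun_mul (contDiff_top_nat (hus l t) k).contDiffAt
      (contDiff_top_nat (hF.smooth _ t) k).contDiffAt, Finset.mul_sum]
    refine (Finset.abs_sum_le_sum_abs _ _).trans ?_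
    have hm : ∀ m ∈ Finset.range (k + 1), |(j.choose l : ℝ) * ((k.choose m : ℝ) *
        iteratedDeriv m (fun x => u l x t) κ * iteratedDeriv (k - m) (fun x => F (j - l) x t) κ)| ≤
        P * C * (c + j + k).factorial * R ^ (j + k) * (1 / 2) ^ l * (1 / 2) ^ m := by
      intro m hm
      have hm' : m ≤ k := by simpa [Nat.lt_succ_iff] using hm
      rw [abs_mul, abs_mul, abs_mul, Nat.abs_cast, Nat.abs_cast]
      have h1 : R₀ ^ m * R ^ (j - l + (k - m)) ≤ R ^ (j + k) * (1 / 2) ^ l * (1 / 2) ^ m := by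
        have e1 : R ^ (j + k) * (1 / 2) ^ l * (1 / 2) ^ m =
            (R / 2) ^ m * (R / 2) ^ l * R ^ (j - l + (k - m)) := by
          rw [show j + k = m + (l + (j - l + (k - m))) by omega, pow_add, pow_add R l]
          simp only [div_pow, one_pow]
          ring
        rw [e1]
        have h2 : R₀ ^ m ≤ (R / 2) ^ m := by gcongr; linarith
        have h3 : 1 ≤ (R / 2) ^ l := one_le_pow₀ (by linarith)
        have h4 : 0 ≤ (R / 2) ^ m := by positivity
        calc R₀ ^ m * R ^ (j - l + (k - m)) ≤ (R / 2) ^ m * R ^ (j - l + (k - m)) := by gcongr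
          _ ≤ (R / 2) ^ m * (R / 2) ^ l * R ^ (j - l + (k - m)) := by
            gcongr; exact le_mul_of_one_le_right h4 h3
      have h2 : ((j.choose l : ℝ) * ((k.choose m : ℝ) * m.factorial) *
          (c + (j - l) + (k - m)).factorial) ≤ (c + j + k).factorial := by
        exact_mod_cast choose_mul_choose_mul_factorial_le hl' hm'
      calc (j.choose l : ℝ) * ((k.choose m : ℝ) * |iteratedDeriv m (fun x => u l x t) κ| *
            |iteratedDeriv (k - m) (fun x => F (j - l) x t) κ|)
          ≤ (j.choose l : ℝ) * ((k.choose m : ℝ) * (C * m.factorial * R₀ ^ m) *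
            (P * (c + (j - l) + (k - m)).factorial * R ^ (j - l + (k - m)))) := by
            gcongr
            · exact hu l m κ t
            · exact hF.bound (j - l) (k - m) κ t
        _ = P * C * ((j.choose l : ℝ) * ((k.choose m : ℝ) * m.factorial) *
            (c + (j - l) + (k - m)).factorial) * (R₀ ^ m * R ^ (j - l + (k - m))) := by ring
        _ ≤ P * C * (c + j + k).factorial * (R ^ (j + k) * (1 / 2) ^ l * (1 / 2) ^ m) := by
            gcongr
        _ = _ := by ring
    refine (Finset.sum_le_sum hm).trans ?_
    rw [← Finset.mul_sum]
    calc P * C * (c + j + k).factorial * R ^ (j + k) * (1 / 2) ^ l *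
          ∑ i ∈ Finset.range (k + 1), (1 / 2 : ℝ) ^ i
        ≤ P * C * (c + j + k).factorial * R ^ (j + k) * (1 / 2) ^ l * 2 := by
          gcongr; exact sum_half_pow_le _
      _ = _ := by ring
  refine (Finset.abs_sum_le_sum_abs _ _).trans ((Finset.sum_le_sum hterm).trans ?_)
  rw [← Finset.mul_sum]
  calc 2 * P * C * (c + j + k).factorial * R ^ (j + k) *
        ∑ i ∈ Finset.range (j + 1), (1 / 2 : ℝ) ^ i
      ≤ 2 * P * C * (c + j + k).factorial * R ^ (j + k) * 2 := by
        gcongr; exact sum_half_pow_le _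
    _ = _ := by ring

theorem GrowthBound.add {c : ℕ} {P P' R : ℝ} {F G : ℕ → ℝ → ℝ → ℝ} (hF : GrowthBound c P R F)
    (hG : GrowthBound c P' R G) : GrowthBound c (P + P') R (fun j κ t => F j κ t + G j κ t) := by
  refine ⟨fun j t => (hF.smooth j t).add (hG.smooth j t), fun j k κ t => ?_⟩
  rw [iteratedDeriv_fun_add (contDiff_top_nat (hF.smooth j t) k).contDiffAt
    (contDiff_top_nat (hG.smooth j t) k).contDiffAt]
  refine (abs_add_le _ _).trans ((add_le_add (hF.bound j k κ t) (hG.bound j k κ t)).trans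
    (le_of_eq (by ring)))

theorem GrowthBound.neg {c : ℕ} {P R : ℝ} {F : ℕ → ℝ → ℝ → ℝ} (hF : GrowthBound c P R F) :
    GrowthBound c P R (fun j κ t => -F j κ t) := by
  refine ⟨fun j t => (hF.smooth j t).neg, fun j k κ t => ?_⟩
  rw [iteratedDeriv_fun_neg, abs_neg]
  exact hF.bound j k κ t

theorem GrowthBound.shift {c : ℕ} {P R : ℝ} {F : ℕ → ℝ → ℝ → ℝ} (hF : GrowthBound c P R F) :
    GrowthBound (c + 1) (P * R) R (fun j => F (j + 1)) := by
  refine ⟨fun j t => hF.smooth _ t, fun j k κ t => (hF.bound (j + 1) k κ t).trans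
    (le_of_eq ?_)⟩
  rw [show c + (j + 1) + k = c + 1 + j + k by ring, show j + 1 + k = j + k + 1 by ring, pow_succ]
  ring

theorem GrowthBound.angleDeriv {c : ℕ} {P R : ℝ} {F : ℕ → ℝ → ℝ → ℝ} (hF : GrowthBound c P R F) :
    GrowthBound (c + 1) (P * R) R (fun j => angleDeriv (F j)) := by
  refine ⟨fun j t => (contDiff_infty_iff_deriv.1 (hF.smooth j t)).2, fun j k κ t => ?_⟩
  have h := hF.bound j (k + 1) κ t
  rw [iteratedDeriv_succ'] at h
  refine h.trans (le_of_eq ?_)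
  rw [show c + j + (k + 1) = c + 1 + j + k by ring, show j + (k + 1) = j + k + 1 by ring, pow_succ]
  ring

/-- The exponent of `K` appears as a factor growing linearly in `c + j`. Raising the factorial index
`c` by one absorbs it, as it does for the shift and for the angle derivative. -/
theorem GrowthBound.weight {c : ℕ} {P R s : ℝ} (_ : 0 ≤ P) (_ : 0 ≤ R) {F : ℕ → ℝ → ℝ → ℝ}
    (hF : GrowthBound c P R F) :
    GrowthBound (c + 1) (P * (|s| + 1)) R
      (fun j κ t => (s - c - j) / ((n : ℝ) + 1) * F j κ t) := by
  refine ⟨fun j t => contDiff_const.mul (hF.smooth j t), fun j k κ t => ?_⟩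
  rw [iteratedDeriv_const_mul_field, abs_mul, abs_div, abs_of_pos (show (0 : ℝ) < (n : ℝ) + 1 by positivity)]
  have h1 : |s - c - j| ≤ |s| + (c + j) := by
    calc |s - c - j| = |s + -((c : ℝ) + j)| := by congr 1; ring
      _ ≤ |s| + |-((c : ℝ) + j)| := abs_add_le _ _
      _ = _ := by rw [abs_neg, abs_of_nonneg (show (0 : ℝ) ≤ (c : ℝ) + j by positivity)]
  have h2 : |s - c - j| / ((n : ℝ) + 1) ≤ (|s| + 1) * (c + 1 + j + k) := by
    refine (div_le_self (abs_nonneg _) (by linarith [n.cast_nonneg (α := ℝ)])).trans (h1.trans ?_)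
    have := abs_nonneg s
    have h3 : (0 : ℝ) ≤ c := by positivity
    have h4 : (0 : ℝ) ≤ j := by positivity
    have h5 : (0 : ℝ) ≤ k := by positivity
    nlinarith [mul_nonneg this h3, mul_nonneg this h4, mul_nonneg this h5]
  calc |s - c - j| / ((n : ℝ) + 1) * |iteratedDeriv k (fun x => F j x t) κ|
      ≤ ((|s| + 1) * (c + 1 + j + k)) * (P * (c + j + k).factorial * R ^ (j + k)) := by
        gcongr; exact hF.bound j k κ t
    _ = _ := by
        rw [show c + 1 + j + k = (c + j + k) + 1 by ring, Nat.factorial_succ]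
        push_cast
        ring

/-- Bounds for the functions `∂w_{l+1}/∂κ` and `(n-l)/(n+1) w_{l+1}` that act in `coefStep`. -/
structure GeneratorBound (n : ℕ) (w : ℕ → ℝ → ℝ → ℝ) (C R₀ : ℝ) : Prop where
  nonneg : 0 ≤ C
  one_le : 1 ≤ R₀
  smooth : ∀ l t, ContDiff ℝ ∞ fun κ => w l κ t
  bound_deriv : ∀ l k κ t, |iteratedDeriv k (fun x => angleDeriv (w (l + 1)) x t) κ|
    ≤ C * k.factorial * R₀ ^ k
  bound : ∀ l k κ t, |iteratedDeriv k (fun x => ((n : ℝ) - l) / ((n : ℝ) + 1) * w (l + 1) x t) κ|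
    ≤ C * k.factorial * R₀ ^ k

theorem exists_common_bound {u : ℕ → ℝ → ℝ → ℝ} {e N : ℕ} (hT : 0 < T)
    (hu : ∀ l, u l ∈ Sep ϖ T e) (h0 : ∀ l, N ≤ l → u l = 0) : ∃ C R₀ : ℝ, 0 ≤ C ∧ 1 ≤ R₀ ∧
      ∀ l k κ t, |iteratedDeriv k (fun x => u l x t) κ| ≤ C * k.factorial * R₀ ^ k := by
  choose C R hC hR hb using fun l => Sep.bound hT (hu l)
  refine ⟨∑ l ∈ Finset.range N, C l, 1 + ∑ l ∈ Finset.range N, R l,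
    Finset.sum_nonneg fun l _ => hC l, ?_, fun l k κ t => ?_⟩
  · have : 0 ≤ ∑ l ∈ Finset.range N, R l := Finset.sum_nonneg fun l _ => by linarith [hR l]
    linarith
  have hS : 0 ≤ ∑ l ∈ Finset.range N, C l := Finset.sum_nonneg fun l _ => hC l
  have hS' : 0 ≤ ∑ l ∈ Finset.range N, R l := Finset.sum_nonneg fun l _ => by linarith [hR l]
  by_cases hl : l < N
  · have h1 : C l ≤ ∑ l ∈ Finset.range N, C l :=
      Finset.single_le_sum (fun l _ => hC l) (Finset.mem_range.2 hl)
    have h2 : R l ≤ ∑ l ∈ Finset.range N, R l :=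
      Finset.single_le_sum (fun l _ => by linarith [hR l]) (Finset.mem_range.2 hl)
    refine (hb l k κ t).trans ?_
    have := hR l
    gcongr
    linarith
  · rw [h0 l (by omega)]
    have : (fun x => (0 : ℝ → ℝ → ℝ) x t) = fun _ => (0 : ℝ) := rfl
    rw [this, iteratedDeriv_const]
    simp
    positivity

theorem exists_generatorBound {e N : ℕ} (hT : 0 < T) (hw : ∀ r, w r ∈ Sep ϖ T e)
    (h0 : ∀ r, N ≤ r → w r = 0) : ∃ C R₀, GeneratorBound n w C R₀ := by
  obtain ⟨C, R, hC, hR, hb⟩ := exists_common_bound hT (u := fun l => angleDeriv (w (l + 1)))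
    (fun l => Sep.angleDeriv_mem (hw _)) (N := N) fun l hl => by
      rw [h0 _ (by omega), Sep.angleDeriv_zero]
  obtain ⟨C', R', hC', hR', hb'⟩ := exists_common_bound hT
    (u := fun l => (((n : ℝ) - l) / ((n : ℝ) + 1)) • w (l + 1))
    (fun l => Submodule.smul_mem _ _ (hw _)) (N := N) fun l hl => by
      rw [h0 _ (by omega), smul_zero]
  refine ⟨C + C', R + R', by positivity, by linarith, fun l t => Sep.contDiff_angle (hw l) t,
    fun l k κ t => (hb l k κ t).trans ?_, fun l k κ t => (hb' l k κ t).trans ?_⟩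
  · gcongr <;> linarith
  · gcongr <;> linarith

/-- A row consists of a shift, a weighted convolution and a convolution with the angle derivative.
Each raises the factorial index by one, at the cost of `R`, `4C(|s|+1)` and `4CR` respectively;
their sum is the rate per row. For `j = k = 0` this is the growth `i! L^i` of the diagonal. -/
theorem GrowthBound.coefTriangle {M R C R₀ : ℝ} (hw : GeneratorBound n w C R₀)
    (hR : 2 * R₀ ≤ R) (hM : 0 ≤ M) (hh : GrowthBound 0 M R h) (i : ℕ) :
    GrowthBound i (M * (R + 4 * C * (|s| + 1) + 4 * C * R) ^ i) R (coefTriangle n s w h i) := by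
  set L := R + 4 * C * (|s| + 1) + 4 * C * R with hL
  have hR1 := hw.one_le
  have hC := hw.nonneg
  have hR0 : 0 ≤ R := by linarith
  have hL0 : 0 ≤ L := by positivity
  induction i with
  | zero => simpa [LieOscillator.coefTriangle] using hh
  | succ i ih =>
    have hP : 0 ≤ M * L ^ i := by positivity
    have h1 := (ih.weight (n := n) (s := s) hP hR0).convolution (by positivity) hC hR1 hR
      (u := fun l => LieOscillator.angleDeriv (w (l + 1)))
      (fun l t => (contDiff_infty_iff_deriv.1 (hw.smooth (l + 1) t)).2) hw.bound_deriv
    have h2 := ih.angleDeriv.convolution (by positivity) hC hR1 hR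
      (u := fun l κ t => ((n : ℝ) - l) / ((n : ℝ) + 1) * w (l + 1) κ t)
      (fun l t => contDiff_const.mul (hw.smooth (l + 1) t)) hw.bound
    convert! (ih.shift.add (h1.add h2.neg)) using 1
    · rw [hL]; ring
    · funext j κ t
      simp only [LieOscillator.coefTriangle, coefStep, mul_sub, Finset.sum_sub_distrib]
      rw [← sub_eq_add_neg]

/-! ### The Lie triangle in terms of the coefficients -/

theorem kpow_add {K : ℝ} (hK : 0 < K) (a b : ℤ) : kpow n (a + b) K = kpow n a K * kpow n b K := by
  rw [kpow, kpow, kpow, ← Real.rpow_add hK]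
  congr 1
  push_cast
  ring

theorem kpow_pos {K : ℝ} (hK : 0 < K) (a : ℤ) : 0 < kpow n a K := Real.rpow_pos_of_pos hK _

theorem hasDerivAt_kpow {K : ℝ} (hK : 0 < K) (a : ℤ) :
    HasDerivAt (kpow n a) ((a : ℝ) / ((n : ℝ) + 1) * kpow n (a - (n + 1)) K) K := by
  have := Real.hasDerivAt_rpow_const (x := K) (p := (a : ℝ) / ((n : ℝ) + 1)) (Or.inl hK.ne')
  unfold kpow
  convert! this using 2
  congr 1
  push_cast
  field_simp

theorem bracket_kpow {A B : PhaseFun} {a b : ℤ} {F G : ℝ → ℝ → ℝ}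
    (hA : ∀ K κ t, 0 < K → A K κ t = kpow n a K * F κ t)
    (hB : ∀ K κ t, 0 < K → B K κ t = kpow n b K * G κ t)
    {K : ℝ} (hK : 0 < K) (κ t : ℝ) :
    bracket A B K κ t = kpow n (a + b - (n + 1)) K *
      ((a : ℝ) / ((n : ℝ) + 1) * F κ t * angleDeriv G κ t -
        angleDeriv F κ t * ((b : ℝ) / ((n : ℝ) + 1) * G κ t)) := by
  have hK' : ∀ {A : PhaseFun} {a : ℤ} {F : ℝ → ℝ → ℝ},
      (∀ K κ t, 0 < K → A K κ t = kpow n a K * F κ t) →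
      deriv (fun k => A k κ t) K = (a : ℝ) / ((n : ℝ) + 1) * kpow n (a - (n + 1)) K * F κ t ∧
      deriv (fun x => A K x t) κ = kpow n a K * angleDeriv F κ t := by
    intro A a F hA
    constructor
    · have : (fun k => A k κ t) =ᶠ[𝓝 K] fun k => kpow n a k * F κ t := by
        filter_upwards [Ioi_mem_nhds hK] with k hk using hA k κ t hk
      rw [this.deriv_eq]
      exact ((hasDerivAt_kpow hK a).mul_const _).deriv
    · rw [show (fun x => A K x t) = fun x => kpow n a K * F x t from funext fun x => hA K x t hK]
      simp [angleDeriv]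
  obtain ⟨a1, a2⟩ := hK' hA
  obtain ⟨b1, b2⟩ := hK' hB
  rw [bracket, a1, a2, b1, b2, show a + b - (n + 1) = (a - (n + 1)) + b by ring, kpow_add hK]
  have : kpow n a K * kpow n (b - (n + 1)) K = kpow n (a - (n + 1)) K * kpow n b K := by
    rw [← kpow_add hK, ← kpow_add hK]
    congr 1
    ring
  linear_combination (-(angleDeriv F κ t) * ((b : ℝ) / ((n : ℝ) + 1) * G κ t)) * this

/-- The bracket of `A_{j-l}^i` with `W_{l+1}` has degree `(σ-i-(j-l)) + (n-l) - (n+1) = σ-(i+1)-j`,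
independent of `l`, so all summands share one power of `K`. -/
theorem lieTriangle_eq {W A : ℕ → PhaseFun} {σ : ℤ}
    (hW : ∀ r K κ t, 0 < K → W r K κ t = kpow n ((n : ℤ) - r + 1) K * w r κ t)
    (hA : ∀ j K κ t, 0 < K → A j K κ t = kpow n (σ - j) K * h j κ t) (i : ℕ) : ∀ j K κ t, 0 < K →
      lieTriangle W A i j K κ t = kpow n (σ - i - j) K * coefTriangle n σ w h i j κ t := by
  induction i with
  | zero => intro j K κ t hK; simpa [lieTriangle, coefTriangle] using hA j K κ t hK
  | succ i ih =>
    intro j K κ t hK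
    simp only [lieTriangle, coefTriangle, coefStep]
    rw [ih (j + 1) K κ t hK, mul_add, Finset.mul_sum]
    congr 1
    · congr 2
      push_cast
      ring
    · refine Finset.sum_congr rfl fun l hl => ?_
      have hl' : l ≤ j := by simpa [Nat.lt_succ_iff] using hl
      rw [bracket_kpow (ih (j - l)) (hW (l + 1)) hK]
      have e : σ - i - ((j - l : ℕ) : ℤ) + ((n : ℤ) - ((l + 1 : ℕ) : ℤ) + 1) - (n + 1) =
          σ - ((i + 1 : ℕ) : ℤ) - j := by
        push_cast [hl']
        ring
      rw [e]
      push_cast [hl']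
      ring

end

/-! ### Exponential generating functions -/

/-- The exponential generating function of a sequence. -/
noncomputable def egf (F : ℕ → ℝ) (μ : ℝ) : ℝ := ∑' j, μ ^ j / (j.factorial : ℝ) * F j

theorem egf_zero (F : ℕ → ℝ) : egf F 0 = F 0 := by
  rw [egf, tsum_eq_single 0]
  · simp
  · intro j hj
    simp [hj]

/-- From `(c+j)! ≤ 2^(c+j) c! j!` the terms are geometric with ratio `2|μ|R ≤ 1/2`. This is the
origin of the condition `|μ| R ≤ 1/4` used throughout. -/
theorem abs_egf_term_le {F : ℕ → ℝ} {c : ℕ} {P R μ : ℝ} (hP : 0 ≤ P) (hR : 0 ≤ R)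
    (hμ : |μ| * R ≤ 1 / 4) {j : ℕ} (hF : |F j| ≤ P * (c + j).factorial * R ^ j) :
    |μ ^ j / (j.factorial : ℝ) * F j| ≤ P * c.factorial * 2 ^ c * (1 / 2) ^ j := by
  have h1 : ((c + j).factorial : ℝ) ≤ 2 ^ (c + j) * (c.factorial * j.factorial) := by
    have h2 : (c + j).factorial ≤ 2 ^ (c + j) * (c.factorial * j.factorial) := by
      rw [← Nat.choose_mul_factorial_mul_factorial (Nat.le_add_right c j), Nat.add_sub_cancel_left,
        mul_assoc]
      exact Nat.mul_le_mul_right _ (Nat.choose_le_two_pow _ _)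
    exact_mod_cast h2
  have hj : (0 : ℝ) < j.factorial := by positivity
  rw [abs_mul, abs_div, abs_pow, Nat.abs_cast]
  calc |μ| ^ j / (j.factorial : ℝ) * |F j|
      ≤ |μ| ^ j / (j.factorial : ℝ) *
        (P * (2 ^ (c + j) * (c.factorial * j.factorial)) * R ^ j) := by
        gcongr; exact hF.trans (by gcongr)
    _ = P * c.factorial * 2 ^ c * (2 * (|μ| * R)) ^ j := by
        rw [mul_pow, mul_pow, pow_add]; field_simp
    _ ≤ _ := by gcongr; linarith

theorem summable_half (C : ℝ) : Summable fun j : ℕ => C * (1 / 2 : ℝ) ^ j :=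
  (summable_geometric_of_lt_one (by norm_num) (by norm_num)).mul_left C

theorem summable_egf {F : ℕ → ℝ} {c : ℕ} {P R μ : ℝ} (hP : 0 ≤ P) (hR : 0 ≤ R)
    (hμ : |μ| * R ≤ 1 / 4) (hF : ∀ j, |F j| ≤ P * (c + j).factorial * R ^ j) :
    Summable fun j => ‖μ ^ j / (j.factorial : ℝ) * F j‖ :=
  Summable.of_nonneg_of_le (fun _ => norm_nonneg _)
    (fun j => abs_egf_term_le hP hR hμ (hF j)) (summable_half (P * c.factorial * 2 ^ c))

theorem abs_egf_le {F : ℕ → ℝ} {c : ℕ} {P R μ : ℝ} (hP : 0 ≤ P) (hR : 0 ≤ R)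
    (hμ : |μ| * R ≤ 1 / 4) (hF : ∀ j, |F j| ≤ P * (c + j).factorial * R ^ j) :
    |egf F μ| ≤ 2 * P * c.factorial * 2 ^ c := by
  refine (norm_tsum_le_tsum_norm (summable_egf hP hR hμ hF)).trans ?_
  refine ((summable_egf hP hR hμ hF).tsum_le_tsum (fun j => abs_egf_term_le hP hR hμ (hF j))
    (summable_half (P * c.factorial * 2 ^ c))).trans (le_of_eq ?_)
  rw [tsum_mul_left, tsum_geometric_two]
  ring

theorem summable_egf_of_bounded {u : ℕ → ℝ} {C : ℝ} (hu : ∀ l, |u l| ≤ C) (μ : ℝ) :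
    Summable fun j => ‖μ ^ j / (j.factorial : ℝ) * u j‖ := by
  refine Summable.of_nonneg_of_le (fun _ => norm_nonneg _) (fun j => ?_)
    ((Real.summable_pow_div_factorial |μ|).mul_right C)
  rw [Real.norm_eq_abs, abs_mul, abs_div, abs_pow, Nat.abs_cast]
  gcongr
  exact hu j

/-- The binomial sums of the Lie triangle are Cauchy products of exponential generating functions:
summing a row over `j` turns the bracket sum into honest products of functions of `μ`. -/
theorem egf_convolution {F u : ℕ → ℝ} {μ : ℝ}
    (hF : Summable fun j => ‖μ ^ j / (j.factorial : ℝ) * F j‖)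
    (hu : Summable fun j => ‖μ ^ j / (j.factorial : ℝ) * u j‖) :
    HasSum (fun j : ℕ => μ ^ j / (j.factorial : ℝ) *
      ∑ l ∈ Finset.range (j + 1), (j.choose l : ℝ) * (F (j - l) * u l)) (egf F μ * egf u μ) := by
  have h := hasSum_sum_range_mul_of_summable_norm hu hF
  rw [mul_comm (egf F μ)]
  convert! h using 2 with j
  rw [Finset.mul_sum]
  refine Finset.sum_congr rfl fun l hl => ?_
  have hl' : l ≤ j := by simpa [Nat.lt_succ_iff] using hl
  have hc : (j.choose l : ℝ) * l.factorial * (j - l).factorial = j.factorial := by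
    exact_mod_cast Nat.choose_mul_factorial_mul_factorial hl'
  have h1 : (l.factorial : ℝ) ≠ 0 := by positivity
  have h2 : ((j - l).factorial : ℝ) ≠ 0 := by positivity
  have h3 : (j.factorial : ℝ) ≠ 0 := by positivity
  have h4 : μ ^ j = μ ^ l * μ ^ (j - l) := by rw [← pow_add, Nat.add_sub_cancel' hl']
  rw [h4]
  field_simp
  linear_combination (μ ^ l * μ ^ (j - l) * F (j - l) * u l) * hc

theorem hasSum_egf_deriv {F : ℕ → ℝ} {μ : ℝ}
    (hF : Summable fun j => ‖μ ^ j / (j.factorial : ℝ) * F (j + 1)‖) :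
    HasSum (fun j : ℕ => (j : ℝ) * μ ^ (j - 1) / (j.factorial : ℝ) * F j)
      (egf (fun j => F (j + 1)) μ) := by
  have h := (hasSum_nat_add_iff (f := fun j : ℕ => (j : ℝ) * μ ^ (j - 1) / (j.factorial : ℝ) * F j)
    (g := egf (fun j => F (j + 1)) μ) 1).1 ?_
  · simpa using h
  · convert! hF.of_norm.hasSum using 2 with j
    rw [Nat.add_sub_cancel, Nat.factorial_succ]
    push_cast
    have : (j : ℝ) + 1 ≠ 0 := by positivity
    have : (j.factorial : ℝ) ≠ 0 := by positivity
    field_simp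

theorem GrowthBound.abs_le {c : ℕ} {P R : ℝ} {F : ℕ → ℝ → ℝ → ℝ} (hF : GrowthBound c P R F)
    (κ t : ℝ) (j : ℕ) : |F j κ t| ≤ P * (c + j).factorial * R ^ j := by
  simpa using hF.bound j 0 κ t

/-- Termwise differentiation on the strip `|μ| R < 1/4`, which is convex. Both partial derivatives
again obey growth bounds with `c + 1`, so the derivatives are dominated by a geometric series. -/
theorem hasFDerivAt_egf {c : ℕ} {P R : ℝ} {F : ℕ → ℝ → ℝ → ℝ} (hF : GrowthBound c P R F)
    (hP : 0 ≤ P) (hR : 0 ≤ R) {μ κ : ℝ} (hμ : |μ| * R < 1 / 4) (t : ℝ) :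
    HasFDerivAt (fun z : ℝ × ℝ => egf (fun j => F j z.2 t) z.1)
      (egf (fun j => F (j + 1) κ t) μ • ContinuousLinearMap.fst ℝ ℝ ℝ +
        egf (fun j => angleDeriv (F j) κ t) μ • ContinuousLinearMap.snd ℝ ℝ ℝ) (μ, κ) := by
  let f' : ℕ → ℝ × ℝ → (ℝ × ℝ →L[ℝ] ℝ) := fun j z =>
    ((j : ℝ) * z.1 ^ (j - 1) / (j.factorial : ℝ) * F j z.2 t) • ContinuousLinearMap.fst ℝ ℝ ℝ +
      (z.1 ^ j / (j.factorial : ℝ) * angleDeriv (F j) z.2 t) • ContinuousLinearMap.snd ℝ ℝ ℝ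
  have hPR : 0 ≤ P * R := by positivity
  let S : Set (ℝ × ℝ) := {z | |z.1| * R < 1 / 4}
  have hSo : IsOpen S := isOpen_lt (by fun_prop) continuous_const
  have hSc : Convex ℝ S := by
    have e : S = (fun z : ℝ × ℝ => z.1 * R) ⁻¹' Metric.ball 0 (1 / 4) := by
      ext z
      simp [S, abs_of_nonneg hR]
    rw [e]
    exact (convex_ball _ _).is_linear_preimage
      ⟨fun x y => by simp [add_mul], fun a x => by simp [mul_assoc]⟩
  have hder : ∀ j, ∀ z ∈ S, HasFDerivAt
      (fun z : ℝ × ℝ => z.1 ^ j / (j.factorial : ℝ) * F j z.2 t) (f' j z) z := by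
    intro j z _
    have h1 : HasFDerivAt (fun z : ℝ × ℝ => z.1 ^ j / (j.factorial : ℝ))
        (((j : ℝ) * z.1 ^ (j - 1) / (j.factorial : ℝ)) • ContinuousLinearMap.fst ℝ ℝ ℝ) z :=
      ((hasDerivAt_pow j z.1).div_const _).comp_hasFDerivAt z hasFDerivAt_fst
    have h2 : HasFDerivAt (fun z : ℝ × ℝ => F j z.2 t)
        (angleDeriv (F j) z.2 t • ContinuousLinearMap.snd ℝ ℝ ℝ) z :=
      (((hF.smooth j t).differentiable (by simp) z.2).hasDerivAt).comp_hasFDerivAt z hasFDerivAt_snd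
    refine (h1.mul h2).congr_fderiv ?_
    simp only [f', smul_smul]
    rw [add_comm]
    congr 2
    ring
  have hbd : ∀ j, ∀ z ∈ S, ‖f' j z‖ ≤
      (2 * (P * R * (c + 1).factorial * 2 ^ (c + 1)) +
        P * R * (c + 1).factorial * 2 ^ (c + 1)) * (1 / 2) ^ j := by
    intro j z hz
    have hz' : |z.1| * R ≤ 1 / 4 := le_of_lt hz
    refine (norm_add_le _ _).trans ?_
    rw [norm_smul, norm_smul, add_mul]
    refine add_le_add ((mul_le_of_le_one_right (norm_nonneg _)
      (ContinuousLinearMap.norm_fst_le ..)).trans ?_)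
      ((mul_le_of_le_one_right (norm_nonneg _) (ContinuousLinearMap.norm_snd_le ..)).trans
      (abs_egf_term_le (F := fun j => angleDeriv (F j) z.2 t) (c := c + 1) hPR hR hz'
        (by simpa using hF.angleDeriv.abs_le z.2 t j)))
    rcases j with _ | j
    · simp
      positivity
    · have := abs_egf_term_le (F := fun j => F (j + 1) z.2 t) (c := c + 1) hPR hR hz'
        (hF.shift.abs_le z.2 t j)
      have e : ((j + 1 : ℕ) : ℝ) * z.1 ^ (j + 1 - 1) / ((j + 1).factorial : ℝ) * F (j + 1) z.2 t =
          z.1 ^ j / (j.factorial : ℝ) * F (j + 1) z.2 t := by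
        rw [Nat.add_sub_cancel, Nat.factorial_succ]
        push_cast
        have : (j : ℝ) + 1 ≠ 0 := by positivity
        have : (j.factorial : ℝ) ≠ 0 := by positivity
        field_simp
      rw [e, Real.norm_eq_abs]
      refine this.trans (le_of_eq ?_)
      rw [pow_succ]
      ring
  have hz : ((μ, κ) : ℝ × ℝ) ∈ S := hμ
  have key := hasFDerivAt_tsum_of_isPreconnected (summable_half _) hSo hSc.isPreconnected
    hder hbd hz (summable_egf hP hR hμ.le (hF.abs_le κ t)).of_norm hz
  refine key.congr_fderiv ?_
  have h1 := (hasSum_egf_deriv (F := fun j => F j κ t)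
    (summable_egf hPR hR hμ.le (hF.shift.abs_le κ t))).smul_const (ContinuousLinearMap.fst ℝ ℝ ℝ)
  have h2 := ((summable_egf hPR hR hμ.le (hF.angleDeriv.abs_le κ t)).of_norm.hasSum).smul_const
    (ContinuousLinearMap.snd ℝ ℝ ℝ)
  exact (h1.add h2).tsum_eq

/-! ### Derivatives of graded expansions along the field of a generating function. -/

section

variable {n : ℕ} {w h : ℕ → ℝ → ℝ → ℝ} {ϖ T : ℝ}

theorem kpow_neg_one_pow {K : ℝ} (hK : 0 < K) (l : ℕ) : kpow n (-1) K ^ l = kpow n (-l) K := by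
  induction l with
  | zero => simp [kpow]
  | succ l ih =>
    rw [pow_succ, ih, ← kpow_add hK]
    congr 1
    push_cast
    ring

theorem kpow_sub {K : ℝ} (hK : 0 < K) (σ : ℤ) (l : ℕ) :
    kpow n (σ - l) K = kpow n σ K * kpow n (-1) K ^ l := by
  rw [kpow_neg_one_pow hK, ← kpow_add hK]
  rfl

/-- The `κ`-derivative of the generating function, without the power of `K`. -/
noncomputable def genAngle (w : ℕ → ℝ → ℝ → ℝ) (κ t μ : ℝ) : ℝ :=
  egf (fun l => angleDeriv (w (l + 1)) κ t) μ

/-- The `K`-derivative of the generating function, without the power of `K`. -/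
noncomputable def genRadial (n : ℕ) (w : ℕ → ℝ → ℝ → ℝ) (κ t μ : ℝ) : ℝ :=
  egf (fun l => ((n : ℝ) - l) / ((n : ℝ) + 1) * w (l + 1) κ t) μ

/-- The action of a vector field of the form given by a generating function on an expansion in
powers of `K ^ (-1 / (n + 1))`. -/
theorem hasDerivWithinAt_expansion {C R₀ P R : ℝ} {i : ℕ} (hw : GeneratorBound n w C R₀)
    {F : ℕ → ℝ → ℝ → ℝ} (hF : GrowthBound i P R F) (hP : 0 ≤ P) (hR : 0 ≤ R) {σ : ℤ} (t : ℝ)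
    {k x : ℝ → ℝ} {S : Set ℝ} {ε : ℝ} (hk : 0 < k ε)
    (hμ : |ε * kpow n (-1) (k ε)| * R < 1 / 4)
    (hk' : HasDerivWithinAt k
      (kpow n n (k ε) * genAngle w (x ε) t (ε * kpow n (-1) (k ε))) S ε)
    (hx' : HasDerivWithinAt x
      (-(kpow n (-1) (k ε) * genRadial n w (x ε) t (ε * kpow n (-1) (k ε)))) S ε) :
    HasDerivWithinAt
      (fun e => kpow n σ (k e) * egf (fun j => F j (x e) t) (e * kpow n (-1) (k e)))
      (kpow n (σ - 1) (k ε) *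
        egf (fun j => coefStep n σ w F j (x ε) t) (ε * kpow n (-1) (k ε))) S ε := by
  set μ := ε * kpow n (-1) (k ε) with hμd
  set p := genAngle w (x ε) t μ with hp
  set q := genRadial n w (x ε) t μ with hq
  have hkp : ∀ a : ℤ, HasDerivWithinAt (fun e => kpow n a (k e))
      ((a : ℝ) / ((n : ℝ) + 1) * kpow n (a - 1) (k ε) * p) S ε := by
    intro a
    have := (hasDerivAt_kpow (n := n) hk a).comp_hasDerivWithinAt ε hk'
    convert! this using 1
    rw [show a - 1 = (a - (n + 1)) + n by ring, kpow_add hk]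
    ring
  have hmu : HasDerivWithinAt (fun e => e * kpow n (-1) (k e))
      (kpow n (-1) (k ε) * (1 - μ * p / ((n : ℝ) + 1))) S ε := by
    have := (hasDerivWithinAt_id ε S).mul (hkp (-1))
    convert! this using 1
    rw [show (-1 : ℤ) - 1 = -1 + -1 by ring, kpow_add hk, hμd]
    push_cast
    simp only [id]
    ring
  have hpair : HasDerivWithinAt (fun e => (e * kpow n (-1) (k e), x e))
      (kpow n (-1) (k ε) * (1 - μ * p / ((n : ℝ) + 1)), -(kpow n (-1) (k ε) * q)) S ε :=
    hmu.prodMk hx'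
  have hE := (hasFDerivAt_egf (κ := x ε) hF hP hR hμ t).comp_hasDerivWithinAt ε hpair
  have hprod := (hkp σ).mul hE
  have hPR : 0 ≤ P * R := by positivity
  have sF := summable_egf hP hR hμ.le (hF.abs_le (x ε) t)
  have sS := summable_egf hPR hR hμ.le (hF.shift.abs_le (x ε) t)
  have sD := summable_egf hPR hR hμ.le (hF.angleDeriv.abs_le (x ε) t)
  have su1 := summable_egf_of_bounded (u := fun l => angleDeriv (w (l + 1)) (x ε) t) (C := C)
    (fun l => by simpa using hw.bound_deriv l 0 (x ε) t) μ
  have su2 := summable_egf_of_bounded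
    (u := fun l => ((n : ℝ) - l) / ((n : ℝ) + 1) * w (l + 1) (x ε) t) (C := C)
    (fun l => by simpa using hw.bound l 0 (x ε) t) μ
  -- The weight `σ - j` splits into the constant `σ` and the operator `-μ d/dμ`. The latter is what
  -- the chain rule produces from the dependence of `μ` on `K`.
  have hwt : HasSum (fun j : ℕ => μ ^ j / (j.factorial : ℝ) *
      (((σ : ℝ) - j) / ((n : ℝ) + 1) * F j (x ε) t))
      ((σ : ℝ) / ((n : ℝ) + 1) * egf (fun j => F j (x ε) t) μ -
        μ / ((n : ℝ) + 1) * egf (fun j => F (j + 1) (x ε) t) μ) := by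
    have h1 := sF.of_norm.hasSum.mul_left ((σ : ℝ) / ((n : ℝ) + 1))
    have h2 := (hasSum_egf_deriv (F := fun j => F j (x ε) t) sS).mul_left (μ / ((n : ℝ) + 1))
    convert! h1.sub h2 using 2 with j
    rcases j with _ | j
    · simp
    · rw [Nat.add_sub_cancel, pow_succ]
      ring
  have swt : Summable (fun j : ℕ => ‖μ ^ j / (j.factorial : ℝ) *
      (((σ : ℝ) - j) / ((n : ℝ) + 1) * F j (x ε) t)‖) := hwt.summable.norm
  have hc1 := egf_convolution swt su1
  have hc2 := egf_convolution sD su2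
  have htot := sS.of_norm.hasSum.add (hc1.sub hc2)
  -- `coefStep` read as generating functions: the shift is the explicit `ε`-derivative, the weighted
  -- product comes from the motion of `K`, and the last product from the motion of `κ`.
  have hval : egf (fun j => coefStep n σ w F j (x ε) t) μ =
      egf (fun j => F (j + 1) (x ε) t) μ +
        (((σ : ℝ) / ((n : ℝ) + 1) * egf (fun j => F j (x ε) t) μ -
        μ / ((n : ℝ) + 1) * egf (fun j => F (j + 1) (x ε) t) μ) * p -
        egf (fun j => angleDeriv (F j) (x ε) t) μ * q) := by
    rw [← hwt.tsum_eq]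
    refine Eq.trans ?_ htot.tsum_eq
    refine tsum_congr fun j => ?_
    simp only [coefStep]
    rw [← mul_sub, ← mul_add, ← Finset.sum_sub_distrib]
    congr 2
    refine Finset.sum_congr rfl fun l _ => ?_
    ring
  refine hprod.congr_deriv ?_
  rw [hval, show σ - 1 = σ + -1 by ring, kpow_add hk]
  simp only [add_apply, smul_apply,
    ContinuousLinearMap.coe_fst', ContinuousLinearMap.coe_snd', smul_eq_mul, Function.comp_apply]
  rw [← hμd]
  ring

/-! ### The vector field of the generating function -/

/-- The term `K ^ ((n - r + 1) / (n + 1)) w_r(κ, t)` of a generating function. -/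
noncomputable def genTerm (n : ℕ) (w : ℕ → ℝ → ℝ → ℝ) : ℕ → PhaseFun := fun r K κ t =>
  kpow n ((n : ℤ) - r + 1) K * w r κ t

theorem egf_eq_sum {s : Finset ℕ} (hs : ∀ r ∈ s, 1 ≤ r) {u : ℕ → ℝ}
    (hu : ∀ r, r ∉ s → u r = 0) (μ : ℝ) : egf (fun l => u (l + 1)) μ =
      ∑ r ∈ s, μ ^ (r - 1) / ((r - 1).factorial : ℝ) * u r := by
  have hinj : Set.InjOn (fun r => r - 1) (s : Set ℕ) := fun r hr r' hr' h => by
    have := hs r hr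
    have := hs r' hr'
    simp only at h
    omega
  rw [egf, tsum_eq_sum (s := s.image fun r => r - 1), Finset.sum_image hinj]
  · refine Finset.sum_congr rfl fun r hr => ?_
    rw [Nat.sub_add_cancel (hs r hr)]
  · intro l hl
    rw [hu (l + 1), mul_zero]
    intro hl'
    exact hl (Finset.mem_image.2 ⟨l + 1, hl', rfl⟩)

theorem genFun_genTerm {s : Finset ℕ} (hs : ∀ r ∈ s, 1 ≤ r) (ε K κ t : ℝ) :
    genFun s (genTerm n w) ε K κ t = ∑ r ∈ s, ε ^ (r - 1) / ((r - 1).factorial : ℝ) *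
      (kpow n ((n : ℤ) - r + 1) K * w r κ t) := by
  rw [genFun]
  refine Finset.sum_congr rfl fun r hr => ?_
  rw [epsTerm, Nat.sub_add_cancel (hs r hr), genTerm]

theorem hamField_genFun {s : Finset ℕ} (hs : ∀ r ∈ s, 1 ≤ r) (hw0 : ∀ r, r ∉ s → w r = 0)
    (hw : ∀ r t, ContDiff ℝ ∞ fun κ => w r κ t) (ε t : ℝ) {K : ℝ} (hK : 0 < K) (κ : ℝ) :
    hamField (genFun s (genTerm n w) ε) t (K, κ) =
      (kpow n n K * genAngle w κ t (ε * kpow n (-1) K),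
        -(kpow n (-1) K * genRadial n w κ t (ε * kpow n (-1) K))) := by
  have e : genFun s (genTerm n w) ε = fun K κ t =>
      ∑ r ∈ s, ε ^ (r - 1) / ((r - 1).factorial : ℝ) *
      (kpow n ((n : ℤ) - r + 1) K * w r κ t) := by
    funext K κ t
    exact genFun_genTerm hs ε K κ t
  rw [hamField, e]
  have hpow : ∀ (l : ℕ) (a : ℤ), kpow n (a - l) K = kpow n a K * kpow n (-1) K ^ l :=
    fun l a => kpow_sub hK a l
  refine Prod.ext ?_ ?_
  · have hd : HasDerivAt (fun x => ∑ r ∈ s, ε ^ (r - 1) / ((r - 1).factorial : ℝ) *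
        (kpow n ((n : ℤ) - r + 1) K * w r x t)) (∑ r ∈ s, ε ^ (r - 1) / ((r - 1).factorial : ℝ) *
        (kpow n ((n : ℤ) - r + 1) K * angleDeriv (w r) κ t)) κ :=
      HasDerivAt.fun_sum fun r _ =>
        ((((hw r t).differentiable (by simp) κ).hasDerivAt).const_mul _).const_mul _
    refine hd.deriv.trans ?_
    change _ = kpow n n K * egf (fun l => angleDeriv (w (l + 1)) κ t) (ε * kpow n (-1) K)
    rw [egf_eq_sum (u := fun r => angleDeriv (w r) κ t) hs fun r hr => by
      rw [hw0 r hr, angleDeriv_zero_apply]]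
    rw [Finset.mul_sum]
    refine Finset.sum_congr rfl fun r hr => ?_
    have := hs r hr
    rw [show (n : ℤ) - r + 1 = n - ((r - 1 : ℕ) : ℤ) by push_cast [this]; ring, hpow, mul_pow]
    ring
  · have hd : HasDerivAt (fun k => ∑ r ∈ s, ε ^ (r - 1) / ((r - 1).factorial : ℝ) *
        (kpow n ((n : ℤ) - r + 1) k * w r κ t)) (∑ r ∈ s, ε ^ (r - 1) / ((r - 1).factorial : ℝ) *
        (((((n : ℤ) - r + 1 : ℤ) : ℝ) / ((n : ℝ) + 1) *
          kpow n (((n : ℤ) - r + 1) - (n + 1)) K) * w r κ t)) K :=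
      HasDerivAt.fun_sum fun r _ => ((hasDerivAt_kpow hK _).mul_const _).const_mul _
    refine (congrArg Neg.neg hd.deriv).trans ?_
    change _ = -(kpow n (-1) K * egf (fun l => ((n : ℝ) - l) / ((n : ℝ) + 1) * w (l + 1) κ t)
      (ε * kpow n (-1) K))
    have := egf_eq_sum (u := fun r => ((n : ℝ) - (r - 1 : ℕ)) / ((n : ℝ) + 1) * w r κ t) hs
      (fun r hr => by rw [hw0 r hr]; simp) (ε * kpow n (-1) K)
    simp only [Nat.add_sub_cancel] at this
    rw [this, Finset.mul_sum]
    congr 1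
    refine Finset.sum_congr rfl fun r hr => ?_
    have := hs r hr
    rw [show (n : ℤ) - r + 1 - (n + 1) = -1 - ((r - 1 : ℕ) : ℤ) by push_cast [this]; ring, hpow,
      mul_pow]
    push_cast [this]
    ring

/-! ### Convergence of Lie series -/

theorem hasSumUniformlyOn_of_hasSum {ι α : Type*} {f : ι → α → ℝ} {g : α → ℝ} {S : Set α}
    {u : ι → ℝ} (hu : Summable u) (hf : ∀ᶠ i in cofinite, ∀ x ∈ S, ‖f i x‖ ≤ u i)
    (hg : ∀ x ∈ S, HasSum (fun i => f i x) (g x)) : HasSumUniformlyOn f g S := by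
  have h := HasSumUniformlyOn.of_norm_le_summable_eventually hu hf
  rw [hasSumUniformlyOn_iff_tendstoUniformlyOn] at h ⊢
  exact h.congr_right fun x hx => (hg x hx).tsum_eq

theorem kpow_le_of_nonpos {a K : ℝ} (ha : 0 < a) (hK : a ≤ K) {z : ℤ} (hz : z ≤ 0) :
    kpow n z K ≤ kpow n z a := by
  refine Real.rpow_le_rpow_of_nonpos ha hK ?_
  exact div_nonpos_of_nonpos_of_nonneg (by exact_mod_cast hz) (by positivity)

theorem exists_kpow_mul_le (D : ℝ) : ∃ ρ : ℝ, 1 ≤ ρ ∧ ∀ a, ρ ≤ a → kpow n (-1) a * D ≤ 1 := by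
  have h : Tendsto (fun a : ℝ => kpow n (-1) a * D) atTop (𝓝 (0 * D)) := by
    refine Tendsto.mul_const D ?_
    have := tendsto_rpow_neg_atTop (y := 1 / ((n : ℝ) + 1)) (by positivity)
    convert! this using 2 with a
    rw [kpow]
    push_cast
    congr 1
    ring
  rw [zero_mul] at h
  obtain ⟨ρ, hρ⟩ := eventually_atTop.1 (h.eventually_le_const zero_lt_one)
  exact ⟨max 1 ρ, le_max_left _ _, fun a ha => hρ a ((le_max_right _ _).trans ha)⟩

/-- For the angle the initial row `κ` is not a power of `K` times a periodic coefficient, but the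
next row is; the triangle is then restarted there. -/
theorem lieTriangle_succ_left (W A : ℕ → PhaseFun) (i : ℕ) : ∀ j,
    lieTriangle W A (i + 1) j = lieTriangle W (lieTriangle W A 1) i j := by
  induction i with
  | zero => intro j; rfl
  | succ i ih =>
    intro j
    funext K κ t
    change lieTriangle W A (i + 1) (j + 1) K κ t + ∑ k ∈ Finset.range (j + 1),
      (j.choose k : ℝ) * bracket (lieTriangle W A (i + 1) (j - k)) (W (k + 1)) K κ t = _
    simp only [ih]
    rfl

/-- The data of a step: a finite generating function with separable coefficients, and its flow. -/
structure LieSetting (n : ℕ) (s : Finset ℕ) (w : ℕ → ℝ → ℝ → ℝ) (C R₀ a b : ℝ)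
    (X : ℝ → ℝ → ℝ → ℝ → ℝ × ℝ) : Prop where
  one_le : ∀ r ∈ s, 1 ≤ r
  zero : ∀ r, r ∉ s → w r = 0
  bound : GeneratorBound n w C R₀
  pos : 0 < a
  flow : IsLieFlow s (genTerm n w) a b X

variable {s : Finset ℕ} {C R₀ a b : ℝ} {X : ℝ → ℝ → ℝ → ℝ → ℝ × ℝ}

theorem LieSetting.hasDerivWithinAt (hX : LieSetting n s w C R₀ a b X) {ε : ℝ}
    (hε : ε ∈ Icc (0 : ℝ) 1) {K : ℝ} (hK : b ≤ K) (κ t : ℝ) :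
    HasDerivWithinAt (fun e => (X e K κ t).1) (kpow n n (X ε K κ t).1 *
      genAngle w (X ε K κ t).2 t (ε * kpow n (-1) (X ε K κ t).1)) (Icc 0 1) ε ∧
    HasDerivWithinAt (fun e => (X e K κ t).2) (-(kpow n (-1) (X ε K κ t).1 *
      genRadial n w (X ε K κ t).2 t (ε * kpow n (-1) (X ε K κ t).1))) (Icc 0 1) ε := by
  have h := hX.flow.ode ε hε K κ t hK
  have hpos : 0 < (X ε K κ t).1 := hX.pos.trans (hX.flow.domain ε hε K κ t hK)
  have := hamField_genFun (n := n) hX.one_le hX.zero hX.bound.smooth ε t hpos (X ε K κ t).2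
  rw [Prod.mk.eta] at this
  rw [this] at h
  exact ⟨h.fst, h.snd⟩

theorem LieSetting.le (hX : LieSetting n s w C R₀ a b X) {K : ℝ} (hK : b ≤ K) : a < K := by
  have := hX.flow.domain 0 (by simp) K 0 0 hK
  rwa [hX.flow.init K 0 0 hK] at this

/-- The entries of the Lie triangle along the flow. -/
noncomputable def flowEntry (n : ℕ) (σ : ℤ) (w h : ℕ → ℝ → ℝ → ℝ)
    (X : ℝ → ℝ → ℝ → ℝ → ℝ × ℝ) (K κ t : ℝ) (i : ℕ) (ε : ℝ) : ℝ :=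
  kpow n (σ - i) (X ε K κ t).1 *
    egf (fun j => coefTriangle n σ w h i j (X ε K κ t).2 t) (ε * kpow n (-1) (X ε K κ t).1)

/-- The two hypotheses of `hasSum_taylor`. The first is the expansion formula with the next row as
derivative. For the second, the generating function of row `i` is at most `2 M (2L)^i i!`, and
`K^(-1/(n+1)) ≤ 1/(8L)` beats `(2L)^i` with room to spare. -/
theorem LieSetting.flowEntry (hX : LieSetting n s w C R₀ a b X) {σ : ℤ} {M R L : ℝ}
    (hR : 2 * R₀ ≤ R) (hM : 0 ≤ M) (hh : GrowthBound 0 M R h)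
    (hL : L = R + 4 * C * (|(σ : ℝ)| + 1) + 4 * C * R) (ha : kpow n (-1) a * (8 * L) ≤ 1)
    {K : ℝ} (hK : b ≤ K) (κ t : ℝ) :
    (∀ i, ∀ ε ∈ Icc (0 : ℝ) 1, HasDerivWithinAt (flowEntry n σ w h X K κ t i)
      (flowEntry n σ w h X K κ t (i + 1) ε) (Icc 0 1) ε) ∧
    ∃ B, ∀ i, ∀ ε ∈ Icc (0 : ℝ) 1,
      |LieOscillator.flowEntry n σ w h X K κ t i ε| ≤ B * i.factorial * (1 / 2) ^ i := by
  have hR1 := hX.bound.one_le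
  have hC := hX.bound.nonneg
  have hR0 : 0 < R := by linarith
  have hLR : R ≤ L := by rw [hL]; have := abs_nonneg (σ : ℝ); nlinarith [mul_nonneg hC this]
  have hL0 : 0 < L := by linarith
  have ha0 := kpow_pos (n := n) hX.pos (-1)
  have hbd := fun i => GrowthBound.coefTriangle (s := (σ : ℝ)) hX.bound hR hM hh i
  rw [← hL] at hbd
  have hpos : ∀ ε ∈ Icc (0 : ℝ) 1, a < (X ε K κ t).1 := fun ε hε => hX.flow.domain ε hε K κ t hK
  have hlam : ∀ ε ∈ Icc (0 : ℝ) 1, kpow n (-1) (X ε K κ t).1 ≤ kpow n (-1) a := fun ε hε =>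
    kpow_le_of_nonpos hX.pos (hpos ε hε).le (by norm_num)
  have hlam0 : ∀ ε ∈ Icc (0 : ℝ) 1, 0 < kpow n (-1) (X ε K κ t).1 := fun ε hε =>
    kpow_pos (hX.pos.trans (hpos ε hε)) _
  have hμ : ∀ ε ∈ Icc (0 : ℝ) 1, |ε * kpow n (-1) (X ε K κ t).1| * R < 1 / 4 := by
    intro ε hε
    have h0 := hlam0 ε hε
    rw [abs_of_nonneg (mul_nonneg hε.1 h0.le)]
    have h1 : ε * kpow n (-1) (X ε K κ t).1 ≤ kpow n (-1) a :=
      (mul_le_of_le_one_left h0.le hε.2).trans (hlam ε hε)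
    have h2 : kpow n (-1) a * R ≤ kpow n (-1) a * L := by gcongr
    have h3 : ε * kpow n (-1) (X ε K κ t).1 * R ≤ kpow n (-1) a * R := by gcongr
    nlinarith
  have hP : ∀ i, 0 ≤ M * L ^ i := fun i => by positivity
  constructor
  · intro i ε hε
    obtain ⟨d1, d2⟩ := hX.hasDerivWithinAt hε hK κ t
    have := hasDerivWithinAt_expansion (σ := σ - i) hX.bound (hbd i) (hP i) hR0.le t
      (k := fun e => (X e K κ t).1) (x := fun e => (X e K κ t).2)
      (hX.pos.trans (hpos ε hε)) (hμ ε hε) d1 d2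
    unfold LieOscillator.flowEntry
    convert! this using 2
    · congr 1
      push_cast
      ring
    · simp only [coefTriangle]
      push_cast
      rfl
  · have hcont : ContinuousOn (fun ε => kpow n σ (X ε K κ t).1) (Icc 0 1) := by
      intro ε hε
      exact (hasDerivAt_kpow (hX.pos.trans (hpos ε hε)) σ).continuousAt.comp_continuousWithinAt
        (f := fun ε => (X ε K κ t).1)
        (hX.hasDerivWithinAt hε hK κ t).1.continuousWithinAt
    obtain ⟨B, hB⟩ := isCompact_Icc.exists_bound_of_continuousOn hcont
    refine ⟨B * (2 * M), fun i ε hε => ?_⟩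
    have h0 := hlam0 ε hε
    have hE := abs_egf_le (hP i) hR0.le (hμ ε hε).le ((hbd i).abs_le (X ε K κ t).2 t)
    have hB' := hB ε hε
    have hB0 : 0 ≤ B := (norm_nonneg _).trans hB'
    rw [LieOscillator.flowEntry, kpow_sub (hX.pos.trans (hpos ε hε)), abs_mul, abs_mul]
    rw [Real.norm_eq_abs] at hB'
    have hl : kpow n (-1) (X ε K κ t).1 * (4 * L) ≤ 1 := by
      have : kpow n (-1) (X ε K κ t).1 * (4 * L) ≤ kpow n (-1) a * (4 * L) := by
        gcongr; exact hlam ε hε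
      nlinarith
    have hpw : |kpow n (-1) (X ε K κ t).1 ^ i| * (2 * L) ^ i ≤ (1 / 2) ^ i := by
      rw [abs_of_pos (by positivity), ← mul_pow]
      gcongr
      linarith
    calc |kpow n σ (X ε K κ t).1| * |kpow n (-1) (X ε K κ t).1 ^ i| * |egf (fun j =>
          coefTriangle n σ w h i j (X ε K κ t).2 t) (ε * kpow n (-1) (X ε K κ t).1)|
        ≤ B * |kpow n (-1) (X ε K κ t).1 ^ i| * (2 * (M * L ^ i) * i.factorial * 2 ^ i) := by
          gcongr
      _ = B * (2 * M) * i.factorial * (|kpow n (-1) (X ε K κ t).1 ^ i| * (2 * L) ^ i) := by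
          rw [mul_pow]; ring
      _ ≤ _ := by gcongr

/-- For `σ ≤ i` the power of `K` is nonincreasing and can be bounded by its value at `a`. The
finitely many earlier terms may be unbounded for large `K`, which does no harm to uniform
convergence. -/
theorem abs_entry_le {σ : ℤ} {M R L K : ℝ} (hw : GeneratorBound n w C R₀)
    (hR : 2 * R₀ ≤ R) (hM : 0 ≤ M) (hh : GrowthBound 0 M R h)
    (hL : L = R + 4 * C * (|(σ : ℝ)| + 1) + 4 * C * R) (ha : 0 < a) (hK : a ≤ K) {i : ℕ}
    (hi : σ ≤ i) (κ t : ℝ) :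
    |1 / (i.factorial : ℝ) * (kpow n (σ - i) K * coefTriangle n σ w h i 0 κ t)| ≤
      kpow n σ a * M * (kpow n (-1) a * L) ^ i := by
  have hb := (GrowthBound.coefTriangle (s := (σ : ℝ)) hw hR hM hh i).abs_le κ t 0
  rw [← hL] at hb
  have hL0 : 0 ≤ L := by
    have := hw.nonneg; have := hw.one_le
    have hR0 : 0 ≤ R := by linarith
    rw [hL]; positivity
  have h1 : kpow n (σ - i) K ≤ kpow n (σ - i) a := kpow_le_of_nonpos ha hK (by omega)
  have h2 := kpow_pos (n := n) (ha.trans_le hK) (σ - i)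
  have h3 := kpow_pos (n := n) ha σ
  have hf : (0 : ℝ) < i.factorial := by positivity
  rw [abs_mul, abs_mul, abs_of_pos (show (0 : ℝ) < 1 / i.factorial by positivity), abs_of_pos h2]
  have h4 := (kpow_pos (n := n) ha (σ - i)).le
  calc 1 / (i.factorial : ℝ) * (kpow n (σ - i) K * |coefTriangle n σ w h i 0 κ t|)
      ≤ 1 / (i.factorial : ℝ) * (kpow n (σ - i) a * (M * L ^ i * (i + 0).factorial * R ^ 0)) := by
        gcongr
    _ = _ := by
        rw [kpow_sub ha, mul_pow, add_zero]
        field_simp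

theorem summable_entry_majorant {L D : ℝ} (ha : 0 < a) (hL : 0 ≤ L)
    (hs : kpow n (-1) a * (8 * L) ≤ 1) : Summable fun i : ℕ => D * (kpow n (-1) a * L) ^ i := by
  have := (kpow_pos (n := n) ha (-1)).le
  exact (summable_geometric_of_lt_one (by positivity) (by linarith)).mul_left D

theorem LieSetting.hasSum (hX : LieSetting n s w C R₀ a b X) {σ : ℤ} {M R L : ℝ}
    (hR : 2 * R₀ ≤ R) (hM : 0 ≤ M) (hh : GrowthBound 0 M R h)
    (hL : L = R + 4 * C * (|(σ : ℝ)| + 1) + 4 * C * R) (ha : kpow n (-1) a * (8 * L) ≤ 1)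
    {K : ℝ} (hK : b ≤ K) (κ t : ℝ) {ε : ℝ} (hε : ε ∈ Icc (0 : ℝ) 1) :
    HasSum (fun i : ℕ => ε ^ i / (i.factorial : ℝ) *
        (kpow n (σ - i) K * coefTriangle n σ w h i 0 κ t))
      (LieOscillator.flowEntry n σ w h X K κ t 0 ε) := by
  obtain ⟨h1, B, h2⟩ := hX.flowEntry hR hM hh hL ha hK κ t
  have := hasSum_taylor (by norm_num) (by norm_num) h1 (fun i _ => h2 i) hε
  convert! this using 3 with i
  -- At `ε = 0` also `μ = 0`, so of the whole row only the entry `j = 0` survives: the diagonal of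
  -- the triangle.
  rw [LieOscillator.flowEntry, hX.flow.init K κ t hK, zero_mul, egf_zero]

/-- The sum of the original series along the flow. -/
theorem LieSetting.hasSum_epsTerm (hX : LieSetting n s w C R₀ a b X) {σ : ℤ} {M R L : ℝ}
    (hR : 2 * R₀ ≤ R) (hM : 0 ≤ M) (hh : GrowthBound 0 M R h)
    (hL : L = R + 4 * C * (|(σ : ℝ)| + 1) + 4 * C * R) (ha : kpow n (-1) a * (8 * L) ≤ 1)
    {A : ℕ → PhaseFun} (hA : ∀ j K κ t, 0 < K → A j K κ t = kpow n (σ - j) K * h j κ t)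
    {K : ℝ} (hK : b ≤ K) (κ t : ℝ) {ε : ℝ} (hε : ε ∈ Icc (0 : ℝ) 1) :
    HasSum (fun i => epsTerm A ε i (X ε K κ t).1 (X ε K κ t).2 t)
      (LieOscillator.flowEntry n σ w h X K κ t 0 ε) := by
  have hR1 := hX.bound.one_le
  have hC := hX.bound.nonneg
  have hR0 : 0 < R := by linarith
  have hLR : R ≤ L := by rw [hL]; have := abs_nonneg (σ : ℝ); nlinarith [mul_nonneg hC this]
  have hpos := hX.flow.domain ε hε K κ t hK
  have hp0 := hX.pos.trans hpos
  have h0 := kpow_pos (n := n) hp0 (-1)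
  have hμ : |ε * kpow n (-1) (X ε K κ t).1| * R ≤ 1 / 4 := by
    rw [abs_of_nonneg (mul_nonneg hε.1 h0.le)]
    have h1 : ε * kpow n (-1) (X ε K κ t).1 ≤ kpow n (-1) a :=
      (mul_le_of_le_one_left h0.le hε.2).trans (kpow_le_of_nonpos hX.pos hpos.le (by norm_num))
    have h2 : ε * kpow n (-1) (X ε K κ t).1 * R ≤ kpow n (-1) a * L := by
      have := kpow_pos (n := n) hX.pos (-1)
      gcongr
    linarith
  have hs := (summable_egf hM hR0.le hμ (hh.abs_le (X ε K κ t).2 t)).of_norm.hasSum.mul_left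
    (kpow n σ (X ε K κ t).1)
  convert! hs using 1
  · funext i
    simp only [epsTerm]
    rw [hA i _ _ _ hp0, kpow_sub hp0, mul_pow]
    ring
  · simp [LieOscillator.flowEntry, egf, coefTriangle]

theorem LieSetting.lieConverges (hX : LieSetting n s w C R₀ a b X) {σ : ℤ} {M R L : ℝ}
    (hR : 2 * R₀ ≤ R) (hM : 0 ≤ M) (hh : GrowthBound 0 M R h)
    (hL : L = R + 4 * C * (|(σ : ℝ)| + 1) + 4 * C * R) (ha : kpow n (-1) a * (8 * L) ≤ 1)
    {A : ℕ → PhaseFun} (hA : ∀ j K κ t, 0 < K → A j K κ t = kpow n (σ - j) K * h j κ t) :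
    LieConverges (genTerm n w) X b A := by
  have hR1 := hX.bound.one_le
  have hC := hX.bound.nonneg
  have hR0 : 0 < R := by linarith
  have hL0 : 0 ≤ L := by rw [hL]; positivity
  have htri := lieTriangle_eq (n := n) (w := w) (W := genTerm n w) (fun r K κ t _ => rfl) hA
  refine ⟨fun ε hε K κ t hK =>
    (hX.hasSum_epsTerm hR hM hh hL ha hA hK κ t hε).summable, ?_⟩
  refine hasSumUniformlyOn_of_hasSum
    (summable_entry_majorant (D := kpow n σ a * M) hX.pos hL0 ha) ?_ ?_
  · rw [Nat.cofinite_eq_atTop]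
    filter_upwards [eventually_ge_atTop σ.toNat] with i hi q hq
    have hi' : σ ≤ i := Int.toNat_le.1 hi
    have hK := (hX.le hq.2)
    simp only [epsTerm]
    rw [htri i 0 _ _ _ (hX.pos.trans hK), Nat.cast_zero, sub_zero]
    refine le_trans ?_ (abs_entry_le hX.bound hR hM hh hL hX.pos hK.le hi' q.2.2.1 q.2.2.2)
    rw [Real.norm_eq_abs, abs_mul, abs_mul (1 / (i.factorial : ℝ))]
    rw [abs_of_nonneg (div_nonneg (pow_nonneg hq.1.1 _) (by positivity)),
      abs_of_nonneg (show (0 : ℝ) ≤ 1 / i.factorial by positivity)]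
    gcongr
    exact pow_le_one₀ hq.1.1 hq.1.2
  · rintro ⟨ε, K, κ, t⟩ ⟨hε, hK⟩
    simp only at hε hK ⊢
    rw [(hX.hasSum_epsTerm hR hM hh hL ha hA hK κ t hε).tsum_eq]
    convert! hX.hasSum hR hM hh hL ha hK κ t hε using 2 with i
    simp only [epsTerm]
    rw [htri i 0 _ _ _ (hX.pos.trans (hX.le hK)), Nat.cast_zero, sub_zero]

/-- Convergence of the Lie series of the angle. -/
theorem LieSetting.lieConverges_angle (hX : LieSetting n s w C R₀ a b X) {M R L : ℝ}
    (hR : 2 * R₀ ≤ R) (hM : 0 ≤ M)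
    (hh : GrowthBound 0 M R fun l κ t => -(((n : ℝ) - l) / ((n : ℝ) + 1) * w (l + 1) κ t))
    (hL : L = R + 4 * C * (|(((-1 : ℤ) : ℤ) : ℝ)| + 1) + 4 * C * R)
    (ha : kpow n (-1) a * (8 * L) ≤ 1) :
    LieConverges (genTerm n w) X b (constSeries fun _ κ _ => κ) := by
  have hR1 := hX.bound.one_le
  have hC := hX.bound.nonneg
  have hR0 : 0 < R := by linarith
  have hL0 : 0 ≤ L := by rw [hL]; positivity
  set h : ℕ → ℝ → ℝ → ℝ := fun l κ t => -(((n : ℝ) - l) / ((n : ℝ) + 1) * w (l + 1) κ t) with hh'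
  set A : ℕ → PhaseFun := constSeries fun _ κ _ => κ with hAdef
  have hA0 : A 0 = fun _ κ _ => κ := rfl
  have hA1 : ∀ j, A (j + 1) = 0 := fun j => rfl
  -- `{κ, W} = -∂W/∂K` has degree `-1`; only the summand with the nonzero entry `A 0 = κ`
  -- contributes.
  have hA : ∀ j K κ t, 0 < K → lieTriangle (genTerm n w) A 1 j K κ t =
      kpow n (-1 - j) K * h j κ t := by
    intro j K κ t hK
    change A (j + 1) K κ t + ∑ k ∈ Finset.range (j + 1),
      (j.choose k : ℝ) * bracket (A (j - k)) (genTerm n w (k + 1)) K κ t = _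
    rw [Finset.sum_range_succ, Finset.sum_eq_zero fun k hk => ?_]
    · rw [hA1, Nat.sub_self, hA0, bracket]
      have hd : HasDerivAt (fun k => genTerm n w (j + 1) k κ t) _ K :=
        (hasDerivAt_kpow (n := n) hK _).mul_const _
      rw [hd.deriv]
      simp only [Pi.zero_apply, deriv_const, deriv_id'', hh']
      rw [show (n : ℤ) - ((j + 1 : ℕ) : ℤ) + 1 - (n + 1) = -1 - j by push_cast; ring]
      push_cast
      simp
      ring
    · have hk' := Finset.mem_range.1 hk
      obtain ⟨l, hl⟩ : ∃ l, j - k = l + 1 := ⟨j - k - 1, by omega⟩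
      rw [hl, hA1]
      simp [bracket]
  have htri := lieTriangle_eq (n := n) (w := w) (W := genTerm n w) (fun r K κ t _ => rfl) hA
  have htri' : ∀ i K κ t, 0 < K → lieTriangle (genTerm n w) A (i + 1) 0 K κ t =
      kpow n (-1 - i) K * coefTriangle n (-1 : ℤ) w h i 0 κ t := by
    intro i K κ t hK
    rw [lieTriangle_succ_left, htri i 0 K κ t hK]
    simp
  have heps : ∀ ε K κ t, HasSum (fun i => epsTerm A ε i K κ t) κ := by
    intro ε K κ t
    have h1 := hasSum_single (f := fun i => epsTerm A ε i K κ t) 0 fun i hi => by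
      obtain ⟨l, rfl⟩ := Nat.exists_eq_succ_of_ne_zero hi
      simp [epsTerm, hA1]
    simpa [epsTerm, hA0] using h1
  refine ⟨fun ε _ K κ t _ => (heps ε _ _ t).summable, ?_⟩
  refine hasSumUniformlyOn_of_hasSum (u := fun i => kpow n (-1) a * M * (kpow n (-1) a * L) ^ (i - 1))
    ?_ ?_ ?_
  · rw [← summable_nat_add_iff 1]
    simpa using summable_entry_majorant (D := kpow n (-1) a * M) hX.pos hL0 ha
  · rw [Nat.cofinite_eq_atTop]
    filter_upwards [eventually_ge_atTop 1] with i hi q hq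
    obtain ⟨l, rfl⟩ := Nat.exists_eq_succ_of_ne_zero (show i ≠ 0 by omega)
    have hK := (hX.le hq.2)
    simp only [epsTerm, Nat.succ_eq_add_one, Nat.add_sub_cancel]
    rw [htri' l _ _ _ (hX.pos.trans hK)]
    refine le_trans ?_ (abs_entry_le (i := l) hX.bound hR hM hh hL hX.pos hK.le (by omega)
      q.2.2.1 q.2.2.2)
    rw [Real.norm_eq_abs, abs_mul, abs_mul (1 / (l.factorial : ℝ))]
    rw [abs_of_nonneg (div_nonneg (pow_nonneg hq.1.1 _) (by positivity)),
      abs_of_nonneg (show (0 : ℝ) ≤ 1 / l.factorial by positivity)]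
    have : l.factorial ≤ (l + 1).factorial := Nat.factorial_le (by omega)
    gcongr
    exact pow_le_one₀ hq.1.1 hq.1.2
  · rintro ⟨ε, K, κ, t⟩ ⟨hε, hK⟩
    simp only at hε hK ⊢
    rw [(heps ε _ _ t).tsum_eq]
    obtain ⟨h1, B, h2⟩ := hX.flowEntry hR hM hh hL ha hK κ t
    have hB0 : 0 ≤ B := by
      have := (abs_nonneg _).trans (h2 0 0 (by simp))
      simpa using this
    -- The chain of flow entries of degree `-1`, preceded by the angle itself. The index shift costs
    -- one power of `q = 1/2`, hence the bound `2 * B`.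
    let g : ℕ → ℝ → ℝ := fun i => Nat.casesOn i (fun e => (X e K κ t).2)
      fun i => LieOscillator.flowEntry n (-1) w h X K κ t i
    have key := hasSum_taylor (g := g) (B := 2 * B) (q := 1 / 2) (by norm_num) (by norm_num)
      ?_ ?_ hε
    · convert! key using 2 with i
      rcases i with _ | i
      · simp [epsTerm, lieTriangle, hA0, g, hX.flow.init K κ t hK]
      · simp only [epsTerm]
        rw [htri' i _ _ _ (hX.pos.trans (hX.le hK))]
        simp only [g, LieOscillator.flowEntry, hX.flow.init K κ t hK, zero_mul, egf_zero]
    · rintro (_ | i) e he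
      · refine (hX.hasDerivWithinAt he hK κ t).2.congr_deriv ?_
        simp only [g, LieOscillator.flowEntry, coefTriangle, genRadial, egf, hh', mul_neg]
        rw [tsum_neg]
        simp
      · exact h1 i e he
    · rintro (_ | i) hi e he
      · omega
      · refine (h2 i e he).trans ?_
        have : i.factorial ≤ (i + 1).factorial := Nat.factorial_le (by omega)
        rw [pow_succ]
        calc B * i.factorial * (1 / 2) ^ i ≤ B * (i + 1).factorial * (1 / 2) ^ i := by gcongr
          _ = _ := by ring

end

/-! ### Ordinary differential equations on the unit interval -/

section

variable {E : Type*} [NormedAddCommGroup E] [NormedSpace ℝ E]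

theorem HasDerivWithinAt.Ici_of_Icc {γ : ℝ → E} {γ' : E} {a b s : ℝ} (hs : s ∈ Ico a b)
    (h : HasDerivWithinAt γ γ' (Icc a b) s) : HasDerivWithinAt γ γ' (Ici s) s :=
  h.mono_of_mem_nhdsWithin (Icc_mem_nhdsGE_of_mem hs)

/-- `γ` solves `γ' = f(s, γ)` on `[0, 1]`. -/
def IsUnitSolution (f : ℝ → E → E) (γ : ℝ → E) : Prop :=
  ∀ s ∈ Icc (0 : ℝ) 1, HasDerivWithinAt γ (f s (γ s)) (Icc 0 1) s

/-- A bounded and uniformly Lipschitz time-dependent vector field on `[0, 1]`. -/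
structure IsTameField (f : ℝ → E → E) (C k : ℝ≥0) : Prop where
  lipschitz : ∀ s, LipschitzWith k (f s)
  continuous : ∀ x, Continuous fun s => f s x
  bound : ∀ s x, ‖f s x‖ ≤ C

theorem IsUnitSolution.continuousOn {f : ℝ → E → E} {γ : ℝ → E} (h : IsUnitSolution f γ) :
    ContinuousOn γ (Icc 0 1) := fun s hs => (h s hs).continuousWithinAt

theorem IsTameField.exists_solution [CompleteSpace E] {f : ℝ → E → E} {C k : ℝ≥0}
    (hf : IsTameField f C k) {s₀ : ℝ} (hs₀ : s₀ ∈ Icc (0 : ℝ) 1) (x₀ : E) :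
    ∃ γ, γ s₀ = x₀ ∧ IsUnitSolution f γ := by
  have hpl : IsPicardLindelof f (⟨s₀, hs₀⟩ : Icc (0 : ℝ) 1) x₀ C 0 C k :=
    { lipschitzOnWith := fun s _ => (hf.lipschitz s).lipschitzOnWith
      continuousOn := fun x _ => (hf.continuous x).continuousOn
      norm_le := fun s _ x _ => hf.bound s x
      mul_max_le := by
        have h1 : max (1 - s₀) (s₀ - 0) ≤ 1 := max_le (by linarith [hs₀.1]) (by linarith [hs₀.2])
        simpa using mul_le_of_le_one_right C.2 h1 }
  obtain ⟨γ, h1, h2⟩ := hpl.exists_eq_forall_mem_Icc_hasDerivWithinAt₀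
  exact ⟨γ, h1, h2⟩

theorem IsTameField.norm_sub_le {f : ℝ → E → E} {C k : ℝ≥0} (hf : IsTameField f C k)
    {γ : ℝ → E} (h : IsUnitSolution f γ) {s s' : ℝ} (hs : s ∈ Icc (0 : ℝ) 1)
    (hs' : s' ∈ Icc (0 : ℝ) 1) : ‖γ s' - γ s‖ ≤ C := by
  refine ((convex_Icc (0 : ℝ) 1).norm_image_sub_le_of_norm_hasDerivWithin_le h
    (fun x _ => hf.bound x _) hs hs').trans ?_
  refine mul_le_of_le_one_right C.2 ?_
  rw [Real.norm_eq_abs, abs_le]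
  constructor <;> linarith [hs.1, hs.2, hs'.1, hs'.2]

theorem IsTameField.dist_le {f : ℝ → E → E} {C k : ℝ≥0} (hf : IsTameField f C k)
    {γ δ : ℝ → E} (h : IsUnitSolution f γ) (h' : IsUnitSolution f δ) {s : ℝ}
    (hs : s ∈ Icc (0 : ℝ) 1) : dist (γ s) (δ s) ≤ dist (γ 0) (δ 0) * Real.exp k := by
  refine (dist_le_of_trajectories_ODE hf.lipschitz h.continuousOn
    (fun t ht => HasDerivWithinAt.Ici_of_Icc ht (h t (Ico_subset_Icc_self ht))) h'.continuousOn
    (fun t ht => HasDerivWithinAt.Ici_of_Icc ht (h' t (Ico_subset_Icc_self ht))) le_rfl s hs).trans ?_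
  gcongr
  exact mul_le_of_le_one_right k.2 (by linarith [hs.2])

theorem IsTameField.eq_of_eq_zero {f : ℝ → E → E} {C k : ℝ≥0} (hf : IsTameField f C k)
    {γ δ : ℝ → E} (h : IsUnitSolution f γ) (h' : IsUnitSolution f δ) (h0 : γ 0 = δ 0) {s : ℝ}
    (hs : s ∈ Icc (0 : ℝ) 1) : γ s = δ s := by
  have := hf.dist_le h h' hs
  rw [h0, dist_self, zero_mul] at this
  exact dist_le_zero.1 this

theorem IsTameField.eq_of_eq_one {f : ℝ → E → E} {C k : ℝ≥0} (hf : IsTameField f C k)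
    {γ δ : ℝ → E} (h : IsUnitSolution f γ) (h' : IsUnitSolution f δ) (h1 : γ 1 = δ 1) :
    γ 0 = δ 0 := by
  have hd : ∀ {γ : ℝ → E}, IsUnitSolution f γ → ∀ t ∈ Ioc (0 : ℝ) 1,
      HasDerivWithinAt γ (f t (γ t)) (Iic t) t := fun h t ht =>
    (h t (Ioc_subset_Icc_self ht)).mono_of_mem_nhdsWithin (Icc_mem_nhdsLE_of_mem ht)
  exact ODE_solution_unique_of_mem_Icc_left (v := f) (s := fun _ => univ) (K := k)
    (fun t _ => (hf.lipschitz t).lipschitzOnWith) h.continuousOn (hd h) (fun _ _ => mem_univ _)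
    h'.continuousOn (hd h') (fun _ _ => mem_univ _) h1 (left_mem_Icc.2 zero_le_one)

/-! ### Linear equations -/

/-- The radial retraction onto the ball of radius `B`. -/
noncomputable def radialClip (B : ℝ) (x : E) : E := (B / max B ‖x‖) • x

theorem norm_radialClip_le {B : ℝ} (hB : 0 < B) (x : E) : ‖radialClip B x‖ ≤ B := by
  have hm : 0 < max B ‖x‖ := lt_max_of_lt_left hB
  rw [radialClip, norm_smul, Real.norm_eq_abs, abs_of_pos (by positivity), div_mul_eq_mul_div,
    div_le_iff₀ hm]
  gcongr
  exact le_max_right _ _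

theorem norm_radialClip_le_norm {B : ℝ} (hB : 0 < B) (x : E) : ‖radialClip B x‖ ≤ ‖x‖ := by
  have hm : 0 < max B ‖x‖ := lt_max_of_lt_left hB
  rw [radialClip, norm_smul, Real.norm_eq_abs, abs_of_pos (by positivity)]
  refine mul_le_of_le_one_left (norm_nonneg _) ?_
  rw [div_le_one hm]
  exact le_max_left _ _

theorem radialClip_of_le {B : ℝ} (hB : 0 < B) {x : E} (hx : ‖x‖ ≤ B) : radialClip B x = x := by
  rw [radialClip, max_eq_left hx, div_self hB.ne', one_smul]

theorem lipschitzWith_radialClip {B : ℝ} (hB : 0 < B) :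
    LipschitzWith 2 (radialClip B : E → E) := by
  have key : ∀ x y : E, ‖radialClip B x - radialClip B y‖ ≤ 2 * ‖x - y‖ := by
    intro x y
    have hx : 0 < max B ‖x‖ := lt_max_of_lt_left hB
    have hy : 0 < max B ‖y‖ := lt_max_of_lt_left hB
    have e : radialClip B x - radialClip B y =
        (B / max B ‖x‖) • (x - y) + (B / max B ‖x‖ - B / max B ‖y‖) • y := by
      rw [radialClip, radialClip, smul_sub, sub_smul]
      abel
    rw [e]
    refine (norm_add_le _ _).trans ?_
    rw [norm_smul, norm_smul, Real.norm_eq_abs, Real.norm_eq_abs, abs_of_pos (by positivity)]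
    have h1 : B / max B ‖x‖ * ‖x - y‖ ≤ ‖x - y‖ :=
      mul_le_of_le_one_left (norm_nonneg _) (by rw [div_le_one hx]; exact le_max_left _ _)
    have h2 : |max B ‖y‖ - max B ‖x‖| ≤ ‖x - y‖ := by
      refine (abs_max_sub_max_le_max _ _ _ _).trans ?_
      rw [sub_self, abs_zero]
      refine max_le (norm_nonneg _) ?_
      rw [abs_sub_comm]
      exact abs_norm_sub_norm_le x y
    have h3 : |B / max B ‖x‖ - B / max B ‖y‖| * ‖y‖ ≤ ‖x - y‖ := by
      have e2 : B / max B ‖x‖ - B / max B ‖y‖ =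
          (B / max B ‖x‖) * ((max B ‖y‖ - max B ‖x‖) / max B ‖y‖) := by
        field_simp
      rw [e2, abs_mul, abs_of_pos (show 0 < B / max B ‖x‖ by positivity), abs_div, abs_of_pos hy]
      have h4 : B / max B ‖x‖ ≤ 1 := by rw [div_le_one hx]; exact le_max_left _ _
      have h5 : ‖y‖ / max B ‖y‖ ≤ 1 := by rw [div_le_one hy]; exact le_max_right _ _
      calc B / max B ‖x‖ * (|max B ‖y‖ - max B ‖x‖| / max B ‖y‖) * ‖y‖
          = B / max B ‖x‖ * |max B ‖y‖ - max B ‖x‖| * (‖y‖ / max B ‖y‖) := by ring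
        _ ≤ 1 * ‖x - y‖ * 1 := by gcongr
        _ = _ := by ring
    linarith
  refine LipschitzWith.of_dist_le_mul fun x y => ?_
  rw [dist_eq_norm, dist_eq_norm]
  simpa using key x y

theorem norm_le_of_deriv_le {γ γ' : ℝ → E} {M δ η : ℝ} (hM : 1 ≤ M) (hη : 0 ≤ η)
    (h : ∀ s ∈ Icc (0 : ℝ) 1, HasDerivWithinAt γ (γ' s) (Icc 0 1) s) (h0 : ‖γ 0‖ ≤ δ)
    (hb : ∀ s ∈ Icc (0 : ℝ) 1, ‖γ' s‖ ≤ M * ‖γ s‖ + η) {s : ℝ} (hs : s ∈ Icc (0 : ℝ) 1) :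
    ‖γ s‖ ≤ (δ + η) * Real.exp M := by
  have h1 := norm_le_gronwallBound_of_norm_deriv_right_le (fun s hs => (h s hs).continuousWithinAt)
    (fun s hs => HasDerivWithinAt.Ici_of_Icc hs (h s (Ico_subset_Icc_self hs))) h0
    (fun s hs => hb s (Ico_subset_Icc_self hs)) s hs
  refine h1.trans ?_
  have hδ : 0 ≤ δ := (norm_nonneg _).trans h0
  rw [gronwallBound_of_K_ne_0 (by positivity), sub_zero]
  have h2 : Real.exp (M * s) ≤ Real.exp M := by
    gcongr
    exact mul_le_of_le_one_right (by linarith) hs.2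
  have h3 : η / M ≤ η := div_le_self hη hM
  have h4 : 0 ≤ η / M := by positivity
  have h5 : 0 ≤ Real.exp (M * s) - 1 := by
    have := Real.one_le_exp (show 0 ≤ M * s from mul_nonneg (by linarith) hs.1)
    linarith
  calc δ * Real.exp (M * s) + η / M * (Real.exp (M * s) - 1)
      ≤ δ * Real.exp M + η * Real.exp M := by
        gcongr; linarith
    _ = _ := by ring

/-- Clipping makes the field bounded, so the Picard–Lindelöf theorem covers the whole interval. By
Gronwall the solution stays within the radius `B`, where the clipping is inactive. -/
theorem exists_linear_solution [CompleteSpace E] {A : ℝ → E →L[ℝ] E}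
    (hA : ContinuousOn A (Icc 0 1)) (x₀ : E) :
    ∃ γ : ℝ → E, γ 0 = x₀ ∧ IsUnitSolution (fun s x => A s x) γ := by
  obtain ⟨M₀, hM₀⟩ := isCompact_Icc.exists_bound_of_continuousOn hA
  set M : ℝ := max 1 M₀
  have hM1 : 1 ≤ M := le_max_left _ _
  set B : ℝ := (‖x₀‖ + 1) * Real.exp M
  have hB : 0 < B := by positivity
  let A' : ℝ → E →L[ℝ] E := fun s => A (projIcc 0 1 zero_le_one s)
  have hA'c : Continuous A' := (continuousOn_iff_continuous_domRestrict.1 hA).comp continuous_projIcc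
  have hA'b : ∀ s, ‖A' s‖ ≤ M := fun s => (hM₀ _ (projIcc 0 1 zero_le_one s).2).trans
    (le_max_right _ _)
  have hA' : ∀ s ∈ Icc (0 : ℝ) 1, A' s = A s := fun s hs => by
    simp only [A', projIcc_of_mem zero_le_one hs]
  have hM0 : 0 ≤ M := by linarith
  have hT : IsTameField (fun s x => A' s (radialClip B x)) (M.toNNReal * B.toNNReal)
      (M.toNNReal * 2) := by
    refine ⟨fun s => ?_, fun x => ?_, fun s x => ?_⟩
    · refine LipschitzWith.comp ?_ (lipschitzWith_radialClip hB)
      refine (A' s).lipschitz.weaken ?_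
      rw [← NNReal.coe_le_coe, Real.coe_toNNReal _ hM0]
      exact hA'b s
    · exact hA'c.clm_apply continuous_const
    · rw [NNReal.coe_mul, Real.coe_toNNReal _ hM0, Real.coe_toNNReal _ hB.le]
      exact (A' s).le_of_opNorm_le_of_le (hA'b s) (norm_radialClip_le hB x)
  obtain ⟨γ, h0, h1⟩ := hT.exists_solution (left_mem_Icc.2 zero_le_one) x₀
  have hle : ∀ s ∈ Icc (0 : ℝ) 1, ‖γ s‖ ≤ B := by
    intro s hs
    refine (norm_le_of_deriv_le (δ := ‖x₀‖) hM1 le_rfl h1 (by rw [h0]) (fun s hs => ?_) hs).trans ?_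
    · rw [add_zero]
      exact (A' s).le_of_opNorm_le_of_le (hA'b s) (norm_radialClip_le_norm hB _)
    · simp only [B]; gcongr; exact zero_le_one
  refine ⟨γ, h0, fun s hs => ?_⟩
  have := h1 s hs
  simp only at this ⊢
  rwa [radialClip_of_le hB (hle s hs), hA' s hs] at this

/-! ### Differentiable dependence on the initial value -/

/-- A vector field that is `C^1` in the space variable, with a flow that is locally Lipschitz in
the initial value. -/
structure IsSmoothFlow (v : ℝ → E → E) (A : ℝ → E → E →L[ℝ] E) (U Z : Set E) (φ : ℝ → E → E) :
    Prop where
  open_target : IsOpen U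
  open_source : IsOpen Z
  deriv : ∀ s ∈ Icc (0 : ℝ) 1, ∀ x ∈ U, HasFDerivAt (v s) (A s x) x
  continuousOn : ContinuousOn (fun q : ℝ × E => A q.1 q.2) (Icc 0 1 ×ˢ U)
  init : ∀ z ∈ Z, φ 0 z = z
  maps : ∀ s ∈ Icc (0 : ℝ) 1, ∀ z ∈ Z, φ s z ∈ U
  ode : ∀ z ∈ Z, IsUnitSolution v fun s => φ s z
  lipschitz : ∀ z ∈ Z, ∃ L, ∀ᶠ z' in 𝓝 z, ∀ s ∈ Icc (0 : ℝ) 1, ‖φ s z' - φ s z‖ ≤ L * ‖z' - z‖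

namespace IsSmoothFlow

variable {v : ℝ → E → E} {A : ℝ → E → E →L[ℝ] E} {U Z : Set E} {φ : ℝ → E → E}

theorem continuousOn_comp (h : IsSmoothFlow v A U Z φ) {z : E} (hz : z ∈ Z) :
    ContinuousOn (fun s => A s (φ s z)) (Icc 0 1) :=
  h.continuousOn.comp (continuousOn_id.prodMk (h.ode z hz).continuousOn)
    fun s hs => ⟨hs, h.maps s hs z hz⟩

/-- Continuity of `A` made uniform along the compact trajectory over `[0,1]`. -/
theorem exists_uniform (h : IsSmoothFlow v A U Z φ) {z : E} (hz : z ∈ Z) {η : ℝ} (hη : 0 < η) :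
    ∃ δ > 0, ∀ s ∈ Icc (0 : ℝ) 1, ∀ y, ‖y - φ s z‖ < δ →
      y ∈ U ∧ ‖A s y - A s (φ s z)‖ ≤ η := by
  have key : ∃ δ > 0, ∀ s ∈ Icc (0 : ℝ) 1, s ∈ Icc (0 : ℝ) 1 → ∀ y, ‖y - φ s z‖ < δ →
      y ∈ U ∧ ‖A s y - A s (φ s z)‖ ≤ η := by
    refine isCompact_Icc.induction_on (p := fun S => ∃ δ > 0, ∀ s ∈ S, s ∈ Icc (0 : ℝ) 1 →
      ∀ y, ‖y - φ s z‖ < δ → y ∈ U ∧ ‖A s y - A s (φ s z)‖ ≤ η) ⟨1, one_pos, by simp⟩ ?_ ?_ ?_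
    · rintro S S' hS ⟨δ, hδ, h1⟩
      exact ⟨δ, hδ, fun s hs => h1 s (hS hs)⟩
    · rintro S S' ⟨δ, hδ, h1⟩ ⟨δ', hδ', h2⟩
      refine ⟨min δ δ', lt_min hδ hδ', fun s hs hsI y hy => ?_⟩
      rcases hs with hs | hs
      · exact h1 s hs hsI y (hy.trans_le (min_le_left _ _))
      · exact h2 s hs hsI y (hy.trans_le (min_le_right _ _))
    · intro s₀ hs₀
      have hx₀ := h.maps s₀ hs₀ z hz
      have hA := h.continuousOn (s₀, φ s₀ z) ⟨hs₀, hx₀⟩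
      rw [Metric.continuousWithinAt_iff] at hA
      obtain ⟨δ₁, hδ₁, hA1⟩ := hA (η / 2) (by linarith)
      obtain ⟨δ₂, hδ₂, hU⟩ := Metric.isOpen_iff.1 h.open_target _ hx₀
      set δ := min δ₁ δ₂ with hδd
      have hδ : 0 < δ := lt_min hδ₁ hδ₂
      have hc := Metric.continuousWithinAt_iff.1 ((h.ode z hz).continuousOn s₀ hs₀) (δ / 2)
        (by linarith)
      obtain ⟨δ₃, hδ₃, hc1⟩ := hc
      refine ⟨Icc 0 1 ∩ Metric.ball s₀ (min δ₃ δ), inter_mem_nhdsWithin _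
        (Metric.ball_mem_nhds _ (lt_min hδ₃ hδ)), δ / 2, by linarith, ?_⟩
      rintro s ⟨-, hs⟩ hsI y hy
      rw [Metric.mem_ball] at hs
      have h1 : dist (φ s z) (φ s₀ z) < δ / 2 := hc1 hsI (hs.trans_le (min_le_left _ _))
      have h2 : dist y (φ s₀ z) < δ := by
        have := dist_triangle y (φ s z) (φ s₀ z)
        rw [dist_eq_norm y (φ s z)] at this
        linarith
      have hyU : ∀ y, dist y (φ s₀ z) < δ → y ∈ U := fun y hy => hU (hy.trans_le (min_le_right _ _))
      have hyA : ∀ y, dist y (φ s₀ z) < δ → dist (A s y) (A s₀ (φ s₀ z)) < η / 2 := fun y hy =>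
        hA1 (x := (s, y)) ⟨hsI, hyU y hy⟩ (max_lt (hs.trans_le ((min_le_right _ _).trans
          (min_le_left _ _))) (hy.trans_le (min_le_left _ _)))
      refine ⟨hyU y h2, ?_⟩
      have h3 := hyA y h2
      have h4 := hyA (φ s z) (by linarith)
      rw [← dist_eq_norm]
      have := dist_triangle_right (A s y) (A s (φ s z)) (A s₀ (φ s₀ z))
      linarith
  obtain ⟨δ, hδ, h1⟩ := key
  exact ⟨δ, hδ, fun s hs => h1 s hs hs⟩

theorem exists_bound (h : IsSmoothFlow v A U Z φ) {z : E} (hz : z ∈ Z) :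
    ∃ M, 1 ≤ M ∧ ∀ s ∈ Icc (0 : ℝ) 1, ‖A s (φ s z)‖ ≤ M := by
  obtain ⟨M, hM⟩ := isCompact_Icc.exists_bound_of_continuousOn (h.continuousOn_comp hz)
  exact ⟨max 1 M, le_max_left _ _, fun s hs => (hM s hs).trans (le_max_right _ _)⟩

theorem eventually_close (h : IsSmoothFlow v A U Z φ) {z : E} (hz : z ∈ Z) {δ : ℝ} (hδ : 0 < δ) :
    ∀ᶠ z' in 𝓝 z, z' ∈ Z ∧ ∀ s ∈ Icc (0 : ℝ) 1, ‖φ s z' - φ s z‖ < δ := by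
  obtain ⟨L, hL⟩ := h.lipschitz z hz
  have ht : Tendsto (fun z' => L * ‖z' - z‖) (𝓝 z) (𝓝 0) := by
    have : Continuous fun z' => L * ‖z' - z‖ := by fun_prop
    simpa using this.tendsto z
  filter_upwards [hL, h.open_source.mem_nhds hz, ht.eventually_lt_const hδ] with z' h1 h2 h3
  exact ⟨h2, fun s hs => (h1 s hs).trans_lt h3⟩

/-- The linearization error `φ_s z' - φ_s z - J_s (z'-z)` vanishes at `s = 0` and satisfies a linear
differential inequality with source `η L ‖z'-z‖`, where `η` measures the oscillation of `A` near the
trajectory. Gronwall makes it `o(‖z'-z‖)`. -/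
theorem hasFDerivAt (h : IsSmoothFlow v A U Z φ) {z : E} (hz : z ∈ Z) {J : ℝ → E →L[ℝ] E}
    (hJ0 : J 0 = ContinuousLinearMap.id ℝ E)
    (hJ : ∀ s ∈ Icc (0 : ℝ) 1, HasDerivWithinAt J ((A s (φ s z)).comp (J s)) (Icc 0 1) s)
    {s : ℝ} (hs : s ∈ Icc (0 : ℝ) 1) : HasFDerivAt (φ s) (J s) z := by
  obtain ⟨M, hM1, hM⟩ := h.exists_bound hz
  obtain ⟨L₀, hL₀⟩ := h.lipschitz z hz
  rw [hasFDerivAt_iff_isLittleO, Asymptotics.isLittleO_iff]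
  intro c hc
  set L := max L₀ 0 + 1
  have hL : 0 < L := by positivity
  set η := c / (L * Real.exp M)
  have hη : 0 < η := by positivity
  obtain ⟨δ, hδ, hu⟩ := h.exists_uniform hz hη
  filter_upwards [hL₀, h.eventually_close hz hδ] with z' h1 h2
  obtain ⟨hz', h2⟩ := h2
  have hd : ∀ s ∈ Icc (0 : ℝ) 1, HasDerivWithinAt (fun s => φ s z' - φ s z - J s (z' - z))
      (v s (φ s z') - v s (φ s z) - (A s (φ s z)) (J s (z' - z))) (Icc 0 1) s := by
    intro s hs
    refine ((h.ode z' hz' s hs).sub (h.ode z hz s hs)).sub ?_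
    simpa using (hJ s hs).clm_apply (hasDerivWithinAt_const s (Icc 0 1) (z' - z))
  have hb : ∀ s ∈ Icc (0 : ℝ) 1, ‖v s (φ s z') - v s (φ s z) - (A s (φ s z)) (J s (z' - z))‖ ≤
      M * ‖φ s z' - φ s z - J s (z' - z)‖ + η * (L * ‖z' - z‖) := by
    intro s hs
    have hball : ∀ y ∈ Metric.ball (φ s z) δ, y ∈ U ∧ ‖A s y - A s (φ s z)‖ ≤ η := fun y hy =>
      hu s hs y (by simpa [dist_eq_norm] using hy)
    have h3 := (convex_ball (φ s z) δ).norm_image_sub_le_of_norm_hasFDerivWithin_le'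
      (fun y hy => (h.deriv s hs y (hball y hy).1).hasFDerivWithinAt) (fun y hy => (hball y hy).2)
      (Metric.mem_ball_self hδ) (show φ s z' ∈ Metric.ball (φ s z) δ by
        simpa [dist_eq_norm] using h2 s hs)
    have e : v s (φ s z') - v s (φ s z) - (A s (φ s z)) (J s (z' - z)) =
        A s (φ s z) (φ s z' - φ s z - J s (z' - z)) +
          (v s (φ s z') - v s (φ s z) - A s (φ s z) (φ s z' - φ s z)) := by
      rw [map_sub (A s (φ s z)) (φ s z' - φ s z)]
      abel
    rw [e]
    refine (norm_add_le _ _).trans (add_le_add ((A s (φ s z)).le_of_opNorm_le (hM s hs) _) ?_)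
    refine h3.trans ?_
    gcongr
    refine (h1 s hs).trans ?_
    gcongr
    simp only [L]
    linarith [le_max_left L₀ 0]
  have key := norm_le_of_deriv_le (δ := 0) hM1 (by positivity) hd
    (by simp [h.init z hz, h.init z' hz', hJ0]) hb hs
  refine key.trans (le_of_eq ?_)
  simp only [η]
  field_simp
  ring

/-- The flow is continuously differentiable in the initial value, and the derivative solves the
variational equation. -/
theorem exists_derivative [CompleteSpace E] (h : IsSmoothFlow v A U Z φ) :
    ∃ J : ℝ → E → E →L[ℝ] E, (∀ z ∈ Z, J 0 z = ContinuousLinearMap.id ℝ E) ∧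
      (∀ z ∈ Z, ∀ s ∈ Icc (0 : ℝ) 1, HasFDerivAt (φ s) (J s z) z) ∧
      (∀ z ∈ Z, ∀ s ∈ Icc (0 : ℝ) 1,
        HasDerivWithinAt (fun s => J s z) ((A s (φ s z)).comp (J s z)) (Icc 0 1) s) ∧
      ∀ s ∈ Icc (0 : ℝ) 1, ContinuousOn (J s) Z := by
  have hex : ∀ z ∈ Z, ∃ J : ℝ → E →L[ℝ] E, J 0 = ContinuousLinearMap.id ℝ E ∧
      ∀ s ∈ Icc (0 : ℝ) 1, HasDerivWithinAt J ((A s (φ s z)).comp (J s)) (Icc 0 1) s := by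
    intro z hz
    have hc : ContinuousOn (fun s => ContinuousLinearMap.compL ℝ E E E (A s (φ s z))) (Icc 0 1) :=
      (ContinuousLinearMap.compL ℝ E E E).continuous.comp_continuousOn (h.continuousOn_comp hz)
    exact exists_linear_solution hc (ContinuousLinearMap.id ℝ E)
  choose! J hJ0 hJ using hex
  refine ⟨fun s z => J z s, hJ0, fun z hz s hs => h.hasFDerivAt hz (hJ0 z hz) (hJ z hz) hs, hJ,
    fun s hs z hz => ContinuousAt.continuousWithinAt ?_⟩
  obtain ⟨M, hM1, hM⟩ := h.exists_bound hz
  have hJb : ∀ s ∈ Icc (0 : ℝ) 1, ‖J z s‖ ≤ (1 + 0) * Real.exp M := fun s hs => by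
    refine norm_le_of_deriv_le hM1 le_rfl (hJ z hz) ?_ (fun s hs => ?_) hs
    · rw [hJ0 z hz]; exact ContinuousLinearMap.norm_id_le
    · rw [add_zero]
      exact (ContinuousLinearMap.opNorm_comp_le _ _).trans (by gcongr; exact hM s hs)
  rw [Metric.continuousAt_iff']
  intro c hc
  -- The difference of two solutions of the variational equation has growth rate `M + 1` and source
  -- at most `η e^M`, since `‖J‖ ≤ e^M`. Gronwall then bounds it by `η D`.
  set D := Real.exp M * Real.exp (M + 1) with hD
  have hD0 : 0 < D := by positivity
  set η := min 1 (c / (2 * D))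
  have hη : 0 < η := lt_min one_pos (by positivity)
  obtain ⟨δ, hδ, hu⟩ := h.exists_uniform hz hη
  filter_upwards [h.eventually_close hz hδ] with z' hz'
  obtain ⟨hz', hclose⟩ := hz'
  have hA : ∀ s ∈ Icc (0 : ℝ) 1, ‖A s (φ s z') - A s (φ s z)‖ ≤ η := fun s hs =>
    (hu s hs _ (hclose s hs)).2
  have key := norm_le_of_deriv_le (M := M + 1) (δ := 0) (η := η * Real.exp M) (by linarith)
    (by positivity) (fun s hs => (hJ z' hz' s hs).sub (hJ z hz s hs))
    (by simp [hJ0 z hz, hJ0 z' hz']) (fun s hs => ?_) hs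
  · rw [dist_eq_norm]
    refine key.trans_lt ?_
    have h1 : η ≤ c / (2 * D) := min_le_right _ _
    calc (0 + η * Real.exp M) * Real.exp (M + 1) = η * D := by rw [hD]; ring
      _ ≤ c / (2 * D) * D := by gcongr
      _ = c / 2 := by field_simp
      _ < c := by linarith
  · have e : (A s (φ s z')).comp (J z' s) - (A s (φ s z)).comp (J z s) =
        (A s (φ s z')).comp (J z' s - J z s) + (A s (φ s z') - A s (φ s z)).comp (J z s) := by
      ext x
      simp
    rw [e]
    have hA' : ‖A s (φ s z')‖ ≤ M + 1 := by
      have h1 := norm_le_norm_add_norm_sub' (A s (φ s z')) (A s (φ s z))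
      have h2 : η ≤ 1 := min_le_left _ _
      linarith [hM s hs, hA s hs]
    refine (norm_add_le _ _).trans (add_le_add ((ContinuousLinearMap.opNorm_comp_le _ _).trans ?_)
      ((ContinuousLinearMap.opNorm_comp_le _ _).trans ?_))
    · gcongr; rfl
    · have := hJb s hs
      rw [add_zero, one_mul] at this
      gcongr
      exact hA s hs

end IsSmoothFlow

end

/-! ### Bounded Lipschitz functions -/

section

variable {E : Type*} [NormedAddCommGroup E]

/-- A time-dependent function that is bounded and uniformly Lipschitz. -/
structure IsTameFun (g : ℝ → E → ℝ) : Prop where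
  bound : ∃ C, 0 ≤ C ∧ ∀ s x, |g s x| ≤ C
  lipschitz : ∃ L, 0 ≤ L ∧ ∀ s x y, |g s x - g s y| ≤ L * ‖x - y‖
  continuous : ∀ x, Continuous fun s => g s x

namespace IsTameFun

theorem time {c : ℝ → ℝ} (hc : Continuous c) {C : ℝ} (hC : ∀ s, |c s| ≤ C) :
    IsTameFun fun s (_ : E) => c s :=
  ⟨⟨C, (abs_nonneg _).trans (hC 0), fun s _ => hC s⟩, ⟨0, le_rfl, by simp⟩, fun _ => hc⟩

theorem const (c : ℝ) : IsTameFun fun _ (_ : E) => c := time continuous_const fun _ => le_rfl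

theorem space {g : E → ℝ} {C L : ℝ} (hC : ∀ x, |g x| ≤ C) (hL0 : 0 ≤ L)
    (hL : ∀ x y, |g x - g y| ≤ L * ‖x - y‖) : IsTameFun fun (_ : ℝ) x => g x :=
  ⟨⟨C, (abs_nonneg _).trans (hC 0), fun _ x => hC x⟩, ⟨L, hL0, fun _ x y => hL x y⟩,
    fun _ => continuous_const⟩

variable {g h : ℝ → E → ℝ}

theorem add (hg : IsTameFun g) (hh : IsTameFun h) : IsTameFun fun s x => g s x + h s x := by
  obtain ⟨⟨C, hC, hgC⟩, ⟨L, hL, hgL⟩, hgc⟩ := hg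
  obtain ⟨⟨C', hC', hhC⟩, ⟨L', hL', hhL⟩, hhc⟩ := hh
  refine ⟨⟨C + C', by positivity, fun s x => (abs_add_le _ _).trans (add_le_add (hgC s x) (hhC s x))⟩,
    ⟨L + L', by positivity, fun s x y => ?_⟩, fun x => (hgc x).add (hhc x)⟩
  rw [add_sub_add_comm, add_mul]
  exact (abs_add_le _ _).trans (add_le_add (hgL s x y) (hhL s x y))

theorem mul (hg : IsTameFun g) (hh : IsTameFun h) : IsTameFun fun s x => g s x * h s x := by
  obtain ⟨⟨C, hC, hgC⟩, ⟨L, hL, hgL⟩, hgc⟩ := hg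
  obtain ⟨⟨C', hC', hhC⟩, ⟨L', hL', hhL⟩, hhc⟩ := hh
  refine ⟨⟨C * C', by positivity, fun s x => ?_⟩,
    ⟨C * L' + L * C', by positivity, fun s x y => ?_⟩, fun x => (hgc x).mul (hhc x)⟩
  · rw [abs_mul]
    exact mul_le_mul (hgC s x) (hhC s x) (abs_nonneg _) hC
  · have e : g s x * h s x - g s y * h s y =
        g s x * (h s x - h s y) + (g s x - g s y) * h s y := by ring
    rw [e]
    refine (abs_add_le _ _).trans ?_
    rw [abs_mul, abs_mul]
    calc |g s x| * |h s x - h s y| + |g s x - g s y| * |h s y|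
        ≤ C * (L' * ‖x - y‖) + L * ‖x - y‖ * C' := by
          gcongr
          exacts [hgC s x, hhL s x y, hgL s x y, hhC s y]
      _ = _ := by ring

theorem pow (hg : IsTameFun g) (m : ℕ) : IsTameFun fun s x => g s x ^ m := by
  induction m with
  | zero => simpa using const (E := E) 1
  | succ m ih => simpa only [pow_succ] using ih.mul hg

theorem sum {ι : Type*} {S : Finset ι} {g : ι → ℝ → E → ℝ} (hg : ∀ i ∈ S, IsTameFun (g i)) :
    IsTameFun fun s x => ∑ i ∈ S, g i s x := by
  classical
  induction S using Finset.induction_on with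
  | empty => simpa using const (E := E) 0
  | insert i S hi ih =>
    simp only [Finset.sum_insert hi]
    exact (hg i (by simp)).add (ih fun j hj => hg j (by simp [hj]))

end IsTameFun

end

theorem IsTameFun.isTameField {g h : ℝ → ℝ × ℝ × ℝ → ℝ} (hg : IsTameFun g) (hh : IsTameFun h) :
    ∃ C k, IsTameField (fun s x => (g s x, h s x, (0 : ℝ))) C k := by
  obtain ⟨⟨C, hC, hgC⟩, ⟨L, hL, hgL⟩, hgc⟩ := hg
  obtain ⟨⟨C', hC', hhC⟩, ⟨L', hL', hhL⟩, hhc⟩ := hh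
  refine ⟨⟨max C C', le_max_of_le_left hC⟩, ⟨max L L', le_max_of_le_left hL⟩, fun s => ?_, fun x => ?_,
    fun s x => ?_⟩
  · refine LipschitzWith.of_dist_le_mul fun x y => ?_
    rw [dist_eq_norm, dist_eq_norm]
    refine max_le ?_ (max_le ?_ ?_)
    · refine (hgL s x y).trans ?_
      gcongr; exact le_max_left _ _
    · refine (hhL s x y).trans ?_
      gcongr; exact le_max_right _ _
    · simp only [Prod.snd_sub, sub_self, norm_zero]
      exact mul_nonneg (NNReal.coe_nonneg _) (norm_nonneg _)
  · exact (hgc x).prodMk ((hhc x).prodMk continuous_const)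
  · refine max_le ((hgC s x).trans (le_max_left _ _)) (max_le ((hhC s x).trans (le_max_right _ _)) ?_)
    rw [norm_zero]
    exact NNReal.coe_nonneg _

/-- Bounds uniform over all `t` come from periodicity; a Lipschitz bound in the direction of `t` is
where `C^1` in time is used. -/
theorem Sep.exists_lipschitz {ϖ T : ℝ} (hT : 0 < T) {F : ℝ → ℝ → ℝ} (hF : F ∈ Sep ϖ T 1) :
    IsTameFun fun (_ : ℝ) (x : ℝ × ℝ × ℝ) => F x.2.1 x.2.2 := by
  obtain ⟨C, R, hC, -, hb⟩ := Sep.bound hT hF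
  obtain ⟨C₁, R₁, hC₁, -, hb₁⟩ := Sep.bound hT (Sep.angleDeriv_mem hF)
  obtain ⟨C₂, R₂, hC₂, -, hb₂⟩ := Sep.bound hT (Sep.timeDeriv_mem (e := 0) hF)
  refine IsTameFun.space (C := C) (L := C₁ + C₂) (fun x => by simpa using hb 0 x.2.1 x.2.2)
    (by positivity) fun x y => ?_
  have h1 : |F x.2.1 x.2.2 - F y.2.1 x.2.2| ≤ C₁ * |x.2.1 - y.2.1| :=
    convex_univ.norm_image_sub_le_of_norm_hasDerivWithin_le (f := fun κ => F κ x.2.2)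
      (fun κ _ => (Sep.hasDerivAt_angle hF κ x.2.2).hasDerivWithinAt)
      (fun κ _ => by simpa using hb₁ 0 κ x.2.2) (mem_univ _) (mem_univ _)
  have h2 : |F y.2.1 x.2.2 - F y.2.1 y.2.2| ≤ C₂ * |x.2.2 - y.2.2| :=
    convex_univ.norm_image_sub_le_of_norm_hasDerivWithin_le (f := fun t => F y.2.1 t)
      (fun t _ => (Sep.hasDerivAt_time (e := 0) hF y.2.1 t).hasDerivWithinAt)
      (fun t _ => by simpa using hb₂ 0 y.2.1 t) (mem_univ _) (mem_univ _)
  have h3 : |x.2.1 - y.2.1| ≤ ‖x - y‖ := (norm_fst_le (x - y).2).trans (norm_snd_le (x - y))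
  have h4 : |x.2.2 - y.2.2| ≤ ‖x - y‖ := (norm_snd_le (x - y).2).trans (norm_snd_le (x - y))
  have := abs_sub_le (F x.2.1 x.2.2) (F y.2.1 x.2.2) (F y.2.1 y.2.2)
  nlinarith [mul_le_mul_of_nonneg_left h3 hC₁, mul_le_mul_of_nonneg_left h4 hC₂]

/-- The inverse of `u`, cut off below `u = 1`. -/
noncomputable def clampInv (u : ℝ) : ℝ := (max u 1)⁻¹

theorem isTameFun_clampInv : IsTameFun fun (_ : ℝ) (x : ℝ × ℝ × ℝ) => clampInv x.1 := by
  have h1 : ∀ u : ℝ, 1 ≤ max u 1 := fun u => le_max_right _ _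
  refine IsTameFun.space (C := 1) (L := 1) (fun x => ?_) zero_le_one fun x y => ?_
  · have := h1 x.1
    rw [clampInv, abs_of_pos (by positivity)]
    exact inv_le_one_of_one_le₀ this
  · have hx := h1 x.1
    have hy := h1 y.1
    have h2 : |max y.1 1 - max x.1 1| ≤ ‖x - y‖ := by
      refine (abs_max_sub_max_le_abs _ _ _).trans ?_
      rw [abs_sub_comm]
      exact norm_fst_le (x - y)
    rw [clampInv, clampInv, inv_sub_inv (by positivity) (by positivity), abs_div,
      abs_of_pos (show 0 < max x.1 1 * max y.1 1 by positivity), one_mul]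
    exact (div_le_self (abs_nonneg _) (one_le_mul_of_one_le_of_one_le hx hy)).trans h2

/-! ### The flow of the generating function in the coordinate `u = K ^ (1 / (n + 1))` -/

/-- The coefficient `ε ^ (r - 1) / (r - 1)!`, with `ε` cut off to `[0, 1]`. -/
noncomputable def clampCoef (r : ℕ) (ε : ℝ) : ℝ :=
  (projIcc (0 : ℝ) 1 zero_le_one ε : ℝ) ^ (r - 1) / ((r - 1).factorial : ℝ)

theorem isTameFun_clampCoef (r : ℕ) : IsTameFun fun s (_ : ℝ × ℝ × ℝ) => clampCoef r s := by
  refine IsTameFun.time (C := 1) ?_ fun s => ?_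
  · unfold clampCoef
    have := continuous_subtype_val.comp (continuous_projIcc (a := (0 : ℝ)) (b := 1)
      (h := zero_le_one))
    exact (this.pow _).div_const _
  · have h := (projIcc (0 : ℝ) 1 zero_le_one s).2
    have h1 : (1 : ℝ) ≤ ((r - 1).factorial : ℝ) := by exact_mod_cast Nat.factorial_pos _
    rw [clampCoef, abs_of_nonneg (div_nonneg (pow_nonneg h.1 _) (by positivity))]
    exact div_le_one_of_le₀ ((pow_le_one₀ h.1 h.2).trans h1) (by positivity)

/-- The field of the generating function in the coordinates `(u, κ, t)`, cut off below `u = 1`. -/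
noncomputable def rootField (n : ℕ) (s : Finset ℕ) (w : ℕ → ℝ → ℝ → ℝ) (ε : ℝ)
    (x : ℝ × ℝ × ℝ) : ℝ × ℝ × ℝ :=
  (∑ r ∈ s, 1 / ((n : ℝ) + 1) * (clampCoef r ε * (clampInv x.1 ^ (r - 1) *
      angleDeriv (w r) x.2.1 x.2.2)),
    ∑ r ∈ s, -(((n : ℝ) - (r - 1 : ℕ)) / ((n : ℝ) + 1)) * (clampCoef r ε * (clampInv x.1 ^ r *
      w r x.2.1 x.2.2)), 0)

/-- In `u = K^(1/(n+1))` the factor `K^(n/(n+1)) = u^n` of `dK/dε` cancels against `du/dK =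
u^(-n)/(n+1)`. Only nonpositive powers of `u` remain, so the cut-off field is globally bounded and
Lipschitz. -/
theorem exists_isTameField_rootField {n : ℕ} {s : Finset ℕ} {w : ℕ → ℝ → ℝ → ℝ} {ϖ T : ℝ}
    (hT : 0 < T) (hw : ∀ r, w r ∈ Sep ϖ T 1) :
    ∃ C k, IsTameField (rootField n s w) C k := by
  refine IsTameFun.isTameField (IsTameFun.sum fun r _ => ?_) (IsTameFun.sum fun r _ => ?_)
  · exact (IsTameFun.const _).mul ((isTameFun_clampCoef r).mul ((isTameFun_clampInv.pow _).mul
      (Sep.exists_lipschitz hT (Sep.angleDeriv_mem (hw r)))))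
  · exact (IsTameFun.const _).mul ((isTameFun_clampCoef r).mul ((isTameFun_clampInv.pow _).mul
      (Sep.exists_lipschitz hT (hw r))))

section

variable {n : ℕ} {s : Finset ℕ} {w : ℕ → ℝ → ℝ → ℝ} {ϖ T : ℝ}

theorem kpow_pow {u : ℝ} (hu : 0 < u) (j : ℤ) : kpow n j (u ^ (n + 1)) = u ^ j := by
  rw [kpow, ← Real.rpow_natCast, ← Real.rpow_mul hu.le, ← Real.rpow_intCast]
  congr 1
  push_cast
  field_simp

theorem kpow_one_pow {K : ℝ} (hK : 0 < K) : kpow n 1 K ^ (n + 1) = K := by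
  rw [kpow, ← Real.rpow_natCast, ← Real.rpow_mul hK.le]
  push_cast
  rw [div_mul_cancel₀ _ (by positivity), Real.rpow_one]

theorem kpow_one_le {K K' : ℝ} (hK : 0 < K) (h : K ≤ K') : kpow n 1 K ≤ kpow n 1 K' :=
  Real.rpow_le_rpow hK.le h (by push_cast; positivity)

/-- The transformation given by a flow in the coordinates `(u, κ, t)`. -/
noncomputable def rootFlow (n : ℕ) (Y : ℝ × ℝ × ℝ → ℝ → ℝ × ℝ × ℝ) (ε K κ t : ℝ) : ℝ × ℝ :=
  ((Y (kpow n 1 K, κ, t) ε).1 ^ (n + 1), (Y (kpow n 1 K, κ, t) ε).2.1)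

/-- `Y x` is the solution of the field starting at `x`. -/
structure IsRootFlow (n : ℕ) (s : Finset ℕ) (w : ℕ → ℝ → ℝ → ℝ) (C k : ℝ≥0)
    (Y : ℝ × ℝ × ℝ → ℝ → ℝ × ℝ × ℝ) : Prop where
  tame : IsTameField (rootField n s w) C k
  init : ∀ x, Y x 0 = x
  solution : ∀ x, IsUnitSolution (rootField n s w) (Y x)

theorem exists_isRootFlow (hT : 0 < T) (hw : ∀ r, w r ∈ Sep ϖ T 1) :
    ∃ C k Y, IsRootFlow n s w C k Y := by
  obtain ⟨C, k, h⟩ := exists_isTameField_rootField (n := n) (s := s) hT hw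
  choose Y h0 h1 using fun x => h.exists_solution (left_mem_Icc.2 zero_le_one) x
  exact ⟨C, k, Y, h, h0, h1⟩

namespace IsRootFlow

variable {C k : ℝ≥0} {Y : ℝ × ℝ × ℝ → ℝ → ℝ × ℝ × ℝ}

theorem norm_sub_le (hY : IsRootFlow n s w C k Y) (x : ℝ × ℝ × ℝ) {ε : ℝ}
    (hε : ε ∈ Icc (0 : ℝ) 1) : ‖Y x ε - x‖ ≤ C := by
  simpa only [hY.init] using
    hY.tame.norm_sub_le (hY.solution x) (left_mem_Icc.2 zero_le_one) hε

theorem sub_le_fst (hY : IsRootFlow n s w C k Y) (x : ℝ × ℝ × ℝ) {ε : ℝ}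
    (hε : ε ∈ Icc (0 : ℝ) 1) : x.1 - C ≤ (Y x ε).1 := by
  have h := (norm_fst_le (Y x ε - x)).trans (hY.norm_sub_le x hε)
  rw [Real.norm_eq_abs, abs_le] at h
  have := h.1
  simp only [Prod.fst_sub] at this
  linarith

theorem time_eq (hY : IsRootFlow n s w C k Y) (x : ℝ × ℝ × ℝ) {ε : ℝ}
    (hε : ε ∈ Icc (0 : ℝ) 1) : (Y x ε).2.2 = x.2.2 := by
  have h := (convex_Icc (0 : ℝ) 1).norm_image_sub_le_of_norm_hasDerivWithin_le (C := 0)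
    (f := fun ε => (Y x ε).2.2) (f' := fun _ => 0)
    (fun e he => (hY.solution x e he).snd.snd) (by simp) (left_mem_Icc.2 zero_le_one) hε
  rw [zero_mul, norm_le_zero_iff, sub_eq_zero, hY.init] at h
  exact h

theorem translate (hY : IsRootFlow n s w C k Y) {d : ℝ × ℝ × ℝ}
    (hd : ∀ ε x, rootField n s w ε (x + d) = rootField n s w ε x) (x : ℝ × ℝ × ℝ) {ε : ℝ}
    (hε : ε ∈ Icc (0 : ℝ) 1) : Y (x + d) ε = Y x ε + d := by
  refine hY.tame.eq_of_eq_zero (δ := fun ε => Y x ε + d) (hY.solution _) (fun e he => ?_) ?_ hε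
  · rw [hd]
    exact (hY.solution x e he).add_const d
  · simp only [hY.init]

theorem rootFlow_angle (hY : IsRootFlow n s w C k Y) (hw : ∀ r, w r ∈ Sep ϖ T 1) {ε : ℝ}
    (hε : ε ∈ Icc (0 : ℝ) 1) (K κ t : ℝ) :
    rootFlow n Y ε K (κ + ϖ) t = rootFlow n Y ε K κ t + (0, ϖ) := by
  have := hY.translate (d := (0, ϖ, 0)) (fun ε x => by
    simp [rootField, Sep.periodic_angle (hw _), Sep.periodic_angle (Sep.angleDeriv_mem (hw _))])
    (kpow n 1 K, κ, t) hε
  simp only [Prod.mk_add_mk, add_zero] at this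
  simp [rootFlow, this]

theorem rootFlow_time (hY : IsRootFlow n s w C k Y) (hw : ∀ r, w r ∈ Sep ϖ T 1) {ε : ℝ}
    (hε : ε ∈ Icc (0 : ℝ) 1) (K κ t : ℝ) :
    rootFlow n Y ε K κ (t + T) = rootFlow n Y ε K κ t := by
  have := hY.translate (d := (0, 0, T)) (fun ε x => by
    simp [rootField, Sep.periodic_time (hw _), Sep.periodic_time (Sep.angleDeriv_mem (hw _))])
    (kpow n 1 K, κ, t) hε
  simp only [Prod.mk_add_mk, add_zero] at this
  simp [rootFlow, this]

/-- The transformation is the Lie flow where the cut-off is inactive. -/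
theorem isLieFlow (hY : IsRootFlow n s w C k Y) (hs : ∀ r ∈ s, 1 ≤ r)
    (hw0 : ∀ r, r ∉ s → w r = 0) (hw : ∀ r, w r ∈ Sep ϖ T 1) {a b : ℝ} (ha : 1 ≤ a)
    (hab : kpow n 1 a + C < kpow n 1 b) (hb : 0 < b) :
    IsLieFlow s (genTerm n w) a b (rootFlow n Y) := by
  have ha0 : 0 < a := by linarith
  have ha1 : 1 ≤ kpow n 1 a := Real.one_le_rpow ha (by push_cast; positivity)
  -- The field is bounded by `C`, so in unit time `u` drops by at most `C` and never enters the
  -- region of the cut-off.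
  have hu : ∀ ε ∈ Icc (0 : ℝ) 1, ∀ K κ t, b ≤ K → kpow n 1 a < (Y (kpow n 1 K, κ, t) ε).1 := by
    intro ε hε K κ t hK
    have := hY.sub_le_fst (kpow n 1 K, κ, t) hε
    have := kpow_one_le (n := n) hb hK
    simp only at *
    linarith
  refine ⟨fun K κ t hK => ?_, fun ε hε K κ t hK => ?_, fun ε hε K κ t hK => ?_⟩
  · simp [rootFlow, hY.init, kpow_one_pow (hb.trans_le hK)]
  · rw [rootFlow]
    calc a = kpow n 1 a ^ (n + 1) := (kpow_one_pow ha0).symm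
      _ < _ := by
        exact pow_lt_pow_left₀ (hu ε hε K κ t hK) (by linarith) n.succ_ne_zero
  · set y := Y (kpow n 1 K, κ, t) ε with hy
    have h1 : 1 < y.1 := ha1.trans_lt (hu ε hε K κ t hK)
    have h0 : 0 < y.1 := by linarith
    have ht : y.2.2 = t := hY.time_eq _ hε
    have hsol := hY.solution (kpow n 1 K, κ, t) ε hε
    have hd0 : HasDerivWithinAt (fun e => (Y (kpow n 1 K, κ, t) e).1) _ (Icc 0 1) ε := hsol.fst
    have hd1 := hd0.pow (n + 1)
    have hd2 := hsol.snd.fst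
    have hd := hd1.prodMk hd2
    refine HasDerivWithinAt.congr_deriv hd ?_
    rw [← hy]
    have e : rootFlow n Y ε K κ t = (y.1 ^ (n + 1), y.2.1) := rfl
    rw [e, hamField_genFun hs hw0 (fun r t => Sep.contDiff_angle (hw r) t) ε t (by positivity)]
    rw [kpow_pow h0, kpow_pow h0, genAngle, genRadial,
      egf_eq_sum (u := fun r => angleDeriv (w r) y.2.1 t) hs fun r hr => by
        rw [hw0 r hr, angleDeriv_zero_apply]]
    have h2 := egf_eq_sum (u := fun r => ((n : ℝ) - (r - 1 : ℕ)) / ((n : ℝ) + 1) * w r y.2.1 t) hs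
      (fun r hr => by rw [hw0 r hr]; simp) (ε * y.1 ^ (-1 : ℤ))
    simp only [Nat.add_sub_cancel] at h2
    rw [h2]
    have hinv : clampInv y.1 = y.1⁻¹ := by rw [clampInv, max_eq_left h1.le]
    have hcoef : ∀ r, clampCoef r ε = ε ^ (r - 1) / ((r - 1).factorial : ℝ) := fun r => by
      rw [clampCoef, projIcc_of_mem zero_le_one hε]
    simp only [rootField, ht, hinv, hcoef]
    refine Prod.ext ?_ ?_
    · simp only
      rw [Finset.mul_sum, Finset.mul_sum]
      refine Finset.sum_congr rfl fun r hr => ?_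
      simp only [Nat.add_sub_cancel, zpow_neg, zpow_one, zpow_natCast, mul_pow]
      push_cast
      field_simp
    · simp only
      rw [Finset.mul_sum, ← Finset.sum_neg_distrib]
      refine Finset.sum_congr rfl fun r hr => ?_
      obtain ⟨l, rfl⟩ : ∃ l, r = l + 1 := ⟨r - 1, by have := hs r hr; omega⟩
      simp only [Nat.add_sub_cancel, zpow_neg, zpow_one, mul_pow, pow_succ]
      ring

theorem injective (hY : IsRootFlow n s w C k Y) {b : ℝ} (hb : 0 < b) (hCb : C < kpow n 1 b)
    {K κ K' κ' t : ℝ} (hK : b ≤ K) (hK' : b ≤ K')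
    (h : rootFlow n Y 1 K κ t = rootFlow n Y 1 K' κ' t) : K = K' ∧ κ = κ' := by
  have h01 : (1 : ℝ) ∈ Icc (0 : ℝ) 1 := right_mem_Icc.2 zero_le_one
  have hpos : ∀ {K κ}, b ≤ K → 0 ≤ (Y (kpow n 1 K, κ, t) 1).1 := by
    intro K κ hK
    have := hY.sub_le_fst (kpow n 1 K, κ, t) h01
    have := kpow_one_le (n := n) hb hK
    simp only at *
    linarith
  have h1 := (pow_left_inj₀ (hpos hK) (hpos hK') n.succ_ne_zero).1 (congrArg Prod.fst h)
  have h2 : (Y (kpow n 1 K, κ, t) 1).2.1 = (Y (kpow n 1 K', κ', t) 1).2.1 := congrArg Prod.snd h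
  have h3 : Y (kpow n 1 K, κ, t) 1 = Y (kpow n 1 K', κ', t) 1 :=
    Prod.ext h1 (Prod.ext h2 (by rw [hY.time_eq _ h01, hY.time_eq _ h01]))
  have h4 := hY.tame.eq_of_eq_one (hY.solution _) (hY.solution _) h3
  rw [hY.init, hY.init] at h4
  simp only [Prod.mk.injEq] at h4
  refine ⟨?_, h4.2.1⟩
  rw [← kpow_one_pow (n := n) (hb.trans_le hK), h4.1, kpow_one_pow (hb.trans_le hK')]

/-- The preimage is found by solving backwards from `ε = 1`, which again moves `u` by at most `C`;
hence the threshold `(d^(1/(n+1)) + C)^(n+1)`, independent of `t`. -/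
theorem surjective (hY : IsRootFlow n s w C k Y) (c : ℝ) : ∃ c' : ℝ, ∀ t,
    {z : ℝ × ℝ | c' < z.1} ⊆ (fun z : ℝ × ℝ => rootFlow n Y 1 z.1 z.2 t) '' {z | c < z.1} := by
  have h01 : (1 : ℝ) ∈ Icc (0 : ℝ) 1 := right_mem_Icc.2 zero_le_one
  set d := max c 1
  have hd : 0 < d := lt_max_of_lt_right one_pos
  have hC : (0 : ℝ) ≤ C := C.2
  have hp := kpow_pos (n := n) hd 1
  refine ⟨(kpow n 1 d + C) ^ (n + 1), fun t z hz => ?_⟩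
  have hz0 : 0 < z.1 := lt_trans (by positivity) (show (kpow n 1 d + C) ^ (n + 1) < z.1 from hz)
  have hz1 : kpow n 1 d + C < kpow n 1 z.1 := by
    refine lt_of_pow_lt_pow_left₀ (n + 1) (kpow_pos hz0 1).le ?_
    rw [kpow_one_pow hz0]
    exact hz
  obtain ⟨γ, hγ1, hγ⟩ := hY.tame.exists_solution h01 (kpow n 1 z.1, z.2, t)
  have hγY : ∀ ε ∈ Icc (0 : ℝ) 1, Y (γ 0) ε = γ ε := fun ε hε =>
    hY.tame.eq_of_eq_zero (hY.solution _) hγ (hY.init _) hε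
  have hγ0 : (γ 0).2.2 = t := by
    rw [← hY.time_eq (γ 0) h01, hγY 1 h01, hγ1]
  have hge : kpow n 1 d < (γ 0).1 := by
    have h := (norm_fst_le (γ 0 - γ 1)).trans
      (hY.tame.norm_sub_le hγ h01 (left_mem_Icc.2 zero_le_one))
    rw [Real.norm_eq_abs, abs_le, hγ1] at h
    have := h.1
    simp only [Prod.fst_sub] at this
    linarith
  have hg0 : 0 < (γ 0).1 := hp.trans hge
  have hroot : kpow n 1 ((γ 0).1 ^ (n + 1)) = (γ 0).1 := by rw [kpow_pow hg0, zpow_one]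
  refine ⟨((γ 0).1 ^ (n + 1), (γ 0).2.1), ?_, ?_⟩
  · refine (le_max_left c 1).trans_lt ?_
    calc d = kpow n 1 d ^ (n + 1) := (kpow_one_pow hd).symm
      _ < _ := pow_lt_pow_left₀ hge hp.le n.succ_ne_zero
  · have e : ((γ 0).1, (γ 0).2.1, t) = γ 0 := Prod.ext rfl (Prod.ext rfl hγ0.symm)
    simp only [rootFlow, hroot, e, hγY 1 h01, hγ1]
    rw [kpow_one_pow hz0]

/-- Local Lipschitz dependence on the initial values. -/
theorem lipschitz (hY : IsRootFlow n s w C k Y) {K₀ : ℝ} (hK₀ : 0 < K₀) (κ₀ t₀ : ℝ) :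
    ∃ L, ∀ᶠ z : ℝ × ℝ × ℝ in 𝓝 (K₀, κ₀, t₀), ∀ ε ∈ Icc (0 : ℝ) 1,
      ‖(rootFlow n Y ε z.1 z.2.1 z.2.2 : ℝ × ℝ) - rootFlow n Y ε K₀ κ₀ t₀‖ ≤
        L * ‖z - (K₀, κ₀, t₀)‖ := by
  obtain ⟨D, hD⟩ := (hasDerivAt_kpow (n := n) hK₀ 1).isBigO_sub.bound
  set D' := max D 1
  set B := kpow n 1 K₀ + 1 + C with hB
  have hC : (0 : ℝ) ≤ C := C.2
  have hk0 := kpow_pos (n := n) hK₀ 1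
  have hB1 : 1 ≤ B := by linarith
  set L₁ := D' * Real.exp k
  have hD'1 : 1 ≤ D' := le_max_right _ _
  have hL₁ : 0 < L₁ := by positivity
  refine ⟨max (L₁ * (n + 1 : ℕ) * B ^ n) L₁, ?_⟩
  have hcont : Tendsto (fun z : ℝ × ℝ × ℝ => z.1) (𝓝 (K₀, κ₀, t₀)) (𝓝 K₀) :=
    continuous_fst.tendsto _
  have h1 := hcont.eventually hD
  have h2 := hcont.eventually ((hasDerivAt_kpow (n := n) hK₀ 1).continuousAt.eventually_lt_const
    (show kpow n 1 K₀ < kpow n 1 K₀ + 1 by linarith))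
  have h3 := hcont.eventually ((hasDerivAt_kpow (n := n) hK₀ 1).continuousAt.eventually_const_lt
    (show 0 < kpow n 1 K₀ by linarith))
  filter_upwards [h1, h2, h3] with z h1 h2 h3 ε hε
  set x := (kpow n 1 z.1, z.2.1, z.2.2)
  set x₀ := (kpow n 1 K₀, κ₀, t₀)
  have hxx : dist x x₀ ≤ D' * ‖z - (K₀, κ₀, t₀)‖ := by
    rw [dist_eq_norm]
    have h4 : ‖z - (K₀, κ₀, t₀)‖ ≤ D' * ‖z - (K₀, κ₀, t₀)‖ :=
      le_mul_of_one_le_left (norm_nonneg _) hD'1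
    refine max_le ?_ ((norm_snd_le (z - (K₀, κ₀, t₀))).trans h4)
    refine h1.trans ?_
    gcongr
    · exact le_max_left _ _
    · exact norm_fst_le (z - (K₀, κ₀, t₀))
  have hY1 : ‖Y x ε - Y x₀ ε‖ ≤ L₁ * ‖z - (K₀, κ₀, t₀)‖ := by
    have := hY.tame.dist_le (hY.solution x) (hY.solution x₀) hε
    rw [hY.init, hY.init, dist_eq_norm] at this
    refine this.trans ?_
    calc dist x x₀ * Real.exp k ≤ D' * ‖z - (K₀, κ₀, t₀)‖ * Real.exp k := by gcongr
      _ = _ := by simp only [L₁]; ring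
  have hbd : ∀ y : ℝ × ℝ × ℝ, 0 ≤ y.1 → y.1 ≤ kpow n 1 K₀ + 1 → |(Y y ε).1| ≤ B := by
    intro y hy0 hy
    have h := (norm_fst_le (Y y ε - y)).trans (hY.norm_sub_le y hε)
    rw [Real.norm_eq_abs, abs_le] at h
    simp only [Prod.fst_sub] at h
    rw [abs_le]
    constructor <;> linarith [h.1, h.2]
  refine max_le ?_ ?_
  · refine (abs_pow_sub_pow_le _ _ _).trans ?_
    have h5 : max |(Y x ε).1| |(Y x₀ ε).1| ≤ B :=
      max_le (hbd x h3.le h2.le) (hbd x₀ hk0.le (by simp only [x₀]; linarith))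
    have h6 : |(Y x ε).1 - (Y x₀ ε).1| ≤ L₁ * ‖z - (K₀, κ₀, t₀)‖ :=
      (norm_fst_le (Y x ε - Y x₀ ε)).trans hY1
    calc |(Y x ε).1 - (Y x₀ ε).1| * ((n + 1 : ℕ) : ℝ) * max |(Y x ε).1| |(Y x₀ ε).1| ^ (n + 1 - 1)
        ≤ (L₁ * ‖z - (K₀, κ₀, t₀)‖) * ((n + 1 : ℕ) : ℝ) * B ^ n := by
          rw [Nat.add_sub_cancel]
          gcongr
      _ = (L₁ * (n + 1 : ℕ) * B ^ n) * ‖z - (K₀, κ₀, t₀)‖ := by ring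
      _ ≤ _ := by gcongr; exact le_max_left _ _
  · refine ((norm_fst_le (Y x ε - Y x₀ ε).2).trans (norm_snd_le (Y x ε - Y x₀ ε))).trans
      (hY1.trans ?_)
    gcongr
    exact le_max_right _ _

end IsRootFlow

end

/-! ### Flows of time-dependent Hamiltonian fields -/

/-- The linear form `(x, y, z) ↦ a x + b y + c z`. -/
noncomputable def linForm (a b c : ℝ) : ℝ × ℝ × ℝ →L[ℝ] ℝ :=
  a • ContinuousLinearMap.fst ℝ ℝ (ℝ × ℝ) +
    (b • (ContinuousLinearMap.fst ℝ ℝ ℝ).comp (ContinuousLinearMap.snd ℝ ℝ (ℝ × ℝ)) +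
      c • (ContinuousLinearMap.snd ℝ ℝ ℝ).comp (ContinuousLinearMap.snd ℝ ℝ (ℝ × ℝ)))

@[simp] theorem linForm_apply (a b c : ℝ) (x : ℝ × ℝ × ℝ) :
    linForm a b c x = a * x.1 + (b * x.2.1 + c * x.2.2) := rfl

theorem continuousOn_linForm {α : Type*} [TopologicalSpace α] {a b c : α → ℝ} {S : Set α}
    (ha : ContinuousOn a S) (hb : ContinuousOn b S) (hc : ContinuousOn c S) :
    ContinuousOn (fun x => linForm (a x) (b x) (c x)) S :=
  (ha.smul continuousOn_const).add ((hb.smul continuousOn_const).add (hc.smul continuousOn_const))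

theorem continuousOn_clm_prod {α G H : Type*} [TopologicalSpace α] [NormedAddCommGroup G]
    [NormedSpace ℝ G] [NormedAddCommGroup H] [NormedSpace ℝ H] {A : α → ℝ × ℝ × ℝ →L[ℝ] G}
    {B : α → ℝ × ℝ × ℝ →L[ℝ] H} {S : Set α} (hA : ContinuousOn A S) (hB : ContinuousOn B S) :
    ContinuousOn (fun x => (A x).prod (B x)) S := by
  have h1 := (continuousOn_const (c := ContinuousLinearMap.inl ℝ G H)).clm_comp hA
  have h2 := (continuousOn_const (c := ContinuousLinearMap.inr ℝ G H)).clm_comp hB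
  refine (h1.add h2).congr fun x _ => ?_
  ext <;> simp

/-- The first derivatives `W₁ = ∂W/∂κ`, `W₂ = ∂W/∂K`, `W₃ = ∂W/∂t` of a function `W(ε, K, κ, t)`,
with their derivatives. -/
structure IsHamJet (U : Set (ℝ × ℝ × ℝ))
    (W₁ W₂ W₃ m₁₁ m₁₂ m₂₂ m₁₃ m₂₃ : ℝ → ℝ × ℝ × ℝ → ℝ) : Prop where
  deriv_angle : ∀ ε ∈ Icc (0 : ℝ) 1, ∀ z ∈ U,
    HasFDerivAt (W₁ ε) (linForm (m₁₂ ε z) (m₂₂ ε z) (m₂₃ ε z)) z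
  deriv_action : ∀ ε ∈ Icc (0 : ℝ) 1, ∀ z ∈ U,
    HasFDerivAt (W₂ ε) (linForm (m₁₁ ε z) (m₁₂ ε z) (m₁₃ ε z)) z
  deriv_time : ∀ ε ∈ Icc (0 : ℝ) 1, ∀ z ∈ U, HasFDerivAt (fun y : ℝ × ℝ => W₃ ε (y.1, y.2, z.2.2))
    (m₁₃ ε z • ContinuousLinearMap.fst ℝ ℝ ℝ + m₂₃ ε z • ContinuousLinearMap.snd ℝ ℝ ℝ)
    (z.1, z.2.1)
  cont₁₁ : ContinuousOn (fun q : ℝ × ℝ × ℝ × ℝ => m₁₁ q.1 q.2) (Icc 0 1 ×ˢ U)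
  cont₁₂ : ContinuousOn (fun q : ℝ × ℝ × ℝ × ℝ => m₁₂ q.1 q.2) (Icc 0 1 ×ˢ U)
  cont₂₂ : ContinuousOn (fun q : ℝ × ℝ × ℝ × ℝ => m₂₂ q.1 q.2) (Icc 0 1 ×ˢ U)
  cont₁₃ : ContinuousOn (fun q : ℝ × ℝ × ℝ × ℝ => m₁₃ q.1 q.2) (Icc 0 1 ×ˢ U)
  cont₂₃ : ContinuousOn (fun q : ℝ × ℝ × ℝ × ℝ => m₂₃ q.1 q.2) (Icc 0 1 ×ˢ U)

/-- The derivative of the field `(W₁, -W₂, 0)`. -/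
noncomputable def jetMap (m₁₁ m₁₂ m₂₂ m₁₃ m₂₃ : ℝ → ℝ × ℝ × ℝ → ℝ) (ε : ℝ) (z : ℝ × ℝ × ℝ) :
    ℝ × ℝ × ℝ →L[ℝ] ℝ × ℝ × ℝ :=
  (linForm (m₁₂ ε z) (m₂₂ ε z) (m₂₃ ε z)).prod
    ((-linForm (m₁₁ ε z) (m₁₂ ε z) (m₁₃ ε z)).prod 0)

/-- The area form on the first two components. -/
def areaForm (a b : ℝ × ℝ × ℝ) : ℝ := a.1 * b.2.1 - a.2.1 * b.1

/-- The inclusion of the vectors without time component. -/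
noncomputable def spatial : ℝ × ℝ →L[ℝ] ℝ × ℝ × ℝ :=
  (ContinuousLinearMap.fst ℝ ℝ ℝ).prod ((ContinuousLinearMap.snd ℝ ℝ ℝ).prod 0)

@[simp] theorem spatial_apply (b : ℝ × ℝ) : spatial b = (b.1, b.2, 0) := rfl

section

variable {U Z : Set (ℝ × ℝ × ℝ)} {W₁ W₂ W₃ m₁₁ m₁₂ m₂₂ m₁₃ m₂₃ : ℝ → ℝ × ℝ × ℝ → ℝ}
  {φ : ℝ → ℝ × ℝ × ℝ → ℝ × ℝ × ℝ}

theorem IsHamJet.isSmoothFlow (h : IsHamJet U W₁ W₂ W₃ m₁₁ m₁₂ m₂₂ m₁₃ m₂₃) (hU : IsOpen U)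
    (hZ : IsOpen Z) (hinit : ∀ z ∈ Z, φ 0 z = z) (hmaps : ∀ s ∈ Icc (0 : ℝ) 1, ∀ z ∈ Z, φ s z ∈ U)
    (hode : ∀ z ∈ Z, IsUnitSolution (fun ε z => (W₁ ε z, -W₂ ε z, (0 : ℝ))) fun s => φ s z)
    (hlip : ∀ z ∈ Z, ∃ L, ∀ᶠ z' in 𝓝 z, ∀ s ∈ Icc (0 : ℝ) 1, ‖φ s z' - φ s z‖ ≤ L * ‖z' - z‖) :
    IsSmoothFlow (fun ε z => (W₁ ε z, -W₂ ε z, (0 : ℝ))) (jetMap m₁₁ m₁₂ m₂₂ m₁₃ m₂₃) U Z φ where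
  open_target := hU
  open_source := hZ
  deriv s hs x hx := (h.deriv_angle s hs x hx).prodMk
    ((h.deriv_action s hs x hx).neg.prodMk (hasFDerivAt_const 0 x))
  continuousOn := by
    have h1 := continuousOn_linForm h.cont₁₂ h.cont₂₂ h.cont₂₃
    have h2 := (continuousOn_linForm h.cont₁₁ h.cont₁₂ h.cont₁₃).neg
    have h3 : ContinuousOn (fun _ : ℝ × ℝ × ℝ × ℝ => (0 : ℝ × ℝ × ℝ →L[ℝ] ℝ)) (Icc 0 1 ×ˢ U) :=
      continuousOn_const
    exact continuousOn_clm_prod h1 (continuousOn_clm_prod h2 h3)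
  init := hinit
  maps := hmaps
  ode := hode
  lipschitz := hlip

/-- The variational equation. -/
def IsVariation (m₁₁ m₁₂ m₂₂ m₁₃ m₂₃ : ℝ → ℝ × ℝ × ℝ → ℝ) (φ : ℝ → ℝ × ℝ × ℝ)
    (J : ℝ → ℝ × ℝ × ℝ →L[ℝ] ℝ × ℝ × ℝ) : Prop :=
  J 0 = ContinuousLinearMap.id ℝ _ ∧ ∀ s ∈ Icc (0 : ℝ) 1,
    HasDerivWithinAt J ((jetMap m₁₁ m₁₂ m₂₂ m₁₃ m₂₃ s (φ s)).comp (J s)) (Icc 0 1) s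

theorem eqOn_of_hasDerivWithinAt_eq {f g f' : ℝ → ℝ}
    (hf : ∀ s ∈ Icc (0 : ℝ) 1, HasDerivWithinAt f (f' s) (Icc 0 1) s)
    (hg : ∀ s ∈ Icc (0 : ℝ) 1, HasDerivWithinAt g (f' s) (Icc 0 1) s) (h0 : f 0 = g 0) {s : ℝ}
    (hs : s ∈ Icc (0 : ℝ) 1) : f s = g s := by
  have h := (convex_Icc (0 : ℝ) 1).norm_image_sub_le_of_norm_hasDerivWithin_le (C := 0)
    (f := fun s => f s - g s) (f' := fun _ => 0)
    (fun e he => by simpa using (hf e he).fun_sub (hg e he)) (by simp) (left_mem_Icc.2 zero_le_one) hs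
  rw [zero_mul, norm_le_zero_iff, h0, sub_self, sub_zero, sub_eq_zero] at h
  exact h

variable {γ : ℝ → ℝ × ℝ × ℝ} {J : ℝ → ℝ × ℝ × ℝ →L[ℝ] ℝ × ℝ × ℝ}

theorem IsVariation.hasDerivWithinAt (h : IsVariation m₁₁ m₁₂ m₂₂ m₁₃ m₂₃ γ J) (a : ℝ × ℝ × ℝ)
    {s : ℝ} (hs : s ∈ Icc (0 : ℝ) 1) : HasDerivWithinAt (fun s => J s a)
      (jetMap m₁₁ m₁₂ m₂₂ m₁₃ m₂₃ s (γ s) (J s a)) (Icc 0 1) s := by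
  simpa using (h.2 s hs).clm_apply (hasDerivWithinAt_const s (Icc 0 1) a)

theorem IsVariation.time_eq (h : IsVariation m₁₁ m₁₂ m₂₂ m₁₃ m₂₃ γ J) (a : ℝ × ℝ × ℝ)
    {s : ℝ} (hs : s ∈ Icc (0 : ℝ) 1) : (J s a).2.2 = a.2.2 :=
  eqOn_of_hasDerivWithinAt_eq (f := fun s => (J s a).2.2) (g := fun _ => a.2.2) (f' := fun _ => 0)
    (fun _ hs => (h.hasDerivWithinAt a hs).snd.snd) (fun s _ => hasDerivWithinAt_const s _ _)
    (by simp [h.1]) hs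

/-- The spatial part of `jetMap` is the matrix of a Hamiltonian linear system, so its contributions
cancel. Only the mixed space–time derivatives survive, multiplied by the constant time components:
the pairing is constant for spatial vectors, and for the time direction it sees the spatial
derivative of `∂W/∂t`. -/
theorem IsVariation.areaForm (h : IsVariation m₁₁ m₁₂ m₂₂ m₁₃ m₂₃ γ J) (a b : ℝ × ℝ × ℝ)
    {s : ℝ} (hs : s ∈ Icc (0 : ℝ) 1) :
    HasDerivWithinAt (fun s => areaForm (J s a) (J s b))
      (a.2.2 * (m₁₃ s (γ s) * (J s b).1 + m₂₃ s (γ s) * (J s b).2.1) -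
        b.2.2 * (m₁₃ s (γ s) * (J s a).1 + m₂₃ s (γ s) * (J s a).2.1)) (Icc 0 1) s := by
  have ha := h.hasDerivWithinAt a hs
  have hb := h.hasDerivWithinAt b hs
  have ha₁ : HasDerivWithinAt (fun s => (J s a).1) _ (Icc 0 1) s := ha.fst
  have ha₂ : HasDerivWithinAt (fun s => (J s a).2.1) _ (Icc 0 1) s := ha.snd.fst
  have hb₁ : HasDerivWithinAt (fun s => (J s b).1) _ (Icc 0 1) s := hb.fst
  have hb₂ : HasDerivWithinAt (fun s => (J s b).2.1) _ (Icc 0 1) s := hb.snd.fst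
  have key := (ha₁.mul hb₂).sub (ha₂.mul hb₁)
  refine HasDerivWithinAt.congr_deriv key ?_
  have h1 := h.time_eq a hs
  have h2 := h.time_eq b hs
  simp only [jetMap, ContinuousLinearMap.prod_apply, linForm_apply, neg_apply,
    h1, h2]
  ring

theorem IsVariation.areaForm_spatial (h : IsVariation m₁₁ m₁₂ m₂₂ m₁₃ m₂₃ γ J) (a b : ℝ × ℝ)
    {s : ℝ} (hs : s ∈ Icc (0 : ℝ) 1) :
    LieOscillator.areaForm (J s (spatial a)) (J s (spatial b)) = a.1 * b.2 - a.2 * b.1 :=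
  eqOn_of_hasDerivWithinAt_eq
    (f := fun s => LieOscillator.areaForm (J s (spatial a)) (J s (spatial b)))
    (g := fun _ => a.1 * b.2 - a.2 * b.1) (f' := fun _ => 0)
    (fun s hs => by simpa using h.areaForm (spatial a) (spatial b) hs)
    (fun s _ => hasDerivWithinAt_const s _ _) (by simp [h.1, LieOscillator.areaForm]) hs

/-- The rate of change of the generating function along the flow, in the spatial directions. -/
theorem IsHamJet.hasFDerivAt_time (h : IsHamJet U W₁ W₂ W₃ m₁₁ m₁₂ m₂₂ m₁₃ m₂₃) (hZ : IsOpen Z)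
    {ε : ℝ} (hε : ε ∈ Icc (0 : ℝ) 1) {z : ℝ × ℝ × ℝ} (hz : z ∈ Z) (hmaps : φ ε z ∈ U)
    (htime : ∀ z ∈ Z, (φ ε z).2.2 = z.2.2) {J : ℝ × ℝ × ℝ →L[ℝ] ℝ × ℝ × ℝ}
    (hJ : HasFDerivAt (φ ε) J z) :
    HasFDerivAt (fun y : ℝ × ℝ => W₃ ε (φ ε (y.1, y.2, z.2.2)))
      (m₁₃ ε (φ ε z) • (ContinuousLinearMap.fst ℝ ℝ (ℝ × ℝ)).comp (J.comp spatial) +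
        m₂₃ ε (φ ε z) • ((ContinuousLinearMap.fst ℝ ℝ ℝ).comp
          (ContinuousLinearMap.snd ℝ ℝ (ℝ × ℝ))).comp (J.comp spatial)) (z.1, z.2.1) := by
  have hι : HasFDerivAt (fun y : ℝ × ℝ => (y.1, y.2, z.2.2)) spatial (z.1, z.2.1) :=
    hasFDerivAt_fst.prodMk (hasFDerivAt_snd.prodMk (hasFDerivAt_const _ _))
  have h1 : HasFDerivAt (fun y : ℝ × ℝ => φ ε (y.1, y.2, z.2.2)) (J.comp spatial) (z.1, z.2.1) :=
    HasFDerivAt.comp (g := φ ε) (z.1, z.2.1) hJ hι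
  have h2 : HasFDerivAt
      (fun y : ℝ × ℝ => ((φ ε (y.1, y.2, z.2.2)).1, (φ ε (y.1, y.2, z.2.2)).2.1))
      (((ContinuousLinearMap.fst ℝ ℝ (ℝ × ℝ)).comp (J.comp spatial)).prod
        (((ContinuousLinearMap.fst ℝ ℝ ℝ).comp
          (ContinuousLinearMap.snd ℝ ℝ (ℝ × ℝ))).comp (J.comp spatial))) (z.1, z.2.1) :=
    h1.fst.prodMk h1.snd.fst
  have h3 := h.deriv_time ε hε (φ ε z) hmaps
  rw [htime z hz] at h3
  have h4 := HasFDerivAt.comp (g := fun y : ℝ × ℝ => W₃ ε (y.1, y.2, z.2.2)) (z.1, z.2.1) h3 h2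
  refine (h4.congr_fderiv ?_).congr_of_eventuallyEq ?_
  · ext <;> simp
  · have hc : ContinuousAt (fun y : ℝ × ℝ => (y.1, y.2, z.2.2)) (z.1, z.2.1) := by fun_prop
    filter_upwards [hc.eventually_mem (hZ.mem_nhds hz)] with y hy
    simp only [Function.comp_apply]
    have := htime _ hy
    simp only at this
    exact congrArg (W₃ ε) (Prod.ext rfl (Prod.ext rfl this))

end

/-! ### The generating function as a Hamiltonian -/

/-- Sums of terms `ε ^ (r - 1) / (r - 1)! K ^ (a_r / (n + 1)) F_r(κ, t)`. -/
noncomputable def genSum (n : ℕ) (s : Finset ℕ) (a : ℕ → ℤ) (c : ℕ → ℝ) (F : ℕ → ℝ → ℝ → ℝ)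
    (ε : ℝ) (z : ℝ × ℝ × ℝ) : ℝ :=
  ∑ r ∈ s, ε ^ (r - 1) / ((r - 1).factorial : ℝ) * (c r * (kpow n (a r) z.1 * F r z.2.1 z.2.2))

section

variable {n : ℕ} {s : Finset ℕ} {a : ℕ → ℤ} {c : ℕ → ℝ} {F w : ℕ → ℝ → ℝ → ℝ} {ϖ T : ℝ}

theorem Sep.hasFDerivAt {F : ℝ → ℝ → ℝ} (hF : F ∈ Sep ϖ T 1) (κ t : ℝ) :
    HasFDerivAt (fun z : ℝ × ℝ => F z.1 z.2) (angleDeriv F κ t • ContinuousLinearMap.fst ℝ ℝ ℝ +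
      timeDeriv F κ t • ContinuousLinearMap.snd ℝ ℝ ℝ) (κ, t) := by
  have h := ((Sep.contDiff hF).differentiable (by simp) (κ, t)).hasFDerivAt
  refine h.congr_fderiv ?_
  have h1 : HasDerivAt (fun x => F x t) _ κ :=
    HasFDerivAt.comp_hasDerivAt (l := fun z : ℝ × ℝ => F z.1 z.2) (f := fun x => (x, t)) κ h
      ((hasDerivAt_id κ).prodMk (hasDerivAt_const κ t))
  have h2 : HasDerivAt (fun x => F κ x) _ t :=
    HasFDerivAt.comp_hasDerivAt (l := fun z : ℝ × ℝ => F z.1 z.2) (f := fun x => (κ, x)) t h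
      ((hasDerivAt_const t κ).prodMk (hasDerivAt_id t))
  have h1' := h1.unique (Sep.hasDerivAt_angle hF κ t)
  have h2' := h2.unique (Sep.hasDerivAt_time (e := 0) hF κ t)
  ext <;> simp [h1', h2']

theorem continuousOn_genSum (hF : ∀ r, F r ∈ Sep ϖ T 0) :
    ContinuousOn (fun q : ℝ × ℝ × ℝ × ℝ => genSum n s a c F q.1 q.2) {q | 0 < q.2.1} := by
  refine continuousOn_finsetSum _ fun r _ => ?_
  have h1 : ContinuousOn (fun q : ℝ × ℝ × ℝ × ℝ => kpow n (a r) q.2.1) {q | 0 < q.2.1} :=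
    fun q hq => ((hasDerivAt_kpow hq (a r)).continuousAt.comp
      (f := fun q : ℝ × ℝ × ℝ × ℝ => q.2.1) (by fun_prop)).continuousWithinAt
  have h2 : Continuous fun q : ℝ × ℝ × ℝ × ℝ => F r q.2.2.1 q.2.2.2 :=
    (Sep.contDiff (hF r)).continuous.comp
      (g := fun z : ℝ × ℝ => F r z.1 z.2) (f := fun q : ℝ × ℝ × ℝ × ℝ => q.2.2) (by fun_prop)
  have h3 : Continuous fun q : ℝ × ℝ × ℝ × ℝ => q.1 ^ (r - 1) / ((r - 1).factorial : ℝ) := by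
    fun_prop
  exact h3.continuousOn.mul (continuousOn_const.mul (h1.mul h2.continuousOn))

theorem hasFDerivAt_genSum (hF : ∀ r, F r ∈ Sep ϖ T 1) (ε : ℝ) {z : ℝ × ℝ × ℝ} (hz : 0 < z.1) :
    HasFDerivAt (genSum n s a c F ε)
      (linForm (genSum n s (fun r => a r - (n + 1)) (fun r => c r * (a r / ((n : ℝ) + 1))) F ε z)
        (genSum n s a c (fun r => angleDeriv (F r)) ε z)
        (genSum n s a c (fun r => timeDeriv (F r)) ε z)) z := by
  have h : ∀ r ∈ s, HasFDerivAt (fun z : ℝ × ℝ × ℝ => ε ^ (r - 1) / ((r - 1).factorial : ℝ) *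
      (c r * (kpow n (a r) z.1 * F r z.2.1 z.2.2))) _ z := fun r _ =>
    ((((hasDerivAt_kpow hz (a r)).comp_hasFDerivAt z hasFDerivAt_fst).mul
      (HasFDerivAt.comp (g := fun z : ℝ × ℝ => F r z.1 z.2) z
        (Sep.hasFDerivAt (hF r) z.2.1 z.2.2) hasFDerivAt_snd)).const_mul (c r)).const_mul _
  refine (HasFDerivAt.fun_sum h).congr_fderiv ?_
  refine ContinuousLinearMap.ext fun x => ?_
  simp only [genSum, linForm_apply, Finset.sum_mul, ← Finset.sum_add_distrib, sum_apply]
  refine Finset.sum_congr rfl fun r _ => ?_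
  simp
  ring

theorem hasFDerivAt_genSum_spatial (hF : ∀ r, F r ∈ Sep ϖ T 0) (ε : ℝ) {z : ℝ × ℝ × ℝ}
    (hz : 0 < z.1) : HasFDerivAt (fun y : ℝ × ℝ => genSum n s a c F ε (y.1, y.2, z.2.2))
      (genSum n s (fun r => a r - (n + 1)) (fun r => c r * (a r / ((n : ℝ) + 1))) F ε z •
        ContinuousLinearMap.fst ℝ ℝ ℝ +
        genSum n s a c (fun r => angleDeriv (F r)) ε z • ContinuousLinearMap.snd ℝ ℝ ℝ)
      (z.1, z.2.1) := by
  have h1 : ∀ r, HasFDerivAt (fun y : ℝ × ℝ => kpow n (a r) y.1)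
      (((a r : ℝ) / ((n : ℝ) + 1) * kpow n (a r - (n + 1)) z.1) • ContinuousLinearMap.fst ℝ ℝ ℝ)
      (z.1, z.2.1) := fun r =>
    HasDerivAt.comp_hasFDerivAt (h₂ := kpow n (a r)) (f := Prod.fst) (z.1, z.2.1)
      (hasDerivAt_kpow hz (a r)) hasFDerivAt_fst
  have h2 : ∀ r, HasFDerivAt (fun y : ℝ × ℝ => F r y.2 z.2.2)
      (angleDeriv (F r) z.2.1 z.2.2 • ContinuousLinearMap.snd ℝ ℝ ℝ) (z.1, z.2.1) := fun r =>
    HasDerivAt.comp_hasFDerivAt (h₂ := fun κ => F r κ z.2.2) (z.1, z.2.1)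
      (Sep.hasDerivAt_angle (hF r) z.2.1 z.2.2) hasFDerivAt_snd
  have h : ∀ r ∈ s, HasFDerivAt (fun y : ℝ × ℝ => ε ^ (r - 1) / ((r - 1).factorial : ℝ) *
      (c r * (kpow n (a r) y.1 * F r y.2 z.2.2))) _ (z.1, z.2.1) := fun r _ =>
    (((h1 r).mul (h2 r)).const_mul (c r)).const_mul _
  refine (HasFDerivAt.fun_sum h).congr_fderiv ?_
  refine ContinuousLinearMap.ext fun x => ?_
  simp only [genSum, Finset.sum_mul, ← Finset.sum_add_distrib, sum_apply, add_apply, smul_apply,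
    smul_eq_mul, ContinuousLinearMap.coe_fst', ContinuousLinearMap.coe_snd']
  refine Finset.sum_congr rfl fun r _ => ?_
  ring

/-- The exponent of `W_r`. -/
def genDegree (n : ℕ) (r : ℕ) : ℤ := (n : ℤ) - r + 1

/-- The factor of the `K`-derivative of `W_r`. -/
noncomputable def genWeight (n : ℕ) (r : ℕ) : ℝ := (genDegree n r : ℝ) / ((n : ℝ) + 1)

theorem genFun_eq_genSum (hs : ∀ r ∈ s, 1 ≤ r) (ε K κ t : ℝ) :
    genFun s (genTerm n w) ε K κ t = genSum n s (genDegree n) (fun _ => 1) w ε (K, κ, t) := by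
  rw [genFun_genTerm hs, genSum]
  simp [genDegree]

/-- The action derivative of the generating function. -/
noncomputable def genAction (n : ℕ) (s : Finset ℕ) (F : ℕ → ℝ → ℝ → ℝ) : ℝ → ℝ × ℝ × ℝ → ℝ :=
  genSum n s (fun r => genDegree n r - (n + 1)) (fun r => 1 * genWeight n r) F

/-- The generating function with other coefficients. -/
noncomputable def genPlain (n : ℕ) (s : Finset ℕ) (F : ℕ → ℝ → ℝ → ℝ) : ℝ → ℝ × ℝ × ℝ → ℝ :=
  genSum n s (genDegree n) (fun _ => 1) F

theorem isHamJet_gen (hw : ∀ r, w r ∈ Sep ϖ T 1) {U : Set (ℝ × ℝ × ℝ)} (hU : ∀ z ∈ U, 0 < z.1) :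
    IsHamJet U (genPlain n s fun r => angleDeriv (w r)) (genAction n s w)
      (genPlain n s fun r => timeDeriv (w r))
      (genSum n s (fun r => genDegree n r - (n + 1) - (n + 1)) (fun r => 1 * genWeight n r *
        ((genDegree n r - (n + 1) : ℤ) / ((n : ℝ) + 1))) w)
      (genAction n s fun r => angleDeriv (w r))
      (genPlain n s fun r => angleDeriv (angleDeriv (w r)))
      (genAction n s fun r => timeDeriv (w r))
      (genPlain n s fun r => timeDeriv (angleDeriv (w r))) := by
  have hw' : ∀ r, w r ∈ Sep ϖ T 0 := fun r => Sep.mono (Nat.zero_le 1) (hw r)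
  have hwa : ∀ r, angleDeriv (w r) ∈ Sep ϖ T 1 := fun r => Sep.angleDeriv_mem (hw r)
  have hwt : ∀ r, timeDeriv (w r) ∈ Sep ϖ T 0 := fun r => Sep.timeDeriv_mem (hw r)
  have hsub : ∀ {f : ℝ × ℝ × ℝ × ℝ → ℝ}, ContinuousOn f {q | 0 < q.2.1} →
      ContinuousOn f (Icc 0 1 ×ˢ U) := fun h => h.mono fun q hq => hU q.2 hq.2
  refine ⟨fun ε _ z hz => hasFDerivAt_genSum hwa ε (hU z hz),
    fun ε _ z hz => hasFDerivAt_genSum hw ε (hU z hz), fun ε _ z hz => ?_,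
    hsub (continuousOn_genSum hw'), hsub (continuousOn_genSum fun r => Sep.angleDeriv_mem (hw' r)),
    hsub (continuousOn_genSum fun r => Sep.angleDeriv_mem (Sep.angleDeriv_mem (hw' r))),
    hsub (continuousOn_genSum hwt), hsub (continuousOn_genSum fun r => Sep.timeDeriv_mem (hwa r))⟩
  have := hasFDerivAt_genSum_spatial (n := n) (s := s) (a := genDegree n) (c := fun _ => 1)
    hwt ε (hU z hz)
  -- The same function must serve as the time derivative of `∂W/∂κ` and as the angle derivative of
  -- `∂W/∂t`. Separability provides this without second time derivatives.
  simp only [fun r => Sep.timeDeriv_angleDeriv (e := 0) (hw r)]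
  exact this

theorem hamField_eq_gen (hs : ∀ r ∈ s, 1 ≤ r) (hw : ∀ r, w r ∈ Sep ϖ T 1) (ε t : ℝ) {K : ℝ}
    (hK : 0 < K) (κ : ℝ) : hamField (genFun s (genTerm n w) ε) t (K, κ) =
      (genPlain n s (fun r => angleDeriv (w r)) ε (K, κ, t), -genAction n s w ε (K, κ, t)) := by
  have h := hasFDerivAt_genSum_spatial (n := n) (s := s) (a := genDegree n) (c := fun _ => 1)
    (fun r => Sep.mono (Nat.zero_le 1) (hw r)) ε (z := (K, κ, t)) hK
  have h1 := HasFDerivAt.comp_hasDerivAt (f := fun x => (K, x)) κ h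
      ((hasDerivAt_const κ K).prodMk (hasDerivAt_id κ))
  have h2 := HasFDerivAt.comp_hasDerivAt (f := fun x => (x, κ)) K h
      ((hasDerivAt_id K).prodMk (hasDerivAt_const K κ))
  simp only [hamField, genFun_eq_genSum hs]
  refine Prod.ext (h1.deriv.trans ?_) (congrArg Neg.neg (h2.deriv.trans ?_))
  · simp [genPlain]
  · simp [genAction, genWeight]

end

/-! ### Symplectic changes of variables -/

section

variable {a b : ℝ} {φ : ℝ × ℝ × ℝ → ℝ × ℝ × ℝ} {J : ℝ × ℝ × ℝ → ℝ × ℝ × ℝ →L[ℝ] ℝ × ℝ × ℝ}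

/-- The map `φ(K, κ, t)`, with the time as a third component, is a `C^1` change of variables from
`K > b` into `K > a` that preserves the area at fixed time. -/
structure IsAreaMap (a b : ℝ) (φ : ℝ × ℝ × ℝ → ℝ × ℝ × ℝ)
    (J : ℝ × ℝ × ℝ → ℝ × ℝ × ℝ →L[ℝ] ℝ × ℝ × ℝ) : Prop where
  deriv : ∀ z, b < z.1 → HasFDerivAt φ (J z) z
  continuousOn : ContinuousOn J {z | b < z.1}
  time : ∀ z, b < z.1 → (φ z).2.2 = z.2.2
  time_deriv : ∀ z, b < z.1 → ∀ x, (J z x).2.2 = x.2.2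
  area : ∀ z, b < z.1 → ∀ u v : ℝ × ℝ,
    areaForm (J z (spatial u)) (J z (spatial v)) = u.1 * v.2 - u.2 * v.1
  injective : ∀ z z', b < z.1 → b < z'.1 → φ z = φ z' → z = z'
  maps : ∀ z, b < z.1 → a < (φ z).1

namespace IsAreaMap

theorem isOpen_domain : IsOpen {z : ℝ × ℝ × ℝ | b < z.1} := isOpen_lt continuous_const continuous_fst

theorem injective_deriv (h : IsAreaMap a b φ J) {z : ℝ × ℝ × ℝ} (hz : b < z.1) :
    Function.Injective (J z) := by
  rw [injective_iff_map_eq_zero]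
  intro x hx
  have h1 := h.time_deriv z hz x
  rw [hx] at h1
  have hs : x = spatial (x.1, x.2.1) := Prod.ext rfl (Prod.ext rfl h1.symm)
  have h2 := fun v => h.area z hz (x.1, x.2.1) v
  rw [← hs, hx] at h2
  have h3 := h2 (1, 0)
  have h4 := h2 (0, 1)
  simp [areaForm] at h3 h4
  rw [hs, h3, ← h4]
  exact map_zero spatial

theorem hasStrictFDerivAt (h : IsAreaMap a b φ J) {z : ℝ × ℝ × ℝ} (hz : b < z.1) :
    HasStrictFDerivAt φ (J z) z := by
  have hn : {z : ℝ × ℝ × ℝ | b < z.1} ∈ 𝓝 z := isOpen_domain.mem_nhds hz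
  refine hasStrictFDerivAt_of_hasFDerivAt_of_continuousAt ?_ (h.continuousOn.continuousAt hn)
  filter_upwards [hn] with x hx using h.deriv x hx

theorem contDiffOn (h : IsAreaMap a b φ J) : ContDiffOn ℝ 1 φ {z | b < z.1} := by
  rw [show (1 : WithTop ℕ∞) = 0 + 1 by rfl, contDiffOn_succ_iff_fderiv_of_isOpen isOpen_domain]
  refine ⟨fun z hz => (h.deriv z hz).differentiableAt.differentiableWithinAt, by simp, ?_⟩
  rw [contDiffOn_zero]
  exact h.continuousOn.congr fun z hz => (h.deriv z hz).fderiv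

/-- A curve whose image is differentiable is differentiable. -/
theorem differentiableAt_curve (h : IsAreaMap a b φ J) {x : ℝ → ℝ × ℝ × ℝ} {t₀ : ℝ}
    (hx : ∀ᶠ t in 𝓝 t₀, b < (x t).1) (hd : DifferentiableAt ℝ (fun t => φ (x t)) t₀) :
    DifferentiableAt ℝ x t₀ := by
  have hx₀ := hx.self_of_nhds
  let e : (ℝ × ℝ × ℝ) ≃L[ℝ] (ℝ × ℝ × ℝ) :=
    (LinearEquiv.ofInjectiveEndo (J (x t₀)).toLinearMap
      (h.injective_deriv hx₀)).toContinuousLinearEquiv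
  have he : (e : ℝ × ℝ × ℝ →L[ℝ] ℝ × ℝ × ℝ) = J (x t₀) := by
    ext <;> rfl
  have hs : HasStrictFDerivAt φ (e : ℝ × ℝ × ℝ →L[ℝ] ℝ × ℝ × ℝ) (x t₀) := by
    rw [he]; exact h.hasStrictFDerivAt hx₀
  set g := hs.localInverse φ e (x t₀)
  have hg := hs.to_localInverse
  have hgx : g (φ (x t₀)) = x t₀ := hs.localInverse_apply_image
  have h1 : ∀ᶠ t in 𝓝 t₀, φ (g (φ (x t))) = φ (x t) :=
    hd.continuousAt.eventually hs.eventually_right_inverse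
  have h2 : ∀ᶠ t in 𝓝 t₀, b < (g (φ (x t))).1 := by
    have hc : ContinuousAt (fun t => g (φ (x t))) t₀ :=
      ContinuousAt.comp (g := g) hg.hasFDerivAt.continuousAt hd.continuousAt
    refine hc.eventually_mem (isOpen_domain.mem_nhds ?_)
    rw [hgx]
    exact hx₀
  have h3 : (fun t => g (φ (x t))) =ᶠ[𝓝 t₀] x := by
    filter_upwards [h1, h2, hx] with t h1 h2 h3
    exact h.injective _ _ h2 h3 h1
  exact (DifferentiableAt.comp t₀ (g := g) hg.hasFDerivAt.differentiableAt hd).congr_of_eventuallyEq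
    h3.symm

/-- The Hamiltonian field is characterized by `ω(X_H, v) = dH(v)` for the area form `ω`. In this
form it can be compared under area-preserving maps. -/
theorem hamField_area {H : PhaseFun} {t : ℝ} {z : ℝ × ℝ} {L : ℝ × ℝ →L[ℝ] ℝ}
    (hH : HasFDerivAt (fun z : ℝ × ℝ => H z.1 z.2 t) L z) (v : ℝ × ℝ) :
    (hamField H t z).1 * v.2 - (hamField H t z).2 * v.1 = L v := by
  have h1 := HasFDerivAt.comp_hasDerivAt (f := fun x => (z.1, x)) z.2 hH
      ((hasDerivAt_const z.2 z.1).prodMk (hasDerivAt_id z.2))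
  have h2 := HasFDerivAt.comp_hasDerivAt (f := fun x => (x, z.2)) z.1 hH
      ((hasDerivAt_id z.1).prodMk (hasDerivAt_const z.1 z.2))
  have e1 : (hamField H t z).1 = L (0, 1) := h1.deriv
  have e2 : (hamField H t z).2 = -L (1, 0) := congrArg Neg.neg h2.deriv
  have e3 : L v = v.1 * L (1, 0) + v.2 * L (0, 1) := by
    rw [← smul_eq_mul, ← smul_eq_mul, ← map_smul, ← map_smul, ← map_add]
    congr 1
    ext <;> simp
  rw [e1, e2, e3]
  ring

/-- With `G = H ∘ φ - R` and `dR(v) = ω(J ∂_t, J v)`, preservation of area gives `ω(J(y',1) - X_H, J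
v) = ω(y' - X_G, v)` for every spatial `v`. As `J` is invertible on spatial vectors, one difference
vanishes exactly if the other does. -/
theorem transformsHam (h : IsAreaMap a b φ J) {H G R : PhaseFun}
    (hH : ∀ t, DifferentiableOn ℝ (fun z : ℝ × ℝ => H z.1 z.2 t) {z | a < z.1})
    (hR : ∀ z : ℝ × ℝ × ℝ, b < z.1 → ∃ ρ : ℝ × ℝ →L[ℝ] ℝ,
      HasFDerivAt (fun y : ℝ × ℝ => R y.1 y.2 z.2.2) ρ (z.1, z.2.1) ∧
      ∀ v, ρ v = areaForm (J z (0, 0, 1)) (J z (spatial v)))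
    (hG : ∀ K κ t, b < K → G K κ t = H (φ (K, κ, t)).1 (φ (K, κ, t)).2.1 t - R K κ t) :
    TransformsHam b H G fun K κ t => ((φ (K, κ, t)).1, (φ (K, κ, t)).2.1) := by
  have hopen : ∀ c : ℝ, IsOpen {z : ℝ × ℝ | c < z.1} := fun c => isOpen_lt continuous_const
    continuous_fst
  have hdG : ∀ (t : ℝ) (y : ℝ × ℝ), b < y.1 → ∃ LH LG : ℝ × ℝ →L[ℝ] ℝ,
      HasFDerivAt (fun z : ℝ × ℝ => H z.1 z.2 t) LH
        ((φ (y.1, y.2, t)).1, (φ (y.1, y.2, t)).2.1) ∧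
      HasFDerivAt (fun z : ℝ × ℝ => G z.1 z.2 t) LG y ∧
      ∀ v, LG v = LH ((J (y.1, y.2, t) (spatial v)).1, (J (y.1, y.2, t) (spatial v)).2.1) -
        areaForm (J (y.1, y.2, t) (0, 0, 1)) (J (y.1, y.2, t) (spatial v)) := by
    intro t y hy
    obtain ⟨ρ, hρ, hρv⟩ := hR (y.1, y.2, t) hy
    have hHd := ((hH t).differentiableAt ((hopen a).mem_nhds
      (show a < _ from h.maps (y.1, y.2, t) hy))).hasFDerivAt
      (x := ((φ (y.1, y.2, t)).1, (φ (y.1, y.2, t)).2.1))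
    have hι : HasFDerivAt (fun y : ℝ × ℝ => (y.1, y.2, t)) spatial y :=
      hasFDerivAt_fst.prodMk (hasFDerivAt_snd.prodMk (hasFDerivAt_const _ _))
    have h1 : HasFDerivAt (fun y : ℝ × ℝ => φ (y.1, y.2, t)) ((J (y.1, y.2, t)).comp spatial) y :=
      HasFDerivAt.comp (g := φ) y (h.deriv (y.1, y.2, t) hy) hι
    have h2 : HasFDerivAt (fun y : ℝ × ℝ => ((φ (y.1, y.2, t)).1, (φ (y.1, y.2, t)).2.1)) _ y :=
      h1.fst.prodMk h1.snd.fst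
    have h3 := (HasFDerivAt.comp (g := fun z : ℝ × ℝ => H z.1 z.2 t) y hHd h2).sub hρ
    refine ⟨_, _, hHd, h3.congr_of_eventuallyEq ?_, fun v => ?_⟩
    · filter_upwards [(hopen b).mem_nhds hy] with x hx
      exact hG x.1 x.2 t hx
    · rw [← hρv v]
      rfl
  have hpoint : ∀ (t : ℝ) (y y' : ℝ × ℝ), b < y.1 →
      (y' = hamField G t y ↔ ((J (y.1, y.2, t) (y'.1, y'.2, 1)).1,
        (J (y.1, y.2, t) (y'.1, y'.2, 1)).2.1) =
        hamField H t ((φ (y.1, y.2, t)).1, (φ (y.1, y.2, t)).2.1)) := by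
    intro t y y' hy
    obtain ⟨LH, LG, hLH, hLG, hL⟩ := hdG t y hy
    set A := J (y.1, y.2, t) with hA
    have hG' := hamField_area hLG
    have hH' := hamField_area hLH
    set XG := hamField G t y
    set XH := hamField H t ((φ (y.1, y.2, t)).1, (φ (y.1, y.2, t)).2.1)
    have harea := h.area (y.1, y.2, t) hy
    rw [← hA] at harea
    have hsplit : A (y'.1, y'.2, 1) = A (spatial y') + A (0, 0, 1) := by
      rw [← map_add]
      congr 1
      simp
    -- The velocity of the image curve is `J(y',1) = J y' + J ∂_t`; the second part pairs with `J v`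
    -- to `dR(v)`.
    have key : ∀ v : ℝ × ℝ, ((A (y'.1, y'.2, 1)).1 - XH.1) * (A (spatial v)).2.1 -
        ((A (y'.1, y'.2, 1)).2.1 - XH.2) * (A (spatial v)).1 =
        (y'.1 - XG.1) * v.2 - (y'.2 - XG.2) * v.1 := by
      intro v
      have e1 := hH' ((A (spatial v)).1, (A (spatial v)).2.1)
      have e2 := hL v
      have e3 := harea y' v
      have e4 := hG' v
      simp only [areaForm] at e2 e3
      rw [hsplit]
      simp only [Prod.fst_add, Prod.snd_add]
      linarith
    constructor
    · intro hy'
      have hinj : Function.Injective (fun v : ℝ × ℝ => ((A (spatial v)).1, (A (spatial v)).2.1)) := by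
        intro u v huv
        simp only [Prod.mk.injEq] at huv
        have h1 : A (spatial u) = A (spatial v) := Prod.ext huv.1 (Prod.ext huv.2 (by
          rw [h.time_deriv _ hy, h.time_deriv _ hy]; rfl))
        have h2 := h.injective_deriv hy h1
        simp only [spatial_apply, Prod.mk.injEq] at h2
        exact Prod.ext h2.1 h2.2.1
      let B : ℝ × ℝ →ₗ[ℝ] ℝ × ℝ := (((ContinuousLinearMap.fst ℝ ℝ (ℝ × ℝ)).comp
        (A.comp spatial)).prod (((ContinuousLinearMap.fst ℝ ℝ ℝ).comp
          (ContinuousLinearMap.snd ℝ ℝ (ℝ × ℝ))).comp (A.comp spatial))).toLinearMap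
      have hsurj : Function.Surjective B := LinearMap.injective_iff_surjective.1 hinj
      obtain ⟨v, hv⟩ := hsurj (1, 0)
      obtain ⟨u, hu⟩ := hsurj (0, 1)
      have hv1 : (A (spatial v)).1 = 1 := congrArg Prod.fst hv
      have hv2 : (A (spatial v)).2.1 = 0 := congrArg Prod.snd hv
      have hu1 : (A (spatial u)).1 = 0 := congrArg Prod.fst hu
      have hu2 : (A (spatial u)).2.1 = 1 := congrArg Prod.snd hu
      have k1 := key v
      have k2 := key u
      rw [hy', hv1, hv2] at k1
      rw [hy', hu1, hu2] at k2
      rw [hy']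
      exact Prod.ext (by simp only; linarith) (by simp only; linarith)
    · intro hy'
      have h1 : (A (y'.1, y'.2, 1)).1 = XH.1 := congrArg Prod.fst hy'
      have h2 : (A (y'.1, y'.2, 1)).2.1 = XH.2 := congrArg Prod.snd hy'
      simp only [h1, h2, sub_self, zero_mul] at key
      have k1 := key (1, 0)
      have k2 := key (0, 1)
      exact Prod.ext (by simp only at k1 k2; linarith) (by simp only at k1 k2; linarith)
  have hcurve : ∀ (t : ℝ) (y : ℝ → ℝ × ℝ) (y' : ℝ × ℝ), b < (y t).1 → HasDerivAt y y' t →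
      HasDerivAt (fun t => φ ((y t).1, (y t).2, t)) (J ((y t).1, (y t).2, t) (y'.1, y'.2, 1)) t := by
    intro t y y' hy hy'
    have h1 : HasDerivAt (fun t => ((y t).1, (y t).2, t)) (y'.1, y'.2, 1) t :=
      hy'.fst.prodMk (hy'.snd.prodMk (hasDerivAt_id t))
    exact HasFDerivAt.comp_hasDerivAt (l := φ) t (h.deriv _ hy) h1
  have hproj : ∀ (f : ℝ → ℝ × ℝ × ℝ) (f' : ℝ × ℝ × ℝ) (t : ℝ), HasDerivAt f f' t →
      HasDerivAt (fun t => ((f t).1, (f t).2.1)) (f'.1, f'.2.1) t := fun f f' t hf =>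
    hf.fst.prodMk hf.snd.fst
  refine ⟨fun t y hy => ?_, fun α β y hy => ⟨fun hsol t ht => ?_, fun hsol t ht => ?_⟩⟩
  · obtain ⟨LH, LG, -, hLG, -⟩ := hdG t y hy
    exact hLG.differentiableAt.differentiableWithinAt
  · have h1 := hcurve t y _ (hy t ht) (hsol t ht)
    have h2 := hproj _ _ _ h1
    refine h2.congr_deriv ?_
    exact (hpoint t (y t) _ (hy t ht)).1 rfl
  -- Here only the image curve is known to be differentiable; differentiability of `y` comes from
  -- the local inverse of `φ`.
  · have hev : ∀ᶠ u in 𝓝 t, u ∈ Ioo α β := Ioo_mem_nhds ht.1 ht.2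
    have hb : ∀ᶠ u in 𝓝 t, b < (((y u).1, (y u).2, u) : ℝ × ℝ × ℝ).1 := by
      filter_upwards [hev] with u hu using hy u hu
    have hz := hsol t ht
    have hd : DifferentiableAt ℝ (fun u => φ ((y u).1, (y u).2, u)) t := by
      have h1 : DifferentiableAt ℝ (fun u => ((φ ((y u).1, (y u).2, u)).1,
          ((φ ((y u).1, (y u).2, u)).2.1, u))) t :=
        hz.differentiableAt.fst.prodMk (hz.differentiableAt.snd.prodMk differentiableAt_id)
      refine h1.congr_of_eventuallyEq ?_
      filter_upwards [hb] with u hu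
      exact Prod.ext rfl (Prod.ext rfl (h.time _ hu))
    have hx := (h.differentiableAt_curve hb hd).hasDerivAt
    have hy' := hproj _ _ _ hx
    simp only [Prod.mk.eta] at hy'
    refine hy'.congr_deriv ?_
    refine (hpoint t (y t) _ (hy t ht)).2 ?_
    have h1 := hcurve t y _ (hy t ht) hy'
    have h2 := hproj _ _ _ h1
    exact h2.unique hz

theorem isSymplecticChange (h : IsAreaMap a b φ J) {n : ℕ} {T : ℝ}
    (hangle : ∀ K κ t, b < K → φ (K, κ + 4 * tau n, t) = φ (K, κ, t) + (0, 4 * tau n, 0))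
    (hper : ∀ K κ t, b < K → φ (K, κ, t + T) = φ (K, κ, t) + (0, 0, T))
    (hsurj : ∃ c : ℝ, ∀ t, {z : ℝ × ℝ | c < z.1} ⊆
      (fun z : ℝ × ℝ => ((φ (z.1, z.2, t)).1, (φ (z.1, z.2, t)).2.1)) '' {z | b < z.1}) :
    IsSymplecticChange n T a b fun K κ t => ((φ (K, κ, t)).1, (φ (K, κ, t)).2.1) where
  maps K κ t hK := h.maps _ hK
  contDiff := contDiff_fst.comp_contDiffOn h.contDiffOn |>.prodMk
    (contDiff_fst.comp_contDiffOn (contDiff_snd.comp_contDiffOn h.contDiffOn))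
  angle K κ t hK := by simp [hangle K κ t hK]
  periodic_time K κ t hK := by simp [hper K κ t hK]
  symplectic K κ t hK u v := by
    have hι : HasFDerivAt (fun y : ℝ × ℝ => (y.1, y.2, t)) spatial (K, κ) :=
      hasFDerivAt_fst.prodMk (hasFDerivAt_snd.prodMk (hasFDerivAt_const _ _))
    have h1 : HasFDerivAt (fun y : ℝ × ℝ => φ (y.1, y.2, t)) ((J (K, κ, t)).comp spatial) (K, κ) :=
      HasFDerivAt.comp (g := φ) (K, κ) (h.deriv (K, κ, t) hK) hι
    have h2 : HasFDerivAt (fun y : ℝ × ℝ => ((φ (y.1, y.2, t)).1, (φ (y.1, y.2, t)).2.1)) _ (K, κ) :=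
      h1.fst.prodMk h1.snd.fst
    simp only [h2.fderiv]
    exact h.area (K, κ, t) hK u v
  injective t z hz z' hz' heq := by
    simp only [Prod.mk.injEq] at heq
    have := h.injective (z.1, z.2, t) (z'.1, z'.2, t) hz hz' (Prod.ext heq.1 (Prod.ext heq.2 (by
      rw [h.time (z.1, z.2, t) hz, h.time (z'.1, z'.2, t) hz'])))
    simp only [Prod.mk.injEq] at this
    exact Prod.ext this.1 this.2.1
  surjective := hsurj

end IsAreaMap

end

/-! ### The Lie flow as a change of variables -/

/-- The transformation `X_ε`, with the time as a third component. -/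
def lieMap (X : ℝ → ℝ → ℝ → ℝ → ℝ × ℝ) (ε : ℝ) (z : ℝ × ℝ × ℝ) : ℝ × ℝ × ℝ :=
  ((X ε z.1 z.2.1 z.2.2).1, (X ε z.1 z.2.1 z.2.2).2, z.2.2)

section

variable {n : ℕ} {s : Finset ℕ} {w : ℕ → ℝ → ℝ → ℝ} {ϖ T a b : ℝ}
  {X : ℝ → ℝ → ℝ → ℝ → ℝ × ℝ} {W₃ m₁₁ m₁₂ m₂₂ m₁₃ m₂₃ : ℝ → ℝ × ℝ × ℝ → ℝ}

theorem isSmoothFlow_lieMap (hs : ∀ r ∈ s, 1 ≤ r) (hw : ∀ r, w r ∈ Sep ϖ T 1)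
    (hX : IsLieFlow s (genTerm n w) a b X) (ha : 0 ≤ a)
    (hlip : ∀ z : ℝ × ℝ × ℝ, b < z.1 → ∃ L, ∀ᶠ z' : ℝ × ℝ × ℝ in 𝓝 z, ∀ ε ∈ Icc (0 : ℝ) 1,
      ‖X ε z'.1 z'.2.1 z'.2.2 - X ε z.1 z.2.1 z.2.2‖ ≤ L * ‖z' - z‖)
    (hjet : IsHamJet {z | 0 < z.1} (genPlain n s fun r => angleDeriv (w r)) (genAction n s w)
      W₃ m₁₁ m₁₂ m₂₂ m₁₃ m₂₃) :
    IsSmoothFlow (fun ε z => (genPlain n s (fun r => angleDeriv (w r)) ε z, -genAction n s w ε z,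
      (0 : ℝ))) (jetMap m₁₁ m₁₂ m₂₂ m₁₃ m₂₃) {z | 0 < z.1} {z | b < z.1} (lieMap X) := by
  refine hjet.isSmoothFlow (isOpen_lt continuous_const continuous_fst)
    (isOpen_lt continuous_const continuous_fst) (fun z hz => ?_) (fun ε hε z hz => ?_)
    (fun z hz ε hε => ?_) fun z hz => ?_
  · simp [lieMap, hX.init z.1 z.2.1 z.2.2 (le_of_lt hz)]
  · exact ha.trans_lt (hX.domain ε hε z.1 z.2.1 z.2.2 (le_of_lt hz))
  · have h1 := hX.ode ε hε z.1 z.2.1 z.2.2 (le_of_lt hz)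
    have hpos : 0 < (X ε z.1 z.2.1 z.2.2).1 :=
      ha.trans_lt (hX.domain ε hε z.1 z.2.1 z.2.2 (le_of_lt hz))
    have h2 := hamField_eq_gen (n := n) hs hw ε z.2.2 hpos (X ε z.1 z.2.1 z.2.2).2
    rw [Prod.mk.eta] at h2
    rw [h2] at h1
    exact h1.fst.prodMk (h1.snd.prodMk (hasDerivWithinAt_const ε _ z.2.2))
  · obtain ⟨L, hL⟩ := hlip z hz
    refine ⟨max L 1, ?_⟩
    filter_upwards [hL] with z' hz' ε hε
    have h1 := hz' ε hε
    have h2 : L * ‖z' - z‖ ≤ max L 1 * ‖z' - z‖ := by gcongr; exact le_max_left _ _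
    have h3 : ‖z' - z‖ ≤ max L 1 * ‖z' - z‖ :=
      le_mul_of_one_le_left (norm_nonneg _) (le_max_right _ _)
    have h4 := norm_fst_le (X ε z'.1 z'.2.1 z'.2.2 - X ε z.1 z.2.1 z.2.2)
    have h5 := norm_snd_le (X ε z'.1 z'.2.1 z'.2.2 - X ε z.1 z.2.1 z.2.2)
    refine max_le (h4.trans (h1.trans h2)) (max_le (h5.trans (h1.trans h2)) ?_)
    exact ((norm_snd_le (z' - z).2).trans (norm_snd_le (z' - z))).trans h3

/-- Besides the area map, this identifies the pairing of its time derivative with spatial vectors: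
any `D` that integrates the spatial derivatives of `∂W/∂t` along the flow has the same
`ε`-derivative and the same initial value `0` as that pairing. -/
theorem exists_isAreaMap (hs : ∀ r ∈ s, 1 ≤ r) (hw : ∀ r, w r ∈ Sep ϖ T 1)
    (hX : IsLieFlow s (genTerm n w) a b X) (ha : 0 ≤ a)
    (hlip : ∀ z : ℝ × ℝ × ℝ, b < z.1 → ∃ L, ∀ᶠ z' : ℝ × ℝ × ℝ in 𝓝 z, ∀ ε ∈ Icc (0 : ℝ) 1,
      ‖X ε z'.1 z'.2.1 z'.2.2 - X ε z.1 z.2.1 z.2.2‖ ≤ L * ‖z' - z‖)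
    (hinj : ∀ K κ K' κ' t, b < K → b < K' → X 1 K κ t = X 1 K' κ' t → K = K' ∧ κ = κ') :
    ∃ J : ℝ × ℝ × ℝ → ℝ × ℝ × ℝ →L[ℝ] ℝ × ℝ × ℝ, IsAreaMap a b (lieMap X 1) J ∧
      ∀ z : ℝ × ℝ × ℝ, b < z.1 → ∀ D D' : ℝ → ℝ × ℝ →L[ℝ] ℝ, D 0 = 0 →
        (∀ ε ∈ Icc (0 : ℝ) 1, HasDerivWithinAt D (D' ε) (Icc 0 1) ε) →
        (∀ ε ∈ Icc (0 : ℝ) 1, HasFDerivAt (fun y : ℝ × ℝ =>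
          genPlain n s (fun r => timeDeriv (w r)) ε (lieMap X ε (y.1, y.2, z.2.2))) (D' ε)
          (z.1, z.2.1)) →
        ∀ v, D 1 v = areaForm (J z (0, 0, 1)) (J z (spatial v)) := by
  have h01 : (1 : ℝ) ∈ Icc (0 : ℝ) 1 := right_mem_Icc.2 zero_le_one
  have hjet := isHamJet_gen (n := n) (s := s) hw (U := {z | 0 < z.1}) fun z hz => hz
  have hflow := isSmoothFlow_lieMap hs hw hX ha hlip hjet
  obtain ⟨J, hJ0, hJ, hJv, hJc⟩ := hflow.exists_derivative
  have hvar : ∀ z : ℝ × ℝ × ℝ, b < z.1 → IsVariation _ _ _ _ _ (fun ε => lieMap X ε z)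
      (fun ε => J ε z) := fun z hz => ⟨hJ0 z hz, hJv z hz⟩
  refine ⟨J 1, ⟨fun z hz => hJ z hz 1 h01, hJc 1 h01, fun z _ => rfl,
    fun z hz x => (hvar z hz).time_eq x h01, fun z hz u v => (hvar z hz).areaForm_spatial u v h01,
    fun z z' hz hz' h => ?_, fun z hz => hX.domain 1 h01 _ _ _ (le_of_lt hz)⟩, ?_⟩
  · simp only [lieMap, Prod.mk.injEq] at h
    have := hinj z.1 z.2.1 z'.1 z'.2.1 z.2.2 hz hz' (Prod.ext (by rw [h.1, h.2.2])
      (by rw [h.2.1, h.2.2]))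
    exact Prod.ext this.1 (Prod.ext this.2 h.2.2)
  · intro z hz D D' hD0 hD hW v
    refine eqOn_of_hasDerivWithinAt_eq (f := fun ε => D ε v)
      (g := fun ε => areaForm (J ε z (0, 0, 1)) (J ε z (spatial v))) (f' := fun ε => D' ε v)
      (fun ε hε => ?_) (fun ε hε => ?_) ?_ h01
    · simpa using (hD ε hε).clm_apply (hasDerivWithinAt_const ε (Icc 0 1) v)
    · refine ((hvar z hz).areaForm (0, 0, 1) (spatial v) hε).congr_deriv ?_
      have h1 := hjet.hasFDerivAt_time (Z := {z | b < z.1}) (φ := lieMap X)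
        (isOpen_lt continuous_const continuous_fst) hε hz (hflow.maps ε hε z hz)
        (fun _ _ => rfl) (hJ z hz ε hε)
      rw [(hW ε hε).unique h1]
      simp
    · simp [hD0, hJ0 z hz, areaForm]

end

/-! ### Derivatives of the expansions -/

section

variable {n c : ℕ} {P R : ℝ} {F : ℕ → ℝ → ℝ → ℝ}

theorem hasDerivAt_egf (hF : GrowthBound c P R F) (hP : 0 ≤ P) (hR : 0 ≤ R) {μ : ℝ}
    (hμ : |μ| * R < 1 / 4) (κ t : ℝ) :
    HasDerivAt (egf fun j => F j κ t) (egf (fun j => F (j + 1) κ t) μ) μ := by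
  have h := HasFDerivAt.comp_hasDerivAt (f := fun x => (x, κ)) μ
    (hasFDerivAt_egf (κ := κ) hF hP hR hμ t) ((hasDerivAt_id μ).prodMk (hasDerivAt_const μ κ))
  refine HasDerivAt.congr_deriv h ?_
  simp

theorem hasFDerivAt_kpow_egf (hF : GrowthBound c P R F) (hP : 0 ≤ P) (hR : 0 ≤ R) {ε K : ℝ}
    (hK : 0 < K) (hμ : |ε * kpow n (-1) K| * R < 1 / 4) (σ : ℤ) (κ t : ℝ) :
    HasFDerivAt (fun y : ℝ × ℝ => kpow n σ y.1 * egf (fun j => F j y.2 t) (ε * kpow n (-1) y.1))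
      (((σ : ℝ) / ((n : ℝ) + 1) * kpow n (σ - (n + 1)) K *
          egf (fun j => F j κ t) (ε * kpow n (-1) K) -
        ε / ((n : ℝ) + 1) * kpow n (σ - 1 - (n + 1)) K *
          egf (fun j => F (j + 1) κ t) (ε * kpow n (-1) K)) • ContinuousLinearMap.fst ℝ ℝ ℝ +
        (kpow n σ K * egf (fun j => angleDeriv (F j) κ t) (ε * kpow n (-1) K)) •
          ContinuousLinearMap.snd ℝ ℝ ℝ) (K, κ) := by
  have h1 : ∀ τ : ℤ, HasFDerivAt (fun y : ℝ × ℝ => kpow n τ y.1)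
      (((τ : ℝ) / ((n : ℝ) + 1) * kpow n (τ - (n + 1)) K) • ContinuousLinearMap.fst ℝ ℝ ℝ)
      (K, κ) := fun τ => HasDerivAt.comp_hasFDerivAt (h₂ := kpow n τ) (f := Prod.fst) (K, κ)
      (hasDerivAt_kpow hK τ) hasFDerivAt_fst
  have h2 : HasFDerivAt (fun y : ℝ × ℝ => (ε * kpow n (-1) y.1, y.2))
      ((ε • ((((-1 : ℤ) : ℝ) / ((n : ℝ) + 1) * kpow n (-1 - (n + 1)) K) •
        ContinuousLinearMap.fst ℝ ℝ ℝ)).prod (ContinuousLinearMap.snd ℝ ℝ ℝ)) (K, κ) :=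
    ((h1 (-1)).const_mul ε).prodMk hasFDerivAt_snd
  have h3 := HasFDerivAt.comp (g := fun z : ℝ × ℝ => egf (fun j => F j z.2 t) z.1) (K, κ)
    (hasFDerivAt_egf (κ := κ) hF hP hR hμ t) h2
  refine ((h1 σ).mul h3).congr_fderiv ?_
  have e : kpow n (σ - 1 - (n + 1)) K = kpow n σ K * kpow n (-1 - (n + 1)) K := by
    rw [← kpow_add hK]
    congr 1
    ring
  refine ContinuousLinearMap.ext fun x => ?_
  simp only [add_apply, smul_apply, smul_eq_mul, ContinuousLinearMap.comp_apply,
    ContinuousLinearMap.prod_apply, ContinuousLinearMap.coe_fst', ContinuousLinearMap.coe_snd',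
    Function.comp_apply, e]
  push_cast
  ring

/-- The sequence shifted by one, starting with zero. -/
def delay (F : ℕ → ℝ → ℝ → ℝ) : ℕ → ℝ → ℝ → ℝ
  | 0 => 0
  | j + 1 => F j

theorem GrowthBound.delay (hF : GrowthBound 0 P R F) (hP : 0 ≤ P) (hR : 1 ≤ R) :
    GrowthBound 0 P R (delay F) := by
  refine ⟨fun j t => ?_, fun j k κ t => ?_⟩
  · rcases j with _ | j
    · exact contDiff_const (c := (0 : ℝ))
    · exact hF.smooth j t
  · rcases j with _ | j
    · have : (fun x => LieOscillator.delay F 0 x t) = fun _ => (0 : ℝ) := rfl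
      rw [this, iteratedDeriv_const]
      simp
      positivity
    · refine (hF.bound j k κ t).trans ?_
      have h1 : (0 + j + k).factorial ≤ (0 + (j + 1) + k).factorial :=
        Nat.factorial_le (by omega)
      have h2 : R ^ (j + k) ≤ R ^ (j + 1 + k) := pow_le_pow_right₀ hR (by omega)
      gcongr

/-- The primitive, in `ε`, of the derivative of an expansion. -/
theorem hasDerivAt_fderiv_delay (hF : GrowthBound 0 P R F) (hP : 0 ≤ P) (hR : 1 ≤ R) {ε K : ℝ}
    (hK : 0 < K) (hμ : |ε * kpow n (-1) K| * R < 1 / 4) (σ : ℤ) (κ t : ℝ) :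
    HasDerivAt (fun ε : ℝ => (((σ + 1 : ℤ) : ℝ) / ((n : ℝ) + 1) * kpow n (σ + 1 - (n + 1)) K *
          egf (fun j => delay F j κ t) (ε * kpow n (-1) K) -
        ε / ((n : ℝ) + 1) * kpow n (σ + 1 - 1 - (n + 1)) K *
          egf (fun j => delay F (j + 1) κ t) (ε * kpow n (-1) K)) •
            ContinuousLinearMap.fst ℝ ℝ ℝ +
        (kpow n (σ + 1) K * egf (fun j => angleDeriv (delay F j) κ t) (ε * kpow n (-1) K)) •
          ContinuousLinearMap.snd ℝ ℝ ℝ)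
      (((σ : ℝ) / ((n : ℝ) + 1) * kpow n (σ - (n + 1)) K *
          egf (fun j => F j κ t) (ε * kpow n (-1) K) -
        ε / ((n : ℝ) + 1) * kpow n (σ - 1 - (n + 1)) K *
          egf (fun j => F (j + 1) κ t) (ε * kpow n (-1) K)) • ContinuousLinearMap.fst ℝ ℝ ℝ +
        (kpow n σ K * egf (fun j => angleDeriv (F j) κ t) (ε * kpow n (-1) K)) •
          ContinuousLinearMap.snd ℝ ℝ ℝ) ε := by
  have hR0 : 0 ≤ R := by linarith
  have hlin : HasDerivAt (fun ε : ℝ => ε * kpow n (-1) K) (kpow n (-1) K) ε := by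
    simpa using (hasDerivAt_id ε).mul_const (kpow n (-1) K)
  have hd := hF.delay hP hR
  have h1 : HasDerivAt (fun ε : ℝ => egf (fun j => delay F j κ t) (ε * kpow n (-1) K))
      (egf (fun j => F j κ t) (ε * kpow n (-1) K) * kpow n (-1) K) ε :=
    HasDerivAt.comp (h₂ := egf fun j => delay F j κ t) (h := fun ε => ε * kpow n (-1) K) ε
      (hasDerivAt_egf hd hP hR0 hμ κ t) hlin
  have h2 : HasDerivAt (fun ε : ℝ => egf (fun j => F j κ t) (ε * kpow n (-1) K))
      (egf (fun j => F (j + 1) κ t) (ε * kpow n (-1) K) * kpow n (-1) K) ε :=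
    HasDerivAt.comp (h₂ := egf fun j => F j κ t) (h := fun ε => ε * kpow n (-1) K) ε
      (hasDerivAt_egf hF hP hR0 hμ κ t) hlin
  have h3 : HasDerivAt (fun ε : ℝ => egf (fun j => angleDeriv (delay F j) κ t) (ε * kpow n (-1) K))
      (egf (fun j => angleDeriv (F j) κ t) (ε * kpow n (-1) K) * kpow n (-1) K) ε :=
    HasDerivAt.comp (h₂ := egf fun j => angleDeriv (delay F j) κ t)
      (h := fun ε => ε * kpow n (-1) K) ε
      (hasDerivAt_egf hd.angleDeriv (mul_nonneg hP hR0) hR0 hμ κ t) hlin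
  have k1 := ((h1.const_mul (((σ + 1 : ℤ) : ℝ) / ((n : ℝ) + 1) * kpow n (σ + 1 - (n + 1)) K)).sub
    ((((hasDerivAt_id ε).div_const ((n : ℝ) + 1)).mul_const
      (kpow n (σ + 1 - 1 - (n + 1)) K)).mul h2)).smul_const (ContinuousLinearMap.fst ℝ ℝ ℝ)
  have k2 := (h3.const_mul (kpow n (σ + 1) K)).smul_const (ContinuousLinearMap.snd ℝ ℝ ℝ)
  refine HasDerivAt.congr_deriv (k1.add k2) ?_
  have e1 : kpow n (σ + 1 - (n + 1)) K * kpow n (-1) K = kpow n (σ - (n + 1)) K := by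
    rw [← kpow_add hK]; congr 1; ring
  have e2 : kpow n (σ + 1) K * kpow n (-1) K = kpow n σ K := by
    rw [← kpow_add hK]; congr 1; ring
  have e3 : kpow n (σ + 1 - 1 - (n + 1)) K * kpow n (-1) K = kpow n (σ - 1 - (n + 1)) K := by
    rw [← kpow_add hK]; congr 1; ring
  have e4 : kpow n (σ + 1 - 1 - (n + 1)) K = kpow n (σ - (n + 1)) K := by congr 1; ring
  congr 2
  · rw [← e3, e4, ← e1]
    simp only [id]
    push_cast
    field_simp
    ring
  · rw [← e2]
    ring

end

/-! ### The coefficients of the new Hamiltonian -/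

section

variable {n : ℕ} {w h g : ℕ → ℝ → ℝ → ℝ} {ϖ T : ℝ}

theorem exists_growthBound {u : ℕ → ℝ → ℝ → ℝ} {e N : ℕ} (hT : 0 < T)
    (hu : ∀ l, u l ∈ Sep ϖ T e) (h0 : ∀ l, N ≤ l → u l = 0) :
    ∃ M R : ℝ, 0 ≤ M ∧ 1 ≤ R ∧ GrowthBound 0 M R u := by
  obtain ⟨C, R, hC, hR, hb⟩ := exists_common_bound hT hu h0
  refine ⟨C, R, hC, hR, fun l t => Sep.contDiff_angle (hu l) t, fun l k κ t =>
    (hb l k κ t).trans ?_⟩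
  have h1 : k.factorial ≤ (0 + l + k).factorial := Nat.factorial_le (by omega)
  have h2 : R ^ k ≤ R ^ (l + k) := pow_le_pow_right₀ hR (by omega)
  gcongr

theorem GrowthBound.mono {c : ℕ} {P R P' R' : ℝ} {F : ℕ → ℝ → ℝ → ℝ} (hF : GrowthBound c P R F)
    (hP0 : 0 ≤ P) (hR0 : 0 ≤ R) (hP : P ≤ P') (hR : R ≤ R') : GrowthBound c P' R' F :=
  ⟨hF.smooth, fun j k κ t => (hF.bound j k κ t).trans (by have := hP0.trans hP; gcongr)⟩

/-- The constant that governs the growth of the diagonal of the Lie triangle. -/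
noncomputable def growthRate (σ : ℤ) (C R : ℝ) : ℝ := R + 4 * C * (|(σ : ℝ)| + 1) + 4 * C * R

theorem le_growthRate {σ : ℤ} {C R : ℝ} (hC : 0 ≤ C) (hR : 0 ≤ R) : R ≤ growthRate σ C R := by
  have : 0 ≤ 4 * C * (|(σ : ℝ)| + 1) := by positivity
  have : 0 ≤ 4 * C * R := by positivity
  unfold growthRate
  linarith

/-- The diagonal of the Lie triangle, at the level of coefficients. -/
noncomputable def column (n : ℕ) (σ : ℤ) (w h : ℕ → ℝ → ℝ → ℝ) : ℕ → ℝ → ℝ → ℝ :=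
  fun i => coefTriangle n σ w h i 0

theorem GrowthBound.column {σ : ℤ} {M R C R₀ : ℝ} (hw : GeneratorBound n w C R₀)
    (hR : 2 * R₀ ≤ R) (hM : 0 ≤ M) (hh : GrowthBound 0 M R h) :
    GrowthBound 0 M (growthRate σ C R) (column n σ w h) := by
  have hR1 := hw.one_le
  have hC := hw.nonneg
  have hR0 : 0 ≤ R := by linarith
  have hL := le_growthRate (σ := σ) hC hR0
  have hb := fun i => GrowthBound.coefTriangle (s := (σ : ℝ)) hw hR hM hh i
  refine ⟨fun i t => (hb i).smooth 0 t, fun i k κ t => ((hb i).bound 0 k κ t).trans ?_⟩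
  change M * growthRate σ C R ^ i * (i + 0 + k).factorial * R ^ (0 + k) ≤ _
  have h1 : R ^ (0 + k) ≤ growthRate σ C R ^ k := by
    rw [zero_add]; gcongr
  have h0 : 0 ≤ growthRate σ C R := hR0.trans hL
  calc M * growthRate σ C R ^ i * (i + 0 + k).factorial * R ^ (0 + k)
      ≤ M * growthRate σ C R ^ i * (i + 0 + k).factorial * growthRate σ C R ^ k := by gcongr
    _ = _ := by rw [pow_add, zero_add, add_zero]; ring

/-- The coefficient of `K ^ ((2 n - k) / (n + 1))` in the new Hamiltonian. -/
noncomputable def newCoef (n : ℕ) (w h g : ℕ → ℝ → ℝ → ℝ) (k : ℕ) : ℝ → ℝ → ℝ := fun κ t =>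
  1 / (k.factorial : ℝ) * column n (2 * (n : ℤ)) w h k κ t +
    if n ≤ k then 1 / ((k - n + 1).factorial : ℝ) * column n n w g (k - n) κ t else 0

theorem column_mem {e : ℕ} {σ : ℤ} (hw : ∀ r, w r ∈ Sep ϖ T e) {i : ℕ}
    (hh : ∀ l ≤ i, h l ∈ Sep ϖ T e) : column n σ w h i ∈ Sep ϖ T e :=
  coefTriangle_mem hw i 0 hh

theorem newCoef_mem {e : ℕ} (hw : ∀ r, w r ∈ Sep ϖ T e) (hg : ∀ l, g l ∈ Sep ϖ T e) {k : ℕ}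
    (hh : ∀ l ≤ k, h l ∈ Sep ϖ T e) : newCoef n w h g k ∈ Sep ϖ T e := by
  have h1 : newCoef n w h g k = (1 / (k.factorial : ℝ)) • column n (2 * (n : ℤ)) w h k +
      if n ≤ k then (1 / ((k - n + 1).factorial : ℝ)) • column n n w g (k - n) else 0 := by
    funext κ t
    split_ifs with hk <;> simp [newCoef, hk]
  rw [h1]
  refine Submodule.add_mem _ (Submodule.smul_mem _ _ (column_mem hw hh)) ?_
  split_ifs
  · exact Submodule.smul_mem _ _ (column_mem hw fun l _ => hg l)
  · exact Submodule.zero_mem _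

theorem newCoef_zero (hn : 1 ≤ n) : newCoef n w h g 0 = h 0 := by
  funext κ t
  simp [newCoef, column, coefTriangle, show ¬ n ≤ 0 by omega]

/-- Keeps factorial growth when the remainder coefficient of index `k - n`, with its `1/(k-n+1)!`,
is renumbered by the degree index `k`. -/
theorem factorial_mul_factorial_le {n k l : ℕ} (hk : n ≤ k) :
    k.factorial * (k - n + l).factorial ≤ (k + l).factorial * (k - n + 1).factorial := by
  have h1 := Nat.factorial_mul_descFactorial hk
  have h2 := Nat.factorial_mul_descFactorial (show n ≤ k + l by omega)
  have h3 : k.descFactorial n ≤ (k + l).descFactorial n := Nat.descFactorial_le n (by omega)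
  have h4 : (k - n).factorial ≤ (k - n + 1).factorial := Nat.factorial_le (by omega)
  rw [show k + l - n = k - n + l by omega] at h2
  calc k.factorial * (k - n + l).factorial
      = (k - n).factorial * k.descFactorial n * (k - n + l).factorial := by rw [h1]
    _ ≤ (k - n + 1).factorial * (k + l).descFactorial n * (k - n + l).factorial := by gcongr
    _ = _ := by rw [← h2]; ring

/-- The functions `k! newCoef k` are the row coefficients of the new Hamiltonian, so this bound is
the input for the next reduction step. -/
theorem growthBound_newCoef {M L : ℝ} (hM : 0 ≤ M) (hL : 1 ≤ L)
    (hh : GrowthBound 0 M L (column n (2 * (n : ℤ)) w h)) (hg : GrowthBound 0 M L (column n n w g)) :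
    GrowthBound 0 (M + M) L fun k κ t => (k.factorial : ℝ) * newCoef n w h g k κ t := by
  have hG : GrowthBound 0 M L fun k κ t => if n ≤ k then
      (k.factorial : ℝ) * (1 / ((k - n + 1).factorial : ℝ)) * column n n w g (k - n) κ t else 0 := by
    refine ⟨fun k t => ?_, fun k l κ t => ?_⟩
    · split_ifs
      · exact contDiff_const.mul (hg.smooth _ t)
      · exact contDiff_const
    · split_ifs with hk
      · rw [iteratedDeriv_const_mul_field, abs_mul, abs_of_nonneg (by positivity)]
        have h1 := hg.bound (k - n) l κ t
        have h2 : (k.factorial : ℝ) * (k - n + l).factorial ≤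
            (k + l).factorial * (k - n + 1).factorial := by
          exact_mod_cast factorial_mul_factorial_le hk
        have h3 : (0 : ℝ) < (k - n + 1).factorial := by positivity
        have h4 : L ^ (k - n + l) ≤ L ^ (k + l) := pow_le_pow_right₀ hL (by omega)
        rw [zero_add] at h1 ⊢
        calc (k.factorial : ℝ) * (1 / ((k - n + 1).factorial : ℝ)) *
              |iteratedDeriv l (fun x => column n n w g (k - n) x t) κ|
            ≤ (k.factorial : ℝ) * (1 / ((k - n + 1).factorial : ℝ)) *
              (M * (k - n + l).factorial * L ^ (k + l)) := by
              gcongr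
              exact h1.trans (by gcongr)
          _ = M * (((k.factorial : ℝ) * (k - n + l).factorial) / (k - n + 1).factorial) *
              L ^ (k + l) := by ring
          _ ≤ M * (k + l).factorial * L ^ (k + l) := by
              gcongr
              rw [div_le_iff₀ h3]
              exact h2
      · rw [iteratedDeriv_const]
        have : (0 : ℝ) ≤ L := by linarith
        split_ifs <;> simp <;> positivity
  have hsum : (fun k κ t => (k.factorial : ℝ) * newCoef n w h g k κ t) = fun k κ t =>
      column n (2 * (n : ℤ)) w h k κ t + if n ≤ k then
      (k.factorial : ℝ) * (1 / ((k - n + 1).factorial : ℝ)) * column n n w g (k - n) κ t else 0 := by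
    funext k κ t
    have h1 : (k.factorial : ℝ) ≠ 0 := by positivity
    simp only [newCoef]
    split_ifs
    · field_simp
    · field_simp
      ring
  rw [hsum]
  exact hh.add hG

/-- If `W` starts at `r₀`, the remainder starts at index `r₀ - 1` and cannot disturb the higher
degrees, which have just been freed from `κ`. -/
theorem column_normalized {r₀ r₁ : ℕ} (hw : ∀ r, r ∉ Finset.Icc r₀ r₁ → w r = 0) {i : ℕ}
    (hi : i + 1 < r₀) (hg : ∀ j, w (j + 1) = 0 → g j = 0) (σ : ℤ) : column n σ w g i = 0 :=
  coefTriangle_eq_zero (N := i) (fun l hl => hg l (hw (l + 1) (by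
    simp only [Finset.mem_Icc]; omega))) i 0 le_rfl

/-! ### The Hamiltonian in normal form -/

/-- The integers `j ≤ m`, enumerated downwards. -/
def iicEquiv (m : ℤ) : ℕ ≃ Set.Iic m where
  toFun i := ⟨m - i, by simp⟩
  invFun j := (m - j).toNat
  left_inv i := by simp
  right_inv j := by
    have := j.2
    simp only [mem_Iic] at this
    ext
    simp only
    omega

variable {c : ℕ → ℝ → ℝ → ℝ} {m : ℤ} {r₁ : ℕ}

/-- The coefficients `fbar_j` in terms of the sequence of all coefficients. -/
def barCoef (n : ℕ) (c : ℕ → ℝ → ℝ → ℝ) (j : ℤ) (t : ℝ) : ℝ := c (2 * (n : ℤ) - j).toNat 0 t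

/-- The coefficients `f_j` in terms of the sequence of all coefficients. -/
def lowCoef (n : ℕ) (c : ℕ → ℝ → ℝ → ℝ) (j : ℤ) : ℝ → ℝ → ℝ := c (2 * (n : ℤ) - j).toNat

/-- Enumeration of the degrees from `2n` downwards. The relation `r₁ + 1 = 2n - m` says that the
indices `1, …, r₁` are exactly the degrees above `m`. -/
theorem normalHam_eq (h0 : c 0 = fun _ _ => ((n : ℝ) + 1) / (2 * n))
    (hm : (r₁ : ℤ) + 1 = 2 * n - m) (hc : ∀ i, 1 ≤ i → i ≤ r₁ → ∀ κ t, c i κ t = c i 0 t)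
    {K κ t S : ℝ} (hS : HasSum (fun k : ℕ => kpow n (2 * (n : ℤ) - k) K * c k κ t) S) :
    normalHam n m (barCoef n c) (lowCoef n c) K κ t = S := by
  have h1 := (hasSum_nat_add_iff' (r₁ + 1)).2 hS
  have h2 : ∑' j : Set.Iic m, kpow n (j : ℤ) K * lowCoef n c (j : ℤ) κ t =
      S - ∑ k ∈ Finset.range (r₁ + 1), kpow n (2 * (n : ℤ) - k) K * c k κ t := by
    rw [← (iicEquiv m).tsum_eq, ← h1.tsum_eq]
    refine tsum_congr fun i => ?_
    have e : (2 * (n : ℤ) - ((i + (r₁ + 1) : ℕ) : ℤ)) = m - i := by push_cast; omega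
    have e' : (2 * (n : ℤ) - (m - i)).toNat = i + (r₁ + 1) := by omega
    simp only [iicEquiv, Equiv.coe_fn_mk, lowCoef, e, e']
  have h3 : ∑ j ∈ Finset.Icc (m + 1) (2 * (n : ℤ) - 1), kpow n j K * barCoef n c j t =
      ∑ k ∈ Finset.range r₁, kpow n (2 * (n : ℤ) - ((k + 1 : ℕ) : ℤ)) K * c (k + 1) κ t := by
    refine Finset.sum_nbij' (fun j => (2 * (n : ℤ) - 1 - j).toNat)
      (fun k => 2 * (n : ℤ) - 1 - k) ?_ ?_ ?_ ?_ ?_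
    · intro j hj
      simp only [Finset.mem_Icc, Finset.mem_range] at hj ⊢
      omega
    · intro k hk
      simp only [Finset.mem_Icc, Finset.mem_range] at hk ⊢
      omega
    · intro j hj
      simp only [Finset.mem_Icc] at hj
      omega
    · intro k hk
      omega
    · intro j hj
      simp only [Finset.mem_Icc] at hj
      have e : (2 * (n : ℤ) - j).toNat = (2 * (n : ℤ) - 1 - j).toNat + 1 := by omega
      have e' : 2 * (n : ℤ) - (((2 * (n : ℤ) - 1 - j).toNat + 1 : ℕ) : ℤ) = j := by omega
      rw [e', barCoef, e, hc _ (by omega) (by omega) κ t]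
  rw [normalHam, h2, h3, Finset.sum_range_succ', leadTerm, h0]
  simp only [Nat.cast_zero, sub_zero]
  ring

theorem normalRows_eq (h0 : c 0 = fun _ _ => ((n : ℝ) + 1) / (2 * n))
    (hm : (r₁ : ℤ) + 1 = 2 * n - m) (hc : ∀ i, 1 ≤ i → i ≤ r₁ → ∀ κ t, c i κ t = c i 0 t)
    (i : ℕ) (K κ t : ℝ) : normalRows n m (barCoef n c) (lowCoef n c) i K κ t =
      kpow n (2 * (n : ℤ) - i) K * ((i.factorial : ℝ) * c i κ t) := by
  have e : (2 * (n : ℤ) - (2 * (n : ℤ) - i)).toNat = i := by omega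
  rcases Nat.eq_zero_or_pos i with rfl | hi
  · simp [normalRows, leadTerm, h0, mul_comm]
  · simp only [normalRows, barCoef, lowCoef, e, if_neg hi.ne']
    split_ifs with h
    · rw [hc i hi (by omega) κ t]
      ring
    · ring

theorem continuous_time {e : ℕ} {F : ℝ → ℝ → ℝ} (hF : F ∈ Sep ϖ T e) (κ : ℝ) :
    Continuous (F κ) :=
  (Sep.contDiff hF).continuous.comp (g := fun z : ℝ × ℝ => F z.1 z.2) (f := fun t => (κ, t))
    (by fun_prop)

theorem isNormalForm (hT : 0 < T) {M L b : ℝ} (hL : 0 ≤ L)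
    (hmem : ∀ k, c k ∈ Sep (4 * tau n) T 0)
    (hc : ∀ k κ t, |c k κ t| ≤ M * L ^ k) (hb : 0 < b) (hbL : kpow n (-1) b * (8 * L) ≤ 1)
    (hm : (r₁ : ℤ) + 1 = 2 * n - m)
    (hsum : ∀ K κ t, b ≤ K → ∃ S, HasSum (fun k : ℕ => kpow n (2 * (n : ℤ) - k) K * c k κ t) S) :
    IsNormalForm n T m b (barCoef n c) (lowCoef n c) := by
  refine ⟨fun j _ _ => continuous_time (hmem _) 0, fun j _ _ t => Sep.periodic_time (hmem _) 0 t,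
    fun j _ => Sep.isCoefficient hT (hmem _), ?_⟩
  have hk0 := (kpow_pos (n := n) hb (-1)).le
  have hM : 0 ≤ M := by simpa using (abs_nonneg _).trans (hc 0 0 0)
  let u : ℕ → ℝ := fun k => kpow n (2 * n) b * M * (kpow n (-1) b * L) ^ k
  have hu : Summable u := summable_entry_majorant hb hL hbL
  have hu' : Summable fun j : Set.Iic m => u (2 * (n : ℤ) - j).toNat := by
    rw [← (iicEquiv m).summable_iff]
    have := (summable_nat_add_iff (r₁ + 1)).2 hu
    refine this.congr fun i => ?_
    have e' : (2 * (n : ℤ) - (m - i)).toNat = i + (r₁ + 1) := by omega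
    simp only [Function.comp_apply, iicEquiv, Equiv.coe_fn_mk, e']
  -- The majorant needs powers that do not increase with `K`; the finitely many degrees `0 < j ≤ m`
  -- are set aside.
  have hfin : ∀ᶠ j : Set.Iic m in cofinite, (j : ℤ) ≤ 0 := by
    rw [eventually_cofinite]
    refine Set.Finite.of_finite_image (f := Subtype.val) ?_ Subtype.val_injective.injOn
    refine (Set.finite_Icc (0 : ℤ) m).subset ?_
    rintro _ ⟨j, hj, rfl⟩
    exact ⟨by simp only [mem_ofPred_eq] at hj; omega, j.2⟩
  refine ⟨_, hasSumUniformlyOn_of_hasSum hu' (hfin.mono fun j hj q hq => ?_)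
    (g := fun q => ∑' j : Set.Iic m, kpow n (j : ℤ) q.1 * lowCoef n c (j : ℤ) q.2.1 q.2.2)
    fun q hq => ?_⟩
  · have hq' : b ≤ q.1 := hq
    have h1 : kpow n (j : ℤ) q.1 ≤ kpow n (j : ℤ) b := kpow_le_of_nonpos hb hq' hj
    have h2 := (kpow_pos (n := n) (hb.trans_le hq') (j : ℤ)).le
    have h3 : kpow n (j : ℤ) b = kpow n (2 * n) b * kpow n (-1) b ^ (2 * (n : ℤ) - j).toNat := by
      rw [← kpow_sub hb]
      congr 1
      omega
    have h4 := (kpow_pos (n := n) hb (2 * n)).le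
    rw [Real.norm_eq_abs, abs_mul, abs_of_nonneg h2]
    calc kpow n (j : ℤ) q.1 * |lowCoef n c (j : ℤ) q.2.1 q.2.2|
        ≤ kpow n (j : ℤ) b * (M * L ^ (2 * (n : ℤ) - j).toNat) := by
          gcongr
          · exact h2.trans h1
          · exact hc _ _ _
      _ = _ := by rw [h3]; simp only [u]; rw [mul_pow]; ring
  · obtain ⟨S, hS⟩ := hsum q.1 q.2.1 q.2.2 hq
    have h1 := ((hasSum_nat_add_iff' (r₁ + 1)).2 hS).summable
    refine Summable.hasSum ?_
    rw [← (iicEquiv m).summable_iff]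
    refine h1.congr fun i => ?_
    have e : (2 * (n : ℤ) - ((i + (r₁ + 1) : ℕ) : ℤ)) = m - i := by push_cast; omega
    have e' : (2 * (n : ℤ) - (m - i)).toNat = i + (r₁ + 1) := by omega
    simp only [Function.comp_apply, iicEquiv, Equiv.coe_fn_mk, lowCoef, e, e']

end

/-! ### The new Hamiltonian as the sum of a Lie series -/

section

variable {n : ℕ} {s : Finset ℕ} {w h g : ℕ → ℝ → ℝ → ℝ} {C R₀ M R a b : ℝ}
  {X : ℝ → ℝ → ℝ → ℝ → ℝ × ℝ}

theorem abs_growthRate_le {σ σ' : ℤ} (hC : 0 ≤ C) (h : |σ| ≤ |σ'|) :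
    growthRate σ C R ≤ growthRate σ' C R := by
  have : |(σ : ℝ)| ≤ |(σ' : ℝ)| := by exact_mod_cast h
  unfold growthRate
  gcongr

theorem kpow_mul_egf {K : ℝ} (hK : 0 < K) (σ : ℤ) (ε : ℝ) (u : ℕ → ℝ) :
    kpow n σ K * egf u (ε * kpow n (-1) K) =
      ∑' i : ℕ, ε ^ i / (i.factorial : ℝ) * (kpow n (σ - i) K * u i) := by
  rw [egf, ← tsum_mul_left]
  refine tsum_congr fun i => ?_
  rw [kpow_sub hK, mul_pow]
  ring

/-- The data of a step of the reduction: a generating function, its flow, the coefficients `h` of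
the old Hamiltonian and the coefficients `g` of the remainder. -/
structure LieStep (n : ℕ) (s : Finset ℕ) (w h g : ℕ → ℝ → ℝ → ℝ) (C R₀ M R a b : ℝ)
    (X : ℝ → ℝ → ℝ → ℝ → ℝ × ℝ) : Prop extends LieSetting n s w C R₀ a b X where
  radius : 2 * R₀ ≤ R
  nonneg : 0 ≤ M
  ham : GrowthBound 0 M R h
  rem : GrowthBound 0 M R g
  rem_eq : ∀ j κ t, g j κ t = -timeDeriv (w (j + 1)) κ t
  small : kpow n (-1) a * (8 * growthRate (2 * (n : ℤ)) C R) ≤ 1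

namespace LieStep

theorem one_le_radius (hX : LieStep n s w h g C R₀ M R a b X) : 1 ≤ R := by
  have := hX.bound.one_le
  have := hX.radius
  linarith

theorem small_of_abs_le (hX : LieStep n s w h g C R₀ M R a b X) {σ : ℤ} (hσ : |σ| ≤ 2 * n) :
    kpow n (-1) a * (8 * growthRate σ C R) ≤ 1 := by
  refine le_trans ?_ hX.small
  have := kpow_pos (n := n) hX.pos (-1)
  have := abs_growthRate_le (R := R) hX.bound.nonneg (hσ.trans (le_abs_self _))
  gcongr

theorem one_le_growthRate (hX : LieStep n s w h g C R₀ M R a b X) (σ : ℤ) :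
    1 ≤ growthRate σ C R :=
  hX.one_le_radius.trans (le_growthRate hX.bound.nonneg (zero_le_one.trans hX.one_le_radius))

theorem abs_mul_lt (hX : LieStep n s w h g C R₀ M R a b X) {ε K : ℝ} (hε : ε ∈ Icc (0 : ℝ) 1)
    (hK : a < K) : |ε * kpow n (-1) K| * growthRate (2 * (n : ℤ)) C R < 1 / 4 := by
  have h1 := kpow_le_of_nonpos (n := n) hX.pos hK.le (show (-1 : ℤ) ≤ 0 by norm_num)
  have h0 := kpow_pos (n := n) (hX.pos.trans hK) (-1)
  have hL := hX.one_le_growthRate (2 * (n : ℤ))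
  rw [abs_of_nonneg (mul_nonneg hε.1 h0.le)]
  have h2 : ε * kpow n (-1) K ≤ kpow n (-1) a := (mul_le_of_le_one_left h0.le hε.2).trans h1
  have h3 : ε * kpow n (-1) K * growthRate (2 * (n : ℤ)) C R ≤
      kpow n (-1) a * growthRate (2 * (n : ℤ)) C R := by gcongr
  have := hX.small
  linarith

theorem column_ham (hX : LieStep n s w h g C R₀ M R a b X) :
    GrowthBound 0 M (growthRate (2 * (n : ℤ)) C R) (column n (2 * (n : ℤ)) w h) :=
  GrowthBound.column hX.bound hX.radius hX.nonneg hX.ham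

theorem column_rem (hX : LieStep n s w h g C R₀ M R a b X) :
    GrowthBound 0 M (growthRate (2 * (n : ℤ)) C R) (column n n w g) :=
  (GrowthBound.column hX.bound hX.radius hX.nonneg hX.rem).mono hX.nonneg
    (zero_le_one.trans (hX.one_le_growthRate _)) le_rfl
    (abs_growthRate_le hX.bound.nonneg (by
      rw [abs_of_nonneg (by positivity), abs_of_nonneg (by positivity)]; omega))

theorem flowEntry_rem (hX : LieStep n s w h g C R₀ M R a b X) {ε K : ℝ}
    (hε : ε ∈ Icc (0 : ℝ) 1) (hK : b ≤ K) (κ t : ℝ) :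
    flowEntry n n w g X K κ t 0 ε =
      kpow n n K * egf (fun j => column n n w g j κ t) (ε * kpow n (-1) K) := by
  have h1 := hX.hasSum (σ := n) hX.radius hX.nonneg hX.rem rfl
    (hX.small_of_abs_le (by rw [abs_of_nonneg (by positivity)]; omega)) hK κ t hε
  rw [kpow_mul_egf (hX.pos.trans (hX.le hK)), ← h1.tsum_eq]
  rfl

/-- The transported `-∂W/∂t` equals its Lie series in the initial point `(K, κ)`, which can be
differentiated in space and integrated in `ε` term by term. -/
theorem genPlain_lieMap (hX : LieStep n s w h g C R₀ M R a b X) {ε K : ℝ}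
    (hε : ε ∈ Icc (0 : ℝ) 1) (hK : b ≤ K) (κ t : ℝ) :
    genPlain n s (fun r => timeDeriv (w r)) ε (lieMap X ε (K, κ, t)) =
      -(kpow n n K * egf (fun j => column n n w g j κ t) (ε * kpow n (-1) K)) := by
  have hpos := hX.pos.trans (hX.flow.domain ε hε K κ t hK)
  rw [← hX.flowEntry_rem hε hK κ t, flowEntry, genPlain, genSum]
  simp only [coefTriangle, lieMap, hX.rem_eq]
  rw [egf_eq_sum (u := fun r => -timeDeriv (w r) (X ε K κ t).2 t) hX.one_le fun r hr => by
    rw [hX.zero r hr, Sep.timeDeriv_zero]; simp]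
  rw [Finset.mul_sum, ← Finset.sum_neg_distrib]
  refine Finset.sum_congr rfl fun r hr => ?_
  have := hX.one_le r hr
  rw [genDegree, show (n : ℤ) - r + 1 = n - ((r - 1 : ℕ) : ℤ) by push_cast [this]; ring,
    kpow_sub hpos, mul_pow]
  simp
  ring

/-- The remainder function that enters the new Hamiltonian. -/
theorem hasSum_delay (hX : LieStep n s w h g C R₀ M R a b X) {K : ℝ} (hK : a < K) (κ t : ℝ) :
    HasSum (fun i : ℕ => 1 / ((i + 1).factorial : ℝ) *
        (kpow n (n - i) K * column n n w g i κ t))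
      (kpow n (n + 1) K * egf (fun j => delay (column n n w g) j κ t) (1 * kpow n (-1) K)) := by
  have hK0 := hX.pos.trans hK
  have hL := hX.one_le_growthRate (2 * (n : ℤ))
  have hs := (summable_egf hX.nonneg (zero_le_one.trans hL)
    (hX.abs_mul_lt (right_mem_Icc.2 zero_le_one) hK).le
    ((hX.column_rem.delay hX.nonneg hL).abs_le κ t)).of_norm.hasSum.mul_left (kpow n (n + 1) K)
  rw [← hasSum_nat_add_iff' 1] at hs
  convert! hs using 1
  · funext i
    rw [show (n : ℤ) - i = n + 1 - ((i + 1 : ℕ) : ℤ) by push_cast; ring, kpow_sub hK0, mul_pow]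
    simp only [delay]
    ring
  · simp [delay, egf]

theorem hasSum_ham (hX : LieStep n s w h g C R₀ M R a b X) {K : ℝ} (hK : b ≤ K) (κ t : ℝ) :
    HasSum (fun i : ℕ => 1 / (i.factorial : ℝ) *
        (kpow n (2 * (n : ℤ) - i) K * column n (2 * (n : ℤ)) w h i κ t))
      (flowEntry n (2 * (n : ℤ)) w h X K κ t 0 1) := by
  have h1 := hX.hasSum (σ := 2 * (n : ℤ)) hX.radius hX.nonneg hX.ham rfl
    hX.small hK κ t (right_mem_Icc.2 zero_le_one)
  simp only [one_pow] at h1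
  exact h1

/-- Regrouping by degree: `R_0^i` has degree `n - i = 2n - (n+i)` and so joins `H_0^(n+i)`, while in
the series of the Lie transform it stands beside `H_0^(i+1)`. -/
theorem hasSum_newCoef (hX : LieStep n s w h g C R₀ M R a b X) {K : ℝ} (hK : b ≤ K) (κ t : ℝ) :
    HasSum (fun k : ℕ => kpow n (2 * (n : ℤ) - k) K * newCoef n w h g k κ t)
      (flowEntry n (2 * (n : ℤ)) w h X K κ t 0 1 +
        kpow n (n + 1) K * egf (fun j => delay (column n n w g) j κ t) (1 * kpow n (-1) K)) := by
  have h1 : HasSum (fun k : ℕ => if n ≤ k then 1 / ((k - n + 1).factorial : ℝ) *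
      (kpow n (2 * (n : ℤ) - k) K * column n n w g (k - n) κ t) else 0)
      (kpow n (n + 1) K * egf (fun j => delay (column n n w g) j κ t) (1 * kpow n (-1) K)) := by
    rw [← hasSum_nat_add_iff' n, Finset.sum_eq_zero fun k hk => if_neg (by
      have := Finset.mem_range.1 hk; omega), sub_zero]
    convert! hX.hasSum_delay (hX.le hK) κ t using 2 with k
    rw [if_pos (by omega), Nat.add_sub_cancel,
      show 2 * (n : ℤ) - ((k + n : ℕ) : ℤ) = n - k by push_cast; ring]
  convert! (hX.hasSum_ham hK κ t).add h1 using 2 with k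
  rw [newCoef]
  split_ifs <;> ring

/-- Two lower bounds occur: `a` is large enough for the series to converge, `a₀` bounds the domain
of the old Hamiltonian and need not be large. -/
theorem exists_transformsHam (hX : LieStep n s w h g C R₀ M R a b X) {ϖ T a₀ : ℝ}
    (hw : ∀ r, w r ∈ Sep ϖ T 1) (ha₀ : 0 ≤ a₀) (hflow : IsLieFlow s (genTerm n w) a₀ b X)
    (hlip : ∀ z : ℝ × ℝ × ℝ, b < z.1 → ∃ L, ∀ᶠ z' : ℝ × ℝ × ℝ in 𝓝 z, ∀ ε ∈ Icc (0 : ℝ) 1,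
      ‖X ε z'.1 z'.2.1 z'.2.2 - X ε z.1 z.2.1 z.2.2‖ ≤ L * ‖z' - z‖)
    (hinj : ∀ K κ K' κ' t, b < K → b < K' → X 1 K κ t = X 1 K' κ' t → K = K' ∧ κ = κ')
    {H G : PhaseFun} (hH : ∀ t, DifferentiableOn ℝ (fun z : ℝ × ℝ => H z.1 z.2 t) {z | a₀ < z.1})
    (hG : ∀ K κ t, b < K → G K κ t = H (X 1 K κ t).1 (X 1 K κ t).2 t +
      kpow n (n + 1) K * egf (fun j => delay (column n n w g) j κ t) (1 * kpow n (-1) K)) :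
    ∃ J, IsAreaMap a₀ b (lieMap X 1) J ∧ TransformsHam b H G (X 1) := by
  obtain ⟨J, hJ, hJD⟩ := exists_isAreaMap hX.one_le hw hflow ha₀ hlip hinj
  refine ⟨J, hJ, ?_⟩
  have hL := hX.one_le_growthRate (2 * (n : ℤ))
  have hL0 := zero_le_one.trans hL
  have h01 : (1 : ℝ) ∈ Icc (0 : ℝ) 1 := right_mem_Icc.2 zero_le_one
  -- Delaying the sequence integrates its generating function. This `R` is therefore the integral
  -- over `0 ≤ ε ≤ 1` of `∂W/∂t` along the flow, that is `-∑ R_0^i/(i+1)!`.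
  refine hJ.transformsHam (R := fun K κ t => -(kpow n (n + 1) K *
    egf (fun j => delay (column n n w g) j κ t) (1 * kpow n (-1) K))) hH (fun z hz => ?_)
    fun K κ t hK => ?_
  · have haz : a < z.1 := hX.le (le_of_lt hz)
    have hz0 := hX.pos.trans haz
    have key := fun ε (hε : ε ∈ Icc (0 : ℝ) 1) =>
      hasDerivAt_fderiv_delay (n := n) hX.column_rem hX.nonneg hL hz0 (hX.abs_mul_lt hε haz)
        (n : ℤ) z.2.1 z.2.2
    have hρ := (hasFDerivAt_kpow_egf (n := n) (hX.column_rem.delay hX.nonneg hL) hX.nonneg hL0 hz0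
      (hX.abs_mul_lt h01 haz) ((n : ℤ) + 1) z.2.1 z.2.2).neg
    refine ⟨_, hρ, ?_⟩
    refine hJD z hz _ _ ?_ (fun ε hε => (key ε hε).neg.hasDerivWithinAt) fun ε hε => ?_
    · simp [egf_zero, delay, Sep.angleDeriv_zero]
    · refine (hasFDerivAt_kpow_egf (n := n) hX.column_rem hX.nonneg hL0 hz0
        (hX.abs_mul_lt hε haz) (n : ℤ) z.2.1 z.2.2).neg.congr_of_eventuallyEq ?_
      have : ∀ᶠ y : ℝ × ℝ in 𝓝 (z.1, z.2.1), b < y.1 :=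
        (isOpen_lt continuous_const continuous_fst).mem_nhds hz
      filter_upwards [this] with y hy
      exact hX.genPlain_lieMap hε hy.le y.2 z.2.2
  · rw [hG K κ t hK, sub_neg_eq_add]
    rfl

theorem hasSumUniformlyOn_new (hX : LieStep n s w h g C R₀ M R a b X) {A : ℕ → PhaseFun}
    (hA : ∀ j K κ t, 0 < K → A j K κ t = kpow n (2 * (n : ℤ) - j) K * h j κ t)
    (hrem : ∀ j K κ t, 0 < K → remRows (genTerm n w) j K κ t = kpow n (n - j) K * g j κ t)
    (h0 : h 0 = fun _ _ => ((n : ℝ) + 1) / (2 * n)) {G : PhaseFun}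
    (hG : ∀ K κ t, b ≤ K → G K κ t = flowEntry n (2 * (n : ℤ)) w h X K κ t 0 1 +
      kpow n (n + 1) K * egf (fun j => delay (column n n w g) j κ t) (1 * kpow n (-1) K)) :
    HasSumUniformlyOn (fun (i : ℕ) (q : ℝ × ℝ × ℝ) => 1 / ((i + 1).factorial : ℝ) *
      (lieTriangle (genTerm n w) A (i + 1) 0 q.1 q.2.1 q.2.2
        + lieTriangle (genTerm n w) (remRows (genTerm n w)) i 0 q.1 q.2.1 q.2.2))
      (fun q => G q.1 q.2.1 q.2.2 - leadTerm n q.1) {q | b ≤ q.1} := by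
  have hrow : ∀ i K κ t, 0 < K → lieTriangle (genTerm n w) A i 0 K κ t =
      kpow n (2 * (n : ℤ) - i) K * column n (2 * (n : ℤ)) w h i κ t := fun i K κ t hK => by
    rw [lieTriangle_eq (n := n) (w := w) (W := genTerm n w) (fun r K κ t _ => rfl) hA i 0 K κ t hK,
      Nat.cast_zero, sub_zero, column]
  have hrem' : ∀ i K κ t, 0 < K → lieTriangle (genTerm n w) (remRows (genTerm n w)) i 0 K κ t =
      kpow n (n - i) K * column n n w g i κ t := fun i K κ t hK => by
    rw [lieTriangle_eq (n := n) (w := w) (W := genTerm n w) (fun r K κ t _ => rfl) hrem i 0 K κ t hK,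
      Nat.cast_zero, sub_zero, column]
  have hL0 := fun σ => zero_le_one.trans (hX.one_le_growthRate σ)
  have hn : |(n : ℤ)| ≤ 2 * n := by rw [abs_of_nonneg (by positivity)]; omega
  have hs1 := (summable_nat_add_iff 1).2 (summable_entry_majorant (n := n)
    (D := kpow n (2 * (n : ℤ)) a * M) hX.pos (hL0 (2 * (n : ℤ))) hX.small)
  have hs2 := summable_entry_majorant (n := n) (D := kpow n (n : ℤ) a * M) hX.pos (hL0 n)
    (hX.small_of_abs_le hn)
  refine hasSumUniformlyOn_of_hasSum (hs1.add hs2) ?_ ?_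
  · rw [Nat.cofinite_eq_atTop]
    filter_upwards [eventually_ge_atTop (2 * n)] with i hi q hq
    have hK := hX.le hq
    have hK0 := hX.pos.trans hK
    rw [hrow _ _ _ _ hK0, hrem' _ _ _ _ hK0, mul_add]
    refine (norm_add_le _ _).trans (add_le_add ?_ ?_)
    · exact abs_entry_le hX.bound hX.radius hX.nonneg hX.ham rfl hX.pos hK.le (by push_cast; omega)
        q.2.1 q.2.2
    · refine le_trans ?_ (abs_entry_le (i := i) hX.bound hX.radius hX.nonneg hX.rem rfl hX.pos hK.le
        (by omega) q.2.1 q.2.2)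
      have : i.factorial ≤ (i + 1).factorial := Nat.factorial_le (by omega)
      rw [Real.norm_eq_abs, abs_mul, abs_mul (1 / (i.factorial : ℝ)),
        abs_of_nonneg (show (0 : ℝ) ≤ 1 / ((i + 1).factorial : ℝ) by positivity),
        abs_of_nonneg (show (0 : ℝ) ≤ 1 / (i.factorial : ℝ) by positivity)]
      exact mul_le_mul_of_nonneg_right (one_div_le_one_div_of_le (by positivity)
        (by exact_mod_cast this)) (abs_nonneg _)
  · intro q hq
    have hK0 := hX.pos.trans (hX.le hq)
    have h1 := (hasSum_nat_add_iff' 1).2 (hX.hasSum_ham hq q.2.1 q.2.2)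
    have h2 := h1.add (hX.hasSum_delay (hX.le hq) q.2.1 q.2.2)
    convert! h2 using 1
    · funext i
      rw [hrow _ _ _ _ hK0, hrem' _ _ _ _ hK0, mul_add]
    · rw [hG _ _ _ hq]
      simp [column, coefTriangle, h0, leadTerm]
      ring

end LieStep

end

/-! ### One step of the reduction. -/

section

variable {n : ℕ} {T : ℝ} {s : Finset ℕ} {w h g : ℕ → ℝ → ℝ → ℝ}

theorem kpow_add_one_self {K : ℝ} : kpow n (n + 1) K = K := by
  rw [kpow]
  push_cast
  rw [div_self (by positivity), Real.rpow_one]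

/-- Every finite generating function has a convergent Lie transform for large `K`. -/
theorem exists_lieStep (hn : 2 ≤ n) (hT : 0 < T) (a : ℝ) {ϖ : ℝ} (hs : ∀ r ∈ s, 1 ≤ r)
    (hw0 : ∀ r, r ∉ s → w r = 0) (hw : ∀ r, w r ∈ Sep ϖ T 1)
    (hg : ∀ j, g j = -timeDeriv (w (j + 1)))
    (hh : ∃ M R : ℝ, 0 ≤ M ∧ 1 ≤ R ∧ GrowthBound 0 M R h) :
    ∃ (C R₀ M R a' b : ℝ) (C' k : ℝ≥0) (Y : ℝ × ℝ × ℝ → ℝ → ℝ × ℝ × ℝ), a ≤ a' ∧ 0 < b ∧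
      C' < kpow n 1 b ∧ IsRootFlow n s w C' k Y ∧
      LieStep n s w h g C R₀ M R a' b (rootFlow n Y) ∧
      LieConverges (genTerm n w) (rootFlow n Y) b (constSeries fun K _ _ => K) ∧
      LieConverges (genTerm n w) (rootFlow n Y) b (constSeries fun _ κ _ => κ) := by
  obtain ⟨N, hN⟩ : ∃ N, ∀ r, N ≤ r → w r = 0 := ⟨s.sup id + 1, fun r hr => hw0 r fun hrs => by
    have := Finset.le_sup (f := id) hrs
    simp only [id] at this
    omega⟩
  obtain ⟨C, R₀, hC⟩ := exists_generatorBound (n := n) hT hw hN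
  obtain ⟨M₁, R₁, hM₁, hR₁, h₁⟩ := hh
  obtain ⟨M₂, R₂, hM₂, hR₂, h₂⟩ := exists_growthBound hT (u := g) (e := 0) (N := N)
    (fun l => by rw [hg]; exact Submodule.neg_mem _ (Sep.timeDeriv_mem (hw _))) fun l hl => by
      rw [hg, hN _ (by omega), Sep.timeDeriv_zero, neg_zero]
  obtain ⟨M₃, R₃, hM₃, hR₃, h₃⟩ := exists_growthBound hT (ϖ := ϖ) (e := 1) (N := N)
    (u := fun l κ t => -(((n : ℝ) - l) / ((n : ℝ) + 1) * w (l + 1) κ t))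
    (fun l => Submodule.neg_mem _ (Submodule.smul_mem _ (((n : ℝ) - l) / ((n : ℝ) + 1)) (hw (l + 1))))
    fun l hl => by
      rw [hN _ (by omega)]
      funext κ t
      simp
  -- The coefficients of the function `K`, which has degree `n + 1` and the single coefficient `1`.
  obtain ⟨M₄, R₄, hM₄, hR₄, h₄⟩ := exists_growthBound hT (ϖ := ϖ) (e := 1) (N := 1)
    (u := fun l _ _ => if l = 0 then 1 else 0) (fun l => Sep.const_mem _) fun l hl => by
      rw [if_neg (by omega)]
      rfl
  have hR₀ := hC.one_le
  set M := M₁ + M₂ + M₃ + M₄ with hM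
  set R := R₁ + R₂ + R₃ + R₄ + 2 * R₀ with hR
  have hM0 : 0 ≤ M := by positivity
  obtain ⟨ρ, hρ1, hρ⟩ := exists_kpow_mul_le (n := n) (8 * growthRate (2 * (n : ℤ)) C R)
  obtain ⟨C', k, Y, hY⟩ := exists_isRootFlow (n := n) (s := s) hT hw
  set a' := max a ρ
  have ha1 : 1 ≤ a' := hρ1.trans (le_max_right _ _)
  have hC' : (0 : ℝ) ≤ C' := C'.2
  have hk := kpow_pos (n := n) (zero_lt_one.trans_le ha1) 1
  have hu : 0 < kpow n 1 a' + C' + 1 := by positivity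
  -- In the coordinate `u` the flow moves points by at most `C'`; one more unit makes the inequality
  -- strict.
  set b := (kpow n 1 a' + C' + 1) ^ (n + 1) with hb
  have hb0 : 0 < b := by positivity
  have hkb : kpow n 1 b = kpow n 1 a' + C' + 1 := by rw [hb, kpow_pow hu, zpow_one]
  have hX : LieStep n s w h g C R₀ M R a' b (rootFlow n Y) :=
    { one_le := hs
      zero := hw0
      bound := hC
      pos := zero_lt_one.trans_le ha1
      flow := hY.isLieFlow hs hw0 hw ha1 (by linarith) hb0
      radius := by linarith
      nonneg := hM0
      ham := h₁.mono hM₁ (by linarith) (by linarith) (by linarith)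
      rem := h₂.mono hM₂ (by linarith) (by linarith) (by linarith)
      rem_eq := fun j κ t => by rw [hg]; rfl
      small := hρ _ (le_max_right _ _) }
  refine ⟨C, R₀, M, R, a', b, C', k, Y, le_max_left _ _, hb0, by linarith, hY, hX, ?_, ?_⟩
  · refine hX.lieConverges (σ := n + 1) hX.radius hM0
      (h₄.mono hM₄ (by linarith) (by linarith) (by linarith)) rfl
      (hX.small_of_abs_le (by rw [abs_of_nonneg (by positivity)]; omega)) fun j K κ t _ => ?_
    rcases j with _ | j
    · simp [constSeries, kpow_add_one_self]
    · simp [constSeries]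
  · exact hX.lieConverges_angle hX.radius hM0
      (h₃.mono hM₃ (by linarith) (by linarith) (by linarith)) rfl
      (hX.small_of_abs_le (by norm_num; omega))

/-- The Hamiltonian `H` has, for `K > a`, an expansion with the coefficients `h_i` of
`K ^ ((2 n - i) / (n + 1)) / i!`, the first of which are of class `C^e` in the time. -/
structure IsExpansion (n : ℕ) (T : ℝ) (e : ℕ) (a : ℝ) (h : ℕ → ℝ → ℝ → ℝ) (rows : ℕ → PhaseFun)
    (H : PhaseFun) : Prop where
  zero : h 0 = fun _ _ => ((n : ℝ) + 1) / (2 * n)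
  smooth : ∀ i, i ≤ 2 * n - 2 → h i ∈ Sep (4 * tau n) T e
  mem : ∀ i, h i ∈ Sep (4 * tau n) T 0
  growth : ∃ M R : ℝ, 0 ≤ M ∧ 1 ≤ R ∧ GrowthBound 0 M R h
  rows_eq : ∀ (i : ℕ) (K κ t : ℝ), 0 < K → rows i K κ t = kpow n (2 * (n : ℤ) - i) K * h i κ t
  hasSum : ∀ K κ t, a < K → HasSum (fun i : ℕ => 1 / (i.factorial : ℝ) * rows i K κ t) (H K κ t)
  differentiable : ∀ t, DifferentiableOn ℝ (fun z : ℝ × ℝ => H z.1 z.2 t) {z | a < z.1}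

theorem remRows_genTerm (hg : ∀ j, g j = -timeDeriv (w (j + 1))) (j : ℕ) (K κ t : ℝ) :
    remRows (genTerm n w) j K κ t = kpow n (n - j) K * g j κ t := by
  simp only [remRows, genTerm, deriv_const_mul_field]
  rw [hg, show (n : ℤ) - ((j + 1 : ℕ) : ℤ) + 1 = n - j by push_cast; ring]
  simp [timeDeriv]

/-- The common form of both steps. The condition `r₁ + 1 < n + r₀` keeps the remainder below the
normalized degrees, and `e` records that the new coefficients have one time derivative fewer than
the normalized ones. Surjectivity is kept for every `c`, for use in the composition. -/
theorem exists_lieReduction (hn : 1 < n) (hT : 0 < T) {e r₀ r₁ : ℕ} {m : ℤ} {a : ℝ}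
    {rows : ℕ → PhaseFun} {H : PhaseFun} (ha : 0 ≤ a) (hexp : IsExpansion n T e a h rows H)
    (hr₀ : 1 ≤ r₀) (hm : (r₁ : ℤ) + 1 = 2 * n - m) (hr : r₁ + 1 < n + r₀)
    (hsm : ∀ i ≤ r₁, h i ∈ Sep (4 * tau n) T (e + 1))
    (hlow : ∀ i, 1 ≤ i → i < r₀ → ∀ κ t, h i κ t = h i 0 t) :
    ∃ (W : ℕ → PhaseFun) (X : ℝ → ℝ → ℝ → ℝ → ℝ × ℝ) (fbar : ℤ → ℝ → ℝ) (f : ℤ → ℝ → ℝ → ℝ)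
      (b : ℝ), 0 < b ∧ IsLieReduction n T a b (Finset.Icc r₀ r₁) m H rows W X fbar f ∧
      (∃ h', IsExpansion n T e b h' (normalRows n m fbar f) (normalHam n m fbar f) ∧
        ∀ i, 1 ≤ i → i ≤ r₁ → ∀ κ t, h' i κ t = h' i 0 t) ∧
      ∀ c : ℝ, ∃ c' : ℝ, ∀ t,
        {z : ℝ × ℝ | c' < z.1} ⊆ (fun z : ℝ × ℝ => X 1 z.1 z.2 t) '' {z | c < z.1} := by
  have hn1 : 1 ≤ n := hn.le
  obtain ⟨w, hw, hw0, hmean, hred⟩ := exists_normalizing_generator hn1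
    (by linarith [tau_pos hn1] : 0 < 4 * tau n) hexp.zero hsm hlow
  have hw1 : ∀ r, w r ∈ Sep (4 * tau n) T 1 := fun r => Sep.mono (by omega) (hw r)
  have hwe : ∀ r, w r ∈ Sep (4 * tau n) T e := fun r => Sep.mono (by omega) (hw r)
  have hwz : ∀ r, w r ∈ Sep (4 * tau n) T 0 := fun r => Sep.mono (by omega) (hw r)
  set g : ℕ → ℝ → ℝ → ℝ := fun j => -timeDeriv (w (j + 1)) with hg
  have hge : ∀ j, g j ∈ Sep (4 * tau n) T e := fun j =>
    Submodule.neg_mem _ (Sep.timeDeriv_mem (hw _))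
  have hgz : ∀ j, g j ∈ Sep (4 * tau n) T 0 := fun j => Sep.mono (by omega) (hge j)
  have hs : ∀ r ∈ Finset.Icc r₀ r₁, 1 ≤ r := fun r hr => hr₀.trans (Finset.mem_Icc.1 hr).1
  obtain ⟨C, R₀, M, R, a', b, C', k, Y, haa', hb, hCb, hY, hX, hXK, hXκ⟩ :=
    exists_lieStep (h := h) (g := g) hn hT a hs hw0 hw1 (fun _ => rfl) hexp.growth
  set X := rootFlow n Y with hXdef
  have hflow : IsLieFlow (Finset.Icc r₀ r₁) (genTerm n w) a b X :=
    ⟨hX.flow.init, fun ε hε K κ t hK => haa'.trans_lt (hX.flow.domain ε hε K κ t hK), hX.flow.ode⟩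
  have h01 : (1 : ℝ) ∈ Icc (0 : ℝ) 1 := right_mem_Icc.2 zero_le_one
  have hL := hX.one_le_growthRate (2 * (n : ℤ))
  set L := growthRate (2 * (n : ℤ)) C R
  have hrem := fun j K κ t (_ : 0 < K) =>
    remRows_genTerm (n := n) (w := w) (g := g) (fun _ => rfl) j K κ t
  set c := newCoef n w h g with hc
  have hc0 : c 0 = fun _ _ => ((n : ℝ) + 1) / (2 * n) := by rw [hc, newCoef_zero hn1, hexp.zero]
  have hcmem : ∀ i, c i ∈ Sep (4 * tau n) T 0 := fun i => newCoef_mem hwz hgz fun l _ => hexp.mem l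
  have hcol : ∀ i, 1 ≤ i → i ≤ r₁ → ∀ κ t, column n (2 * (n : ℤ)) w h i κ t =
      column n (2 * (n : ℤ)) w h i 0 t := fun i h1 h2 κ t => by
    have := hred i h1 h2 κ t
    simp only [column]
    push_cast
    exact this
  -- The Hamiltonian part is independent of `κ` by the choice of `w`; the remainder part, if
  -- present, has index `i - n < r₀ - 1` and vanishes.
  have hcred : ∀ i, 1 ≤ i → i ≤ r₁ → ∀ κ t, c i κ t = c i 0 t := fun i h1 h2 κ t => by
    simp only [hc, newCoef]
    rw [hcol i h1 h2 κ t]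
    congr 1
    split_ifs with hni
    · rw [column_normalized hw0 (by omega) fun j hj => by
        simp only [hg, hj, Sep.timeDeriv_zero, neg_zero]]
      rfl
    · rfl
  have hgrow := growthBound_newCoef hX.nonneg hL hX.column_ham hX.column_rem
  have hcb : ∀ i κ t, |c i κ t| ≤ (M + M) * L ^ i := fun i κ t => by
    have h1 := (hgrow.bound i 0 κ t)
    rw [iteratedDeriv_zero, abs_mul, Nat.abs_cast] at h1
    have h2 : (0 : ℝ) < i.factorial := by positivity
    simp only [zero_add, add_zero] at h1
    refine le_of_mul_le_mul_left ?_ h2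
    calc (i.factorial : ℝ) * |c i κ t| ≤ (M + M) * i.factorial * L ^ i := h1
      _ = _ := by ring
  have hsum : ∀ K κ t, b ≤ K → HasSum (fun k : ℕ => kpow n (2 * (n : ℤ) - k) K * c k κ t) _ :=
    fun K κ t hK => hX.hasSum_newCoef hK κ t
  have hham := fun K κ t (hK : b ≤ K) => normalHam_eq hc0 hm hcred (hsum K κ t hK)
  have hlip : ∀ z : ℝ × ℝ × ℝ, b < z.1 → ∃ L, ∀ᶠ z' : ℝ × ℝ × ℝ in 𝓝 z, ∀ ε ∈ Icc (0 : ℝ) 1,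
      ‖X ε z'.1 z'.2.1 z'.2.2 - X ε z.1 z.2.1 z.2.2‖ ≤ L * ‖z' - z‖ := fun z hz =>
    hY.lipschitz (hb.trans hz) z.2.1 z.2.2
  have hval : ∀ K κ t, b ≤ K →
      flowEntry n (2 * (n : ℤ)) w h X K κ t 0 1 = H (X 1 K κ t).1 (X 1 K κ t).2 t := by
    intro K κ t hK
    have h1 := hX.hasSum_epsTerm (σ := 2 * (n : ℤ)) hX.radius hX.nonneg hX.ham rfl hX.small
      hexp.rows_eq hK κ t h01
    refine h1.unique ?_
    simpa [epsTerm] using hexp.hasSum _ _ t (hflow.domain 1 h01 K κ t hK)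
  obtain ⟨J, hJ, htr⟩ := hX.exists_transformsHam hw1 ha hflow hlip
    (fun K κ K' κ' t hK hK' h => hY.injective hb hCb hK.le hK'.le h) hexp.differentiable
    (G := normalHam n m (barCoef n c) (lowCoef n c)) fun K κ t hK => by
      rw [hham K κ t hK.le, hval K κ t hK.le]
  have hrow : ∀ i K κ t, 0 < K → lieTriangle (genTerm n w) rows i 0 K κ t =
      kpow n (2 * (n : ℤ) - i) K * column n (2 * (n : ℤ)) w h i κ t := fun i K κ t hK => by
    rw [lieTriangle_eq (n := n) (w := w) (W := genTerm n w) (fun r K κ t _ => rfl) hexp.rows_eq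
      i 0 K κ t hK, Nat.cast_zero, sub_zero, column]
  have hcolmem : ∀ i, column n (2 * (n : ℤ)) w h i ∈ Sep (4 * tau n) T 0 := fun i =>
    column_mem hwz fun l _ => hexp.mem l
  have hnrow := normalRows_eq hc0 hm hcred
  refine ⟨genTerm n w, X, barCoef n c, lowCoef n c, b, hb, ?_,
    ⟨fun i κ t => (i.factorial : ℝ) * c i κ t, ?_, ?_⟩, hY.surjective⟩
  · refine
      { generator := ⟨fun r _ => ⟨w r, Sep.isCoefficient hT (hw r), Sep.contDiff (hw1 r), hmean r,
          fun K κ t _ => rfl⟩, fun r hr => ?_⟩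
        flow := hflow
        converges_K := hXK
        converges_angle := hXκ
        converges_ham := hX.lieConverges hX.radius hX.nonneg hX.ham rfl hX.small hexp.rows_eq
        converges_rem := hX.lieConverges (σ := n) hX.radius hX.nonneg hX.rem rfl
          (hX.small_of_abs_le (by rw [abs_of_nonneg (by positivity)]; omega)) hrem
        reduced := fun i h1 h2 => ⟨column n (2 * (n : ℤ)) w h i 0, continuous_time (hcolmem i) 0,
          Sep.periodic_time (hcolmem i) 0, fun K κ t hK => by
            rw [hrow i K κ t (ha.trans_lt hK), hcol i h1 (by omega) κ t]⟩
        rows := fun i => ⟨column n (2 * (n : ℤ)) w h i, Sep.isCoefficient hT (hcolmem i),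
          fun K κ t hK => hrow i K κ t (ha.trans_lt hK)⟩
        rem_rows := fun i => ⟨column n n w g i, Sep.isCoefficient hT (column_mem hwz fun l _ => hgz l),
          fun K κ t hK => by
            rw [lieTriangle_eq (n := n) (w := w) (W := genTerm n w) (fun r K κ t _ => rfl) hrem
              i 0 K κ t (ha.trans_lt hK), Nat.cast_zero, sub_zero, column]⟩
        normal_form := isNormalForm hT (zero_le_one.trans hL) hcmem hcb hb ?_ hm
          fun K κ t hK => ⟨_, hsum K κ t hK⟩
        new_ham := hX.hasSumUniformlyOn_new hexp.rows_eq hrem hexp.zero hham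
        change := ?_
        transforms := htr }
    · funext K κ t
      simp [genTerm, hw0 r hr]
    · refine le_trans ?_ hX.small
      -- The initial points of the flow already lie in its range `K > a'`, hence `a' < b` and
      -- smallness at `a'` passes to `b`.
      have := kpow_le_of_nonpos (n := n) hX.pos (hX.le le_rfl).le (show (-1 : ℤ) ≤ 0 by norm_num)
      have hL0 := zero_le_one.trans hL
      gcongr
    · refine hJ.isSymplecticChange (fun K κ t _ => ?_) (fun K κ t _ => ?_) ?_
      · have := hY.rootFlow_angle hw1 h01 K κ t
        simp [lieMap, hXdef, this]
      · have := hY.rootFlow_time hw1 h01 K κ t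
        simp [lieMap, hXdef, this]
      · exact hY.surjective b
  · refine ⟨?_, fun i hi => ?_, fun i => Submodule.smul_mem _ (i.factorial : ℝ) (hcmem i),
      ⟨M + M, L, by linarith [hX.nonneg], hL, hgrow⟩, fun i K κ t _ => hnrow i K κ t,
      fun K κ t hK => ?_, htr.1⟩
    · simp [hc0]
    · exact Submodule.smul_mem _ (i.factorial : ℝ)
        (newCoef_mem hwe hge fun l hl => hexp.smooth l (by omega))
    · rw [hham K κ t hK.le]
      convert! hsum K κ t hK.le using 2 with i
      rw [hnrow]
      have : (i.factorial : ℝ) ≠ 0 := by positivity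
      field_simp
  · intro i h1 h2 κ t
    change (i.factorial : ℝ) * c i κ t = (i.factorial : ℝ) * c i 0 t
    rw [hcred i h1 h2 κ t]

end

/-! ### Composition of the changes of variables -/

section

variable {n : ℕ} {T a b c : ℝ} {Φ Ψ : ℝ → ℝ → ℝ → ℝ × ℝ}

/-- An image containing a neighbourhood of infinity is not enough for the outer map: it must cover
one already from `{K > d}`, where `{K > d}` lies in the image of the inner map. -/
theorem IsSymplecticChange.comp (hΦ : IsSymplecticChange n T a b Φ)
    (hΨ : IsSymplecticChange n T b c Ψ)
    (hsurj : ∀ d : ℝ, ∃ d' : ℝ, ∀ t,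
      {z : ℝ × ℝ | d' < z.1} ⊆ (fun z : ℝ × ℝ => Φ z.1 z.2 t) '' {z | d < z.1}) :
    IsSymplecticChange n T a c fun K κ t => Φ (Ψ K κ t).1 (Ψ K κ t).2 t where
  maps K κ t hK := hΦ.maps _ _ t (hΨ.maps K κ t hK)
  contDiff := hΦ.contDiff.comp (g := fun q : ℝ × ℝ × ℝ => Φ q.1 q.2.1 q.2.2)
    (f := fun q : ℝ × ℝ × ℝ => ((Ψ q.1 q.2.1 q.2.2).1, (Ψ q.1 q.2.1 q.2.2).2, q.2.2))
    ((contDiff_fst.comp_contDiffOn hΨ.contDiff).prodMk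
      ((contDiff_snd.comp_contDiffOn hΨ.contDiff).prodMk
        (contDiff_snd.comp contDiff_snd).contDiffOn)) fun q hq => hΨ.maps _ _ _ hq
  angle K κ t hK := by
    have := hΦ.angle _ (Ψ K κ t).2 t (hΨ.maps K κ t hK)
    rw [hΨ.angle K κ t hK]
    simpa using this
  periodic_time K κ t hK := by
    rw [hΨ.periodic_time K κ t hK, hΦ.periodic_time _ _ _ (hΨ.maps K κ t hK)]
  symplectic K κ t hK u v := by
    have hd : ∀ {b' : ℝ} {Θ : ℝ → ℝ → ℝ → ℝ × ℝ},
        ContDiffOn ℝ 1 (fun q : ℝ × ℝ × ℝ => Θ q.1 q.2.1 q.2.2) {q | b' < q.1} → ∀ z : ℝ × ℝ,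
        b' < z.1 → DifferentiableAt ℝ (fun z : ℝ × ℝ => Θ z.1 z.2 t) z := fun {b' Θ} h z hz => by
      have hm : {q : ℝ × ℝ × ℝ | b' < q.1} ∈ 𝓝 (z.1, z.2, t) :=
        (isOpen_lt continuous_const continuous_fst).mem_nhds hz
      have h1 := ((h.contDiffAt hm).differentiableAt (by simp))
      exact DifferentiableAt.comp z (g := fun q : ℝ × ℝ × ℝ => Θ q.1 q.2.1 q.2.2)
        (f := fun z : ℝ × ℝ => (z.1, z.2, t)) h1 (by fun_prop)
    have h1 := hd hΨ.contDiff (K, κ) hK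
    have h2 := hd hΦ.contDiff (Ψ K κ t) (hΨ.maps K κ t hK)
    have h3 := HasFDerivAt.comp (g := fun z : ℝ × ℝ => Φ z.1 z.2 t)
      (f := fun z : ℝ × ℝ => Ψ z.1 z.2 t) (K, κ) h2.hasFDerivAt h1.hasFDerivAt
    have h4 : HasFDerivAt (fun z : ℝ × ℝ => Φ (Ψ z.1 z.2 t).1 (Ψ z.1 z.2 t).2 t) _ (K, κ) := h3
    simp only [h4.fderiv, ContinuousLinearMap.comp_apply]
    have e1 := hΦ.symplectic _ (Ψ K κ t).2 t (hΨ.maps K κ t hK)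
      (fderiv ℝ (fun z : ℝ × ℝ => Ψ z.1 z.2 t) (K, κ) u)
      (fderiv ℝ (fun z : ℝ × ℝ => Ψ z.1 z.2 t) (K, κ) v)
    simp only [Prod.mk.eta] at e1
    exact e1.trans (hΨ.symplectic K κ t hK u v)
  injective t z hz z' hz' h := hΨ.injective t hz hz'
    (hΦ.injective t (hΨ.maps _ _ t hz) (hΨ.maps _ _ t hz') h)
  surjective := by
    obtain ⟨d, hd⟩ := hΨ.surjective
    obtain ⟨d', hd'⟩ := hsurj d
    refine ⟨d', fun t z hz => ?_⟩
    obtain ⟨y, hy, rfl⟩ := hd' t hz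
    obtain ⟨x, hx, rfl⟩ := hd t hy
    exact ⟨x, hx, rfl⟩

theorem TransformsHam.comp {H H' G : PhaseFun} (hΦ : TransformsHam b H H' Φ)
    (hΨ : TransformsHam c H' G Ψ) (hmaps : ∀ K κ t, c < K → b < (Ψ K κ t).1) :
    TransformsHam c H G fun K κ t => Φ (Ψ K κ t).1 (Ψ K κ t).2 t :=
  ⟨hΨ.1, fun α β y hy => (hΨ.2 α β y hy).trans
    (hΦ.2 α β (fun t => Ψ (y t).1 (y t).2 t) fun t ht => hmaps _ _ t (hy t ht))⟩

end

/-! ### The original Hamiltonian -/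

section

variable {n : ℕ} {T : ℝ} {p : ℕ → ℝ → ℝ}

theorem origCoeff_mem (hn : 1 ≤ n) {e j : ℕ} (hp : ContDiff ℝ e (p (j - 1)))
    (hT : Function.Periodic (p (j - 1)) T) : origCoeff n p j ∈ Sep (4 * tau n) T e := by
  have h := Submodule.smul_mem _ (-(((n : ℝ) + 1) / ((j : ℝ) * (n : ℝ))))
    (Sep.tensor_mem (((uniformlyAnalytic_sn hn)).pow j)
      (fun κ => congrArg (· ^ j) (sn_periodic hn κ)) hp hT)
  convert! h using 1
  funext κ t
  simp [origCoeff]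
  ring

/-- The coefficients of the rows of the original Hamiltonian. -/
noncomputable def origSeq (n : ℕ) (p : ℕ → ℝ → ℝ) (i : ℕ) : ℝ → ℝ → ℝ :=
  if i = 0 then fun _ _ => ((n : ℝ) + 1) / (2 * n)
  else if i ≤ 2 * n - 1 then (i.factorial : ℝ) • origCoeff n p (2 * n - i) else 0

theorem origSeq_mem (hn : 1 ≤ n) {e i : ℕ} (hper : ∀ j, j ≤ 2 * n - 2 → Function.Periodic (p j) T)
    (hp : 1 ≤ i → i ≤ 2 * n - 1 → ContDiff ℝ e (p (2 * n - 1 - i))) :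
    origSeq n p i ∈ Sep (4 * tau n) T e := by
  unfold origSeq
  split_ifs with h0 h1
  · exact Sep.const_mem _
  · have e1 : 2 * n - i - 1 = 2 * n - 1 - i := by omega
    refine Submodule.smul_mem _ _ (origCoeff_mem hn ?_ ?_)
    · rw [e1]; exact hp (by omega) h1
    · exact hper _ (by omega)
  · exact Submodule.zero_mem _

theorem isExpansion_orig (hn : 1 < n) (hT : 0 < T)
    (hper : ∀ j, j ≤ 2 * n - 2 → Function.Periodic (p j) T) (hp0 : Continuous (p 0))
    (hp1 : ∀ j, 1 ≤ j → j ≤ 2 * n - 2 → ContDiff ℝ 1 (p j)) :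
    IsExpansion n T 1 0 (origSeq n p) (origRows n p) (origHam n p) := by
  have hmem : ∀ i, origSeq n p i ∈ Sep (4 * tau n) T 0 := fun i =>
    -- The index `2n - 1` carries `p 0`, which is merely continuous; all other coefficients are
    -- `C^1` in time.
    origSeq_mem hn.le hper fun h1 h2 => by
      rcases Nat.eq_zero_or_pos (2 * n - 1 - i) with h | h
      · rw [h]; exact contDiff_zero.2 hp0
      · exact (hp1 _ h (by omega)).of_le (by simp)
  have hrow : ∀ (i : ℕ) (K κ t : ℝ),
      origRows n p i K κ t = kpow n (2 * (n : ℤ) - i) K * origSeq n p i κ t := by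
    intro i K κ t
    unfold origRows origSeq
    split_ifs with h0
    · simp [h0, leadTerm, mul_comm]
    · simp
      ring
    · simp
  refine ⟨by simp [origSeq], fun i hi => origSeq_mem hn.le hper fun h1 h2 => ?_, hmem,
    exists_growthBound hT hmem (N := 2 * n) fun i hi => ?_, fun i K κ t _ => hrow i K κ t,
    fun K κ t hK => ?_, fun t z hz => ?_⟩
  · exact_mod_cast hp1 _ (by omega) (by omega)
  · simp only [origSeq]
    rw [if_neg (by omega), if_neg (by omega)]
  · have h1 := hasSum_sum_of_ne_finset_zero (L := SummationFilter.unconditional ℕ) (s := Finset.range (2 * n - 1 + 1))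
      (f := fun i : ℕ => 1 / (i.factorial : ℝ) * origRows n p i K κ t) fun i hi => by
        rw [Finset.mem_range] at hi
        simp only [origRows]
        rw [if_neg (by omega), if_neg (by omega)]
        simp
    convert! h1 using 1
    rw [Finset.sum_range_succ', origHam, add_comm]
    congr 1
    · refine Finset.sum_nbij' (fun j => 2 * n - 1 - j) (fun i => 2 * n - 1 - i) ?_ ?_ ?_ ?_ ?_
      · intro j hj
        simp only [Finset.mem_Icc, Finset.mem_range] at hj ⊢
        omega
      · intro i hi
        simp only [Finset.mem_Icc, Finset.mem_range] at hi ⊢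
        omega
      · intro j hj
        simp only [Finset.mem_Icc] at hj
        omega
      · intro i hi
        simp only [Finset.mem_range] at hi
        omega
      · intro j hj
        simp only [Finset.mem_Icc] at hj
        have e1 : 2 * (n : ℤ) - ((2 * n - 1 - j + 1 : ℕ) : ℤ) = j := by omega
        have e2 : 2 * n - (2 * n - 1 - j + 1) = j := by omega
        have : ((2 * n - 1 - j + 1).factorial : ℝ) ≠ 0 := by positivity
        simp only [origRows]
        rw [if_neg (by omega), if_pos (by omega), e1, e2]
        field_simp
    · simp [origRows]
  · have hz : 0 < z.1 := hz
    have hk : ∀ j : ℤ, DifferentiableAt ℝ (fun z : ℝ × ℝ => kpow n j z.1) z := fun j =>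
      DifferentiableAt.comp (g := kpow n j) z (hasDerivAt_kpow hz j).differentiableAt
        differentiableAt_fst
    have hs : DifferentiableAt ℝ (fun z : ℝ × ℝ => sn n z.2) z :=
      DifferentiableAt.comp (g := sn n) z ((sn_isRefSolution hn.le).differentiable _)
        differentiableAt_snd
    refine DifferentiableAt.differentiableWithinAt ?_
    unfold origHam leadTerm origCoeff
    refine ((hk _).const_mul _).add (DifferentiableAt.fun_sum fun j _ => (hk _).mul ?_)
    exact ((hs.pow j).const_mul _).mul_const _

end

end LieOscillator

/-! ### The two reduction steps and their composition. -/

theorem mainTheorem3 (n : ℕ) (hn : 1 < n) (T : ℝ) (hT : 0 < T) (p : ℕ → ℝ → ℝ)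
    (hper : ∀ j, j ≤ 2 * n - 2 → Function.Periodic (p j) T)
    (hp0 : Continuous (p 0))
    (hp1 : ∀ j, 1 ≤ j → j ≤ n - 1 → ContDiff ℝ 1 (p j))
    (hp2 : ∀ j, n ≤ j → j ≤ 2 * n - 2 → ContDiff ℝ 2 (p j)) :
    ∃ (W₁ W₂ : ℕ → LieOscillator.PhaseFun) (X₁ X₂ : ℝ → ℝ → ℝ → ℝ → ℝ × ℝ)
      (fbar₁ fbar : ℤ → ℝ → ℝ) (f₁ f : ℤ → ℝ → ℝ → ℝ) (K₁ K₂ : ℝ),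
      0 < K₁ ∧ 0 < K₂ ∧
      LieOscillator.IsLieReduction n T 0 K₁ (Finset.Icc 1 (n - 1)) n
        (LieOscillator.origHam n p) (LieOscillator.origRows n p) W₁ X₁ fbar₁ f₁ ∧
      LieOscillator.IsLieReduction n T K₁ K₂ (Finset.Icc n (2 * n - 2)) 1
        (LieOscillator.normalHam n n fbar₁ f₁) (LieOscillator.normalRows n n fbar₁ f₁)
        W₂ X₂ fbar f ∧
      LieOscillator.IsSymplecticChange n T 0 K₂
        (fun K κ t => X₁ 1 (X₂ 1 K κ t).1 (X₂ 1 K κ t).2 t) ∧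
      LieOscillator.TransformsHam K₂ (LieOscillator.origHam n p)
        (LieOscillator.normalHam n 1 fbar f)
        (fun K κ t => X₁ 1 (X₂ 1 K κ t).1 (X₂ 1 K κ t).2 t) := by

  have hp1' : ∀ j, 1 ≤ j → j ≤ 2 * n - 2 → ContDiff ℝ 1 (p j) := fun j h1 h2 => by
    rcases le_or_gt j (n - 1) with h | h
    · exact hp1 j h1 h
    · exact (hp2 j (by omega) h2).of_le (by norm_num)
  have h1 := LieOscillator.isExpansion_orig hn hT hper hp0 hp1'
  obtain ⟨W₁, X₁, fbar₁, f₁, K₁, hK₁, hred₁, ⟨h', hexp', hlow'⟩, hsurj₁⟩ :=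
    -- The indices `1 ≤ i ≤ n - 1` involve `p (2n-1-i)` with index at least `n`, which is `C^2`. The
    -- generator is then `C^2` in time and the remainder `C^1`.
    LieOscillator.exists_lieReduction (e := 1) (r₀ := 1) (r₁ := n - 1) (m := n) hn hT le_rfl h1
      le_rfl (by push_cast [hn.le]; ring) (by omega)
      (fun i hi => LieOscillator.origSeq_mem hn.le hper fun _ _ => hp2 _ (by omega) (by omega))
      fun i hi hi' => by omega
  have h2 : LieOscillator.IsExpansion n T 0 K₁ h' (LieOscillator.normalRows n n fbar₁ f₁)
      (LieOscillator.normalHam n n fbar₁ f₁) := { hexp' with smooth := fun i _ => hexp'.mem i }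
  obtain ⟨W₂, X₂, fbar, f, K₂, hK₂, hred₂, -, -⟩ :=
    -- The coefficients of index at most `2n - 2` are still `C^1`, and those of index below `n` are
    -- already free of `κ`, so the generator may start at `r = n` and its remainder has degree at
    -- most `1`.
    LieOscillator.exists_lieReduction (e := 0) (r₀ := n) (r₁ := 2 * n - 2) (m := 1) hn hT hK₁.le h2
      hn.le (by omega) (by omega) (fun i hi => hexp'.smooth i hi)
      fun i hi hi' => hlow' i hi (by omega)
  exact ⟨W₁, W₂, X₁, X₂, fbar₁, fbar, f₁, f, K₁, K₂, hK₁, hK₂, hred₁, hred₂,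
    hred₁.change.comp hred₂.change hsurj₁, hred₁.transforms.comp hred₂.transforms hred₂.change.maps⟩
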